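/- Let $0\le k\le n$ be integers and write $[n]=\{1,\dots,n\}$. For $k$-element subsets $I=\{i_1<\dots<i_k\}$ and $J=\{j_1<\dots<j_k\}$ of $[n]$, write $I\le J$ if $i_m\le j_m$ for all $m$. Consider the following five ordered sets. 1. $\mathcal Q(k,n)$. On $S_n$, let $\ell$ be the number of inversions, let $\le$ be Bruhat order, and let the $k$-Bruhat order $\le_k$ be the reflexive transitive closure of the Bruhat covers $u\lessdot v$ with $u([k])\ne v([k])$. The elements of $\mathcal Q(k,n)$ are the classes $\langle u,w\rangle$ of $k$-Bruhat intervals $[u,w]_k$ (where $u\le_k w$) under the equivalence relation generated by $[u,w]_k\sim[uz,wz]_k$, where $z\in S_k\times S_{n-k}$ satisfies $\ell(uz)=\ell(u)+\ell(z)$ and $\ell(wz)=\ell(w)+\ell(z)$. The order is by reverse inclusion: $q\le q'$ if and only if there are representatives $[u,w]_k$ of $q$ and $[u',w']_k$ of $q'$ whose ordinary Bruhat intervals satisfy $[u',w']\subseteq[u,w]$. 2. $\mathrm{Bound}(k,n)$, the bijections $f:\mathbb Z\to\mathbb Z$ such that $f(i+n)=f(i)+n$ and $i\le f(i)\le i+n$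 for all $i$, and $\sum_{i=1}^n(f(i)-i)=kn$, with the restriction of the Bruhat order on affine permutations. (The latter is generated by $f<ft$ when $t$ is an affine reflection, exchanging $i+mn$ and $j+mn$ for all $m\in\mathbb Z$ with $i\not\equiv j \bmod n$ and fixing all other integers, and $\ell(f)<\ell(ft)$. Here $\ell(f)$ is the number of pairs $i<j$ with $f(i)>f(j)$, counted up to simultaneous translation by multiples of $n$.) 3. $\mathrm{Jugg}(k,n)$, the sequences $\mathcal J=(J_1,\dots,J_n)$ of $k$-element subsets of $[n]$ such that, for each $i$ (indices modulo $n$), $\mathbb Z_{\le0}\cup J_{i+1}$ is obtained from $\mathbb Z_{\le 0}\cup J_i$ by subtracting $1$ from all elements and then adding one new element. The order is componentwise. 4. The cyclic rank matrices of type $(k,n)$: the integer matrices $(r_{ij})_{i,j\in\mathbb Z}$ such that $r_{ij}=j-i+1$ for $j<i$; $r_{ij}=k$ for $j\ge i+n-1$; $r_{ij}-r_{(i+1)j}\in\{0,1\}$ and $r_{ij}-r_{i(j-1)}\in\{0,1\}$; if $r_{(i+1)(j-1)}=r_{(i+1)j}=r_{i(j-1)}$ then $r_{ij}=r_{(i+1)(j-1)}$;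 and $r_{(i+n)(j+n)}=r_{ij}$. The order is the reverse entrywise order: $r\le s$ if and only if $r_{ij}\ge s_{ij}$ for all $i,j$. 5. The positroids of rank $k$ on $[n]$: the matroids on $[n]$ whose set of bases is $\mathcal M_{\mathcal J}=\{I\in\binom{[n]}{k} : \chi^{-r+1}(I)\ge J_r \text{ for all } r\in[n]\}$ for some $\mathcal J\in\mathrm{Jugg}(k,n)$, where $\chi$ is the $n$-cycle $1\mapsto2\mapsto\cdots\mapsto n\mapsto1$. The order is reverse inclusion of the sets of bases. **Theorem.** These are five partially ordered sets, and they are all isomorphic. Explicitly, the following maps are well defined and are isomorphisms of posets: * $\mathcal Q(k,n)\to\mathrm{Bound}(k,n)$, $\langle u,w\rangle\mapsto f_{u,w}$, where for $a\in[n]$ one has $f_{u,w}(w(a))=u(a)+n$ if $a\le k$ and $f_{u,w}(w(a))=u(a)$ if $a>k$; * $\mathrm{Bound}(k,n)\to\mathrm{Jugg}(k,n)$, $f\mapsto\mathcal J(f)=(J_1,\dots,J_n)$, where $J_r=\{f(i)-(r-1) : i\le r-1\}\cap[n]$; * $f\mapsto (r_{ij})$ from $\mathrm{Bound}(k,n)$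 to cyclic rank matrices, where for $i\in[n]$, $j\in\mathbb Z$ and $\mathcal J(f)=(J_1,\dots,J_n)$ one has $r_{ij}=k-\#\{x\in J_i\cup\mathbb Z_{\le0} : x>j-i+1\}$; moreover, for all $i,j\in\mathbb Z$, $f(i)=j$ if and only if $r_{ij}=r_{(i+1)j}=r_{i(j-1)}>r_{(i+1)(j-1)}$; * $\mathcal J\mapsto\mathcal M_{\mathcal J}$ from $\mathrm{Jugg}(k,n)$ to positroids of rank $k$ on $[n]$, whose inverse sends $\mathcal M$ to $(J_1,\dots,J_n)$, where $J_r$ is the least element of $\chi^{-r+1}(\mathcal M)=\{\chi^{-r+1}(I) : I \text{ a basis of } \mathcal M\}$. -/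

import Mathlib

namespace PositroidPosets

/-! The set `[n] = {1, …, n}` is modelled by `Fin n`: the element `a : Fin n` stands for the
integer `a + 1`. -/

/-! ### Generalities -/

theorem eq_or_lt_of_reflTransGen {α : Type*} {s : α → α → Prop} (len : α → ℕ)
    (hs : ∀ a b, s a b → len a < len b) {a b : α} (h : Relation.ReflTransGen s a b) :
    a = b ∨ len a < len b := by
  induction h with
  | refl => exact Or.inl rfl
  | tail _ hbc ih =>
    rcases ih with rfl | h
    · exact Or.inr (hs _ _ hbc)
    · exact Or.inr (h.trans (hs _ _ hbc))

/-! ### `k`-element subsets of `[n]` -/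

/-- The `k`-element subsets of `[n]`. -/
def KSubset (k n : ℕ) : Type := {s : Finset (Fin n) // s.card = k}

/-- `{i₁ < ⋯ < i_k} ≤ {j₁ < ⋯ < j_k}` if and only if `i_m ≤ j_m` for all `m`. -/
instance (k n : ℕ) : PartialOrder (KSubset k n) where
  le I J := ∀ m : Fin k, I.1.orderEmbOfFin I.2 m ≤ J.1.orderEmbOfFin J.2 m
  le_refl _ _ := le_rfl
  le_trans _ _ _ h₁ h₂ m := (h₁ m).trans (h₂ m)
  le_antisymm I J h₁ h₂ := by
    have h : (I.1.orderEmbOfFin I.2 : Fin k → Fin n) = J.1.orderEmbOfFin J.2 :=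
      funext fun m => le_antisymm (h₁ m) (h₂ m)
    apply Subtype.ext
    rw [← Finset.coe_inj, ← Finset.range_orderEmbOfFin I.1 I.2,
      ← Finset.range_orderEmbOfFin J.1 J.2, h]

/-- The image `χ⁻ʳ(I)` of `I` under the `r`-th power of the inverse of the long cycle
`χ = [2 3 ⋯ n 1]`. -/
def rotateBack {k n : ℕ} (r : ℕ) (I : KSubset k n) : KSubset k n :=
  ⟨I.1.map ((finRotate n ^ r)⁻¹).toEmbedding, by rw [Finset.card_map]; exact I.2⟩

/-! ### The symmetric group: Bruhat order, `k`-Bruhat order, and `Q(k,n)` -/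

/-- The length of a permutation: its number of inversions. -/
def permLength {n : ℕ} (w : Equiv.Perm (Fin n)) : ℕ :=
  (Finset.univ.filter fun p : Fin n × Fin n => p.1 < p.2 ∧ w p.2 < w p.1).card

/-- Right multiplication by a transposition that increases the length. -/
def BruhatStep {n : ℕ} (u v : Equiv.Perm (Fin n)) : Prop :=
  ∃ a b : Fin n, a ≠ b ∧ v = u * Equiv.swap a b ∧ permLength u < permLength v

/-- The Bruhat (strong) order on the symmetric group. -/
def BruhatLE {n : ℕ} (u v : Equiv.Perm (Fin n)) : Prop :=
  Relation.ReflTransGen BruhatStep u v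

/-- `v` covers `u` in Bruhat order. -/
def BruhatCover {n : ℕ} (u v : Equiv.Perm (Fin n)) : Prop :=
  BruhatLE u v ∧ u ≠ v ∧ ∀ x, BruhatLE u x → BruhatLE x v → x = u ∨ x = v

/-- `σ_k(w) = w([k])`. -/
def sigma {n : ℕ} (k : ℕ) (w : Equiv.Perm (Fin n)) : Set (Fin n) :=
  {x | ∃ a : Fin n, (a : ℕ) < k ∧ w a = x}

/-- `v` covers `u` in `k`-Bruhat order. -/
def KBruhatCover {n : ℕ} (k : ℕ) (u v : Equiv.Perm (Fin n)) : Prop :=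
  BruhatCover u v ∧ sigma k u ≠ sigma k v

/-- The `k`-Bruhat order. -/
def KBruhatLE {n : ℕ} (k : ℕ) (u v : Equiv.Perm (Fin n)) : Prop :=
  Relation.ReflTransGen (KBruhatCover k) u v

/-- The parabolic subgroup `S_k × S_{n-k}`, as a predicate. -/
def IsParabolic {n : ℕ} (k : ℕ) (z : Equiv.Perm (Fin n)) : Prop :=
  ∀ a : Fin n, (a : ℕ) < k ↔ (z a : ℕ) < k

/-- The `k`-Bruhat intervals `[u,w]_k` (with `u ≤_k w`), recorded by their end points. -/
def KInterval (k n : ℕ) : Type :=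
  {p : Equiv.Perm (Fin n) × Equiv.Perm (Fin n) // KBruhatLE k p.1 p.2}

/-- The generating relation `[u,w]_k ∼ [uz,wz]_k`, for `z ∈ S_k × S_{n-k}` such that both products
are length-additive. -/
def KInterval.Rel {k n : ℕ} (p q : KInterval k n) : Prop :=
  ∃ z : Equiv.Perm (Fin n), IsParabolic k z ∧
    q.1.1 = p.1.1 * z ∧ permLength q.1.1 = permLength p.1.1 + permLength z ∧
    q.1.2 = p.1.2 * z ∧ permLength q.1.2 = permLength p.1.2 + permLength z

/-- `Q(k,n)`: the classes of `k`-Bruhat intervals for the equivalence relation generated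
by `KInterval.Rel`. -/
def PairClass (k n : ℕ) : Type := Quot (@KInterval.Rel k n)

/-- The class `⟨u,w⟩` of a `k`-Bruhat interval. -/
def PairClass.mk {k n : ℕ} (u w : Equiv.Perm (Fin n)) (h : KBruhatLE k u w) : PairClass k n :=
  Quot.mk _ ⟨(u, w), h⟩

/-- The interval `[u,w]` in (ordinary) Bruhat order. -/
def bruhatInterval {n : ℕ} (u w : Equiv.Perm (Fin n)) : Set (Equiv.Perm (Fin n)) :=
  {v | BruhatLE u v ∧ BruhatLE v w}

/-- The order on `Q(k,n)`, by reverse inclusion: `q ≤ q'` if and only if there are representatives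
`[u,w]_k` of `q` and `[u',w']_k` of `q'` with `[u',w'] ⊆ [u,w]`. -/
instance (k n : ℕ) : LE (PairClass k n) where
  le q q' := ∃ (u w u' w' : Equiv.Perm (Fin n)) (h : KBruhatLE k u w) (h' : KBruhatLE k u' w'),
    q = PairClass.mk u w h ∧ q' = PairClass.mk u' w' h' ∧
      bruhatInterval u' w' ⊆ bruhatInterval u w

/-- The values of `f_{u,w} = u t_{ω_k} w⁻¹` on `1, …, n` (the entry at `i : Fin n` is the value at
the integer `i + 1`): `f_{u,w}(w(a))` is `u(a) + n` if `a ≤ k` and `u(a)` if `a > k`. -/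
def pairWindow {n : ℕ} (k : ℕ) (u w : Equiv.Perm (Fin n)) (i : Fin n) : ℤ :=
  ((u (w⁻¹ i) : ℕ) : ℤ) + 1 + if ((w⁻¹ i : Fin n) : ℕ) < k then (n : ℤ) else 0

/-! ### Affine permutations -/

/-- The group of affine permutations. -/
def affinePerm (n : ℕ) : Subgroup (Equiv.Perm ℤ) where
  carrier := {f | ∀ i : ℤ, f (i + n) = f i + n}
  mul_mem' {f g} hf hg i := by
    change f (g (i + n)) = f (g i) + n
    rw [hg i, hf (g i)]
  one_mem' _ := rfl
  inv_mem' {f} hf i := by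
    apply f.injective
    change f (f.symm (i + n)) = f (f.symm i + n)
    rw [hf (f.symm i), Equiv.apply_symm_apply, Equiv.apply_symm_apply]

/-- The length of an affine permutation: the number of inversions `(i, j)` (that is `i < j` and
`f j < f i`) up to simultaneous translation by multiples of `n`. Every class has exactly one
representative with `1 ≤ i ≤ n`. -/
noncomputable def affineLength {n : ℕ} (f : affinePerm n) : ℕ :=
  Set.ncard {p : ℤ × ℤ | 1 ≤ p.1 ∧ p.1 ≤ n ∧ p.1 < p.2 ∧ f.1 p.2 < f.1 p.1}

/-- The reflections of the affine symmetric group: exchange `i + mn` and `j + mn` for every `m`,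
where `i` and `j` are not congruent modulo `n`, and fix everything else. -/
def IsAffineReflection {n : ℕ} (t : affinePerm n) : Prop :=
  ∃ i j : ℤ, ¬ i ≡ j [ZMOD n] ∧
    (∀ m : ℤ, t.1 (i + m * n) = j + m * n ∧ t.1 (j + m * n) = i + m * n) ∧
    ∀ x : ℤ, ¬ x ≡ i [ZMOD n] → ¬ x ≡ j [ZMOD n] → t.1 x = x

/-- Right multiplication by a reflection that increases the length. -/
def AffineBruhatStep {n : ℕ} (f g : affinePerm n) : Prop :=
  ∃ t : affinePerm n, IsAffineReflection t ∧ g = f * t ∧ affineLength f < affineLength g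

/-- The Bruhat order on affine permutations. Reflections preserve the ball number and translations
`i ↦ i + c` preserve the length, so this is, on the affine permutations of each given
ball number, the order transported from the Coxeter group of those of ball number zero. -/
def AffineBruhatLE {n : ℕ} (f g : affinePerm n) : Prop :=
  Relation.ReflTransGen AffineBruhatStep f g

/-- Bounded affine permutations: `i ≤ f(i) ≤ i + n` and `(1/n) ∑_{i=1}^n (f(i) - i) = k`. -/
def Bound (k n : ℕ) : Type :=
  {f : affinePerm n // (∀ i : ℤ, i ≤ f.1 i ∧ f.1 i ≤ i + n) ∧
    ∑ i ∈ Finset.Icc (1 : ℤ) n, (f.1 i - i) = n * k}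

instance (k n : ℕ) : CoeFun (Bound k n) (fun _ => ℤ → ℤ) := ⟨fun f => f.1.1⟩

/-- The order on `Bound(k,n)` is the restriction of the Bruhat order. -/
instance (k n : ℕ) : PartialOrder (Bound k n) where
  le f g := AffineBruhatLE f.1 g.1
  le_refl _ := Relation.ReflTransGen.refl
  le_trans _ _ _ := Relation.ReflTransGen.trans
  le_antisymm f g h₁ h₂ := by
    have hs : ∀ a b : affinePerm n, AffineBruhatStep a b → affineLength a < affineLength b :=
      fun _ _ ⟨_, _, _, h⟩ => h
    apply Subtype.ext
    rcases eq_or_lt_of_reflTransGen _ hs h₁ with h | h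
    · exact h
    · rcases eq_or_lt_of_reflTransGen _ hs h₂ with h' | h'
      · exact h'.symm
      · exact absurd (h.trans h') (lt_irrefl _)

/-! ### Juggling states and bounded juggling patterns -/

/-- The juggling state `st(f,t) = {f(i) - t : i ≤ t}` of `f` at time `t`. -/
def stateAt (f : ℤ → ℤ) (t : ℤ) : Set ℤ := {x | ∃ i : ℤ, i ≤ t ∧ x = f i - t}

/-- The juggling state `J ∪ {x : x ≤ 0}`. -/
def toState {k n : ℕ} (J : KSubset k n) : Set ℤ :=
  {x | x ≤ 0} ∪ {x | ∃ a ∈ J.1, x = ((a : ℕ) : ℤ) + 1}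

/-- The state `T` can follow the state `S`: it arises by subtracting `1` from all elements of `S`
and adding one new element. -/
def CanFollow (S T : Set ℤ) : Prop :=
  ∃ t : ℤ, t ∉ (fun x => x - 1) '' S ∧ T = insert t ((fun x => x - 1) '' S)

/-- `Jugg(k,n)`: the sequences `(J₁, …, J_n)` of `k`-element subsets of `[n]` such that `J_{i+1}`
can follow `J_i` for each `i`, the indices being taken modulo `n`. -/
def Jugg (k n : ℕ) : Type :=
  {J : Fin n → KSubset k n // ∀ r : Fin n, CanFollow (toState (J r)) (toState (J (finRotate n r)))}

instance (k n : ℕ) : CoeFun (Jugg k n) (fun _ => Fin n → KSubset k n) := ⟨Subtype.val⟩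

/-- The componentwise order. -/
instance (k n : ℕ) : PartialOrder (Jugg k n) where
  le J J' := ∀ r, J r ≤ J' r
  le_refl _ _ := le_rfl
  le_trans _ _ _ h₁ h₂ r := (h₁ r).trans (h₂ r)
  le_antisymm _ _ h₁ h₂ := Subtype.ext (funext fun r => le_antisymm (h₁ r) (h₂ r))

/-! ### Cyclic rank matrices -/

/-- `R_j(S) = k - #{x ∈ S : x > j}`. -/
noncomputable def stateRank (k : ℕ) (S : Set ℤ) (j : ℤ) : ℤ :=
  (k : ℤ) - (Set.ncard {x | x ∈ S ∧ j < x} : ℤ)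

/-- The conditions that define a cyclic rank matrix of type `(k,n)`. -/
structure IsCyclicRankMatrix (k n : ℕ) (r : ℤ → ℤ → ℤ) : Prop where
  below : ∀ i j : ℤ, j < i → r i j = j - i + 1
  above : ∀ i j : ℤ, i + n - 1 ≤ j → r i j = k
  row_step : ∀ i j : ℤ, r i j - r (i + 1) j = 0 ∨ r i j - r (i + 1) j = 1
  col_step : ∀ i j : ℤ, r i j - r i (j - 1) = 0 ∨ r i j - r i (j - 1) = 1
  corner : ∀ i j : ℤ, r (i + 1) (j - 1) = r (i + 1) j → r (i + 1) j = r i (j - 1) →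
    r i j = r (i + 1) (j - 1)
  periodic : ∀ i j : ℤ, r (i + n) (j + n) = r i j

/-- The cyclic rank matrices of type `(k,n)`. -/
def CyclicRankMatrix (k n : ℕ) : Type := {r : ℤ → ℤ → ℤ // IsCyclicRankMatrix k n r}

instance (k n : ℕ) : CoeFun (CyclicRankMatrix k n) (fun _ => ℤ → ℤ → ℤ) := ⟨Subtype.val⟩

/-- The entrywise order, reversed: `r ≤ s` if and only if `r_{ij} ≥ s_{ij}` for all `i, j`. -/
instance (k n : ℕ) : PartialOrder (CyclicRankMatrix k n) where
  le r s := ∀ i j : ℤ, s i j ≤ r i j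
  le_refl _ _ _ := le_rfl
  le_trans _ _ _ h₁ h₂ i j := (h₂ i j).trans (h₁ i j)
  le_antisymm _ _ h₁ h₂ :=
    Subtype.ext (funext fun i => funext fun j => le_antisymm (h₂ i j) (h₁ i j))

/-! ### Positroids -/

/-- `M_J = {I : χ^{-r+1}(I) ≥ J_r for all r}`. -/
def juggBases {k n : ℕ} (J : Jugg k n) : Set (KSubset k n) :=
  {I | ∀ r : Fin n, J r ≤ rotateBack (r : ℕ) I}

/-- The set of bases of the matroid `M` is the collection `B` of `k`-element sets. -/
def HasBases {k n : ℕ} (M : Matroid (Fin n)) (B : Set (KSubset k n)) : Prop :=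
  ∀ S : Set (Fin n), M.IsBase S ↔ ∃ I ∈ B, (I.1 : Set (Fin n)) = S

/-- The positroids of rank `k` on `[n]`: the matroids on `[n]` whose set of bases is `M_J` for some
`J ∈ Jugg(k,n)`. -/
def Positroid (k n : ℕ) : Type :=
  {M : Matroid (Fin n) // M.E = Set.univ ∧ ∃ J : Jugg k n, HasBases M (juggBases J)}

/-- Reverse inclusion of the sets of bases. -/
instance (k n : ℕ) : PartialOrder (Positroid k n) where
  le M M' := ∀ S : Set (Fin n), M'.1.IsBase S → M.1.IsBase S
  le_refl _ _ h := h
  le_trans _ _ _ h₁ h₂ S h := h₁ S (h₂ S h)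
  le_antisymm M M' h₁ h₂ := by
    apply Subtype.ext
    exact Matroid.ext_isBase (M.2.1.trans M'.2.1.symm) fun S _ => ⟨h₂ S, h₁ S⟩

/-- The rotations `χ^{-r}(I)` of the bases `I` of `M`. -/
def rotatedBases {k n : ℕ} (M : Positroid k n) (r : ℕ) : Set (KSubset k n) :=
  {K | ∃ I : KSubset k n, M.1.IsBase (I.1 : Set (Fin n)) ∧ K = rotateBack r I}

end PositroidPosets

open PositroidPosets

/-! Everything is compared through one rank function. For a bounded affine permutation `f`,
`overRank f i j` counts the positions before `i` whose values exceed `j`. The cyclic rank matrix is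
`k` minus this function, and the tail counts of the juggling states are its entries. The central
fact is `Bound.le_iff`: Bruhat order on `Bound k n` is entrywise comparison of these ranks. One
direction is an injection (`IsRaising.overRank_le`). For the other, look at the outermost diagonal
where the ranks of `f` and `g` differ. It yields a reflection that raises `f`, keeps it bounded and
keeps its ranks below those of `g` (`exists_boundCover_of_overRank_le`); finiteness then gives a
chain of covers inside `Bound k n`.

A cyclic rank matrix returns `f`: in each row the difference with the next row drops from 1 to 0
exactly once, and it drops at `f i` (`IsCyclicRankMatrix.exists_bound`). A juggling pattern defines
such a matrix, so `Bound.jugg` is onto, and both orders become comparison of ranks.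

A set lies in `juggBases` exactly when its number of elements in each cyclic interval is at most the
corresponding rank entry (`mem_juggBases_iff`). The rank matrix is submodular, so tight intervals
uncross, which gives basis exchange. Submodularity also shows that each `J r`, rotated into place,
is a basis; being then the least rotated basis, it recovers the pattern and its order from the
matroid.

For pairs, `KCriterion` characterises `k`-Bruhat order; two of its three clauses say only that
`f_{u,w}` is bounded. Each `f` has a representative with `w` increasing on both blocks, from which
every other pair is obtained by one length-additive right multiplication (`IsPairWindow.rel`), so
classes correspond to `Bound k n`. Nested intervals give comparable ranks
(`IsPairWindow.le_of_bruhatLE`), and each cover in `Bound k n` lifts to any representative by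
raising `u` or lowering `w` (`BoundCover.exists_pair`). -/

namespace PositroidPosets

/-! ### Inversions and raising involutions -/

section Inversions

variable {α β : Type*} [LinearOrder α] [LinearOrder β]

/-- The inversions of a function between linear orders. -/
def inversions (f : α → β) : Set (α × α) := {p | p.1 < p.2 ∧ f p.2 < f p.1}

/-- An involution `t` such that every position moved to the right by `t` has a smaller `f`-value
than its partner, and such that only pairs moved towards each other are reversed by `t`. -/
structure IsRaising (f : α → β) (t : α → α) : Prop where
  invol : ∀ a, t (t a) = a
  up : ∀ a, a < t a → f a < f (t a)
  cross : ∀ a b, a < b → t b < t a → a ≤ t a ∧ t b ≤ b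

theorem IsRaising.down {f : α → β} {t : α → α} (h : IsRaising f t) (a : α) (ha : t a < a) :
    f (t a) < f a := by
  have := h.up (t a) (by rwa [h.invol])
  rwa [h.invol] at this

theorem IsRaising.le_of_le {f : α → β} {t : α → α} (h : IsRaising f t) (a : α) (ha : a ≤ t a) :
    f a ≤ f (t a) := by
  rcases ha.eq_or_lt with h' | h'
  · rw [← h']
  · exact (h.up a h').le

theorem IsRaising.ge_of_ge {f : α → β} {t : α → α} (h : IsRaising f t) (a : α) (ha : t a ≤ a) :
    f (t a) ≤ f a := by
  rcases ha.eq_or_lt with h' | h'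
  · rw [h']
  · exact (h.down a h').le

theorem IsRaising.injective {f : α → β} {t : α → α} (h : IsRaising f t) :
    Function.Injective t := fun a b hab => by rw [← h.invol a, hab, h.invol]

/-- Apply `t` to both members of a pair unless this reverses the pair. -/
def movePair (t : α → α) (p : α × α) : α × α :=
  if t p.1 < t p.2 then (t p.1, t p.2) else p

/-- Moving both members keeps their two `f`-values. If `t` would reverse the pair, `cross` makes the
members move towards each other, so the left value can only grow and the right one only shrink: the
unmoved pair stays inverted. -/
theorem IsRaising.movePair_mem {f : α → β} {t : α → α} (h : IsRaising f t) {p : α × α}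
    (hp : p ∈ inversions f) : movePair t p ∈ inversions (f ∘ t) := by
  obtain ⟨h1, h2⟩ := hp
  unfold movePair
  split_ifs with hlt
  · refine ⟨hlt, ?_⟩
    simp only [Function.comp, h.invol]
    exact h2
  · have hne : t p.1 ≠ t p.2 := fun he => h1.ne (h.injective he)
    obtain ⟨h3, h4⟩ := h.cross _ _ h1 (lt_of_le_of_ne (not_lt.1 hlt) hne.symm)
    exact ⟨h1, ((h.ge_of_ge _ h4).trans_lt h2).trans_le (h.le_of_le _ h3)⟩

theorem IsRaising.movePair_inj {f : α → β} {t : α → α} (h : IsRaising f t) {p q : α × α}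
    (hp : p.1 < p.2) (hq : q.1 < q.2) (hpq : movePair t p = movePair t q) : p = q := by
  unfold movePair at hpq
  split_ifs at hpq with h1 h2 h2
  · rw [Prod.mk.injEq] at hpq
    exact Prod.ext (h.injective hpq.1) (h.injective hpq.2)
  · rw [← hpq] at h2
    simp only [h.invol] at h2
    exact absurd hp h2
  · rw [hpq] at h1
    simp only [h.invol] at h1
    exact absurd hq h1
  · exact hpq

/-- The pair `(a, t a)` is fixed by `movePair`, hence the image of no other ordered pair, and it is
no inversion of `f`. This missed pair is what makes lengths grow strictly. -/
theorem IsRaising.movePair_ne {f : α → β} {t : α → α} (h : IsRaising f t) {a : α}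
    (ha : a < t a) {p : α × α} (hp : p ∈ inversions f) : movePair t p ≠ (a, t a) := by
  intro he
  have h0 : movePair t (a, t a) = (a, t a) := by
    unfold movePair
    rw [if_neg]
    simpa [h.invol] using ha.le
  have := h.movePair_inj hp.1 (q := (a, t a)) ha (he.trans h0.symm)
  subst this
  exact (h.up a ha).not_gt hp.2

end Inversions

/-! ### Bruhat order on the symmetric group -/

section Finite

variable {n : ℕ}

theorem isRaising_swap {u : Equiv.Perm (Fin n)} {a b : Fin n} (hab : a < b) (hu : u a < u b) :
    IsRaising u (Equiv.swap a b) where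
  invol := Equiv.swap_apply_self a b
  up c hc := by
    rw [Equiv.swap_apply_def] at *
    split_ifs at * with h1 h2
    · rwa [h1]
    · exact absurd (h2 ▸ hc) hab.not_gt
    · exact absurd hc (lt_irrefl _)
  cross c d hcd h := by
    simp only [Equiv.swap_apply_def] at *
    split_ifs at * <;> constructor <;> order

theorem permLength_lt_mul_swap {u : Equiv.Perm (Fin n)} {a b : Fin n} (hab : a < b)
    (hu : u a < u b) : permLength u < permLength (u * Equiv.swap a b) := by
  have h := isRaising_swap hab hu
  unfold permLength
  have hsw : Equiv.swap a b a = b := Equiv.swap_apply_left a b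
  rw [← Finset.card_image_of_injOn (f := movePair (Equiv.swap a b))
    (s := Finset.univ.filter fun p : Fin n × Fin n => p.1 < p.2 ∧ u p.2 < u p.1)]
  · apply Finset.card_lt_card
    rw [Finset.ssubset_iff_of_subset]
    · refine ⟨(a, b), Finset.mem_filter.2 ⟨Finset.mem_univ _, hab, by simpa using hu⟩, ?_⟩
      simp only [Finset.mem_image, Finset.mem_filter, Finset.mem_univ, true_and, not_exists, not_and]
      intro p hp
      have := h.movePair_ne (a := a) (by rwa [hsw]) (p := p) hp
      rwa [hsw] at this
    · intro q hq
      simp only [Finset.mem_image, Finset.mem_filter, Finset.mem_univ, true_and] at hq ⊢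
      obtain ⟨p, hp, rfl⟩ := hq
      exact h.movePair_mem hp
  · intro p hp q hq
    simp only [Finset.coe_filter, Finset.mem_univ, true_and, Set.mem_ofPred_eq] at hp hq
    exact h.movePair_inj hp.1 hq.1

/-- If `u b < u a` with `a < b`, undoing the swap raises the length, so the swap itself cannot. -/
theorem bruhatStep_iff {u v : Equiv.Perm (Fin n)} :
    BruhatStep u v ↔ ∃ a b, a < b ∧ u a < u b ∧ v = u * Equiv.swap a b := by
  constructor
  · have key : ∀ a b : Fin n, a < b → permLength u < permLength (u * Equiv.swap a b) →
        u a < u b := by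
      intro a b hab hl
      by_contra hc
      have h1 : u b < u a := lt_of_le_of_ne (not_lt.1 hc) fun h => hab.ne' (u.injective h)
      have := permLength_lt_mul_swap (u := u * Equiv.swap a b) hab (by simpa using h1)
      rw [mul_assoc, Equiv.swap_mul_self, mul_one] at this
      exact absurd hl this.not_gt
    rintro ⟨a, b, hne, rfl, hl⟩
    rcases lt_or_gt_of_ne hne with hab | hab
    · exact ⟨a, b, hab, key a b hab hl, rfl⟩
    · rw [Equiv.swap_comm] at hl ⊢
      exact ⟨b, a, hab, key b a hab hl, rfl⟩
  · rintro ⟨a, b, hab, hu, rfl⟩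
    exact ⟨a, b, hab.ne, rfl, permLength_lt_mul_swap hab hu⟩

theorem bruhatLE_antisymm {u v : Equiv.Perm (Fin n)} (h₁ : BruhatLE u v) (h₂ : BruhatLE v u) :
    u = v := by
  have hs : ∀ a b : Equiv.Perm (Fin n), BruhatStep a b → permLength a < permLength b :=
    fun _ _ ⟨_, _, _, _, h⟩ => h
  rcases eq_or_lt_of_reflTransGen _ hs h₁ with h | h
  · exact h
  · rcases eq_or_lt_of_reflTransGen _ hs h₂ with h' | h'
    · exact h'.symm
    · exact absurd (h.trans h') (lt_irrefl _)

/-! ### Rank functions and covers in the symmetric group -/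

/-- `#{a ≤ m : w(a) > j}`, with `0`-based indices. -/
def permRank (w : Equiv.Perm (Fin n)) (m j : ℕ) : ℕ :=
  (Finset.univ.filter fun a : Fin n => (a : ℕ) < m ∧ j ≤ (w a : ℕ)).card

theorem permRank_mul_swap {u : Equiv.Perm (Fin n)} {a b : Fin n} (hab : a < b) (hu : u a < u b)
    (m j : ℕ) : permRank (u * Equiv.swap a b) m j = permRank u m j +
      if (a : ℕ) < m ∧ m ≤ b ∧ (u a : ℕ) < j ∧ j ≤ u b then 1 else 0 := by
  unfold permRank
  simp only [Finset.card_filter]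
  rw [← Finset.add_sum_erase _ _ (Finset.mem_univ a),
    ← Finset.add_sum_erase _ _ (Finset.mem_univ a),
    ← Finset.add_sum_erase (Finset.univ.erase a) _ (a := b) (by simp [hab.ne']),
    ← Finset.add_sum_erase (Finset.univ.erase a) _ (a := b) (by simp [hab.ne'])]
  have : ∑ x ∈ (Finset.univ.erase a).erase b,
      (if (x : ℕ) < m ∧ j ≤ ((u * Equiv.swap a b) x : ℕ) then 1 else 0) =
      ∑ x ∈ (Finset.univ.erase a).erase b, (if (x : ℕ) < m ∧ j ≤ (u x : ℕ) then 1 else 0) := by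
    apply Finset.sum_congr rfl
    intro x hx
    simp only [Finset.mem_erase, Finset.mem_univ, and_true] at hx
    rw [Equiv.Perm.mul_apply, Equiv.swap_apply_of_ne_of_ne hx.2 hx.1]
  rw [this]
  simp only [Equiv.Perm.mul_apply, Equiv.swap_apply_left, Equiv.swap_apply_right]
  rw [Fin.lt_def] at hab hu
  split_ifs <;> omega

/-- This is the easy half of the tableau criterion; the converse is not needed for finite
permutations. -/
theorem BruhatLE.permRank_le {u v : Equiv.Perm (Fin n)} (h : BruhatLE u v) (m j : ℕ) :
    permRank u m j ≤ permRank v m j := by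
  induction h with
  | refl => exact le_rfl
  | tail _ h ih =>
    obtain ⟨a, b, hab, hu, rfl⟩ := bruhatStep_iff.1 h
    rw [permRank_mul_swap hab hu]
    omega

/-- If some `c` lies in the open rectangle spanned by `a` and `b`, then `(a b) = (a c)(c b)(a c)` is
a product of three raising swaps, which puts `u (a c)` strictly between. Conversely, rank comparison
confines the first swap of any chain from `u` up to `u (a b)` to this rectangle, and emptiness makes
it the swap of `a` and `b`. -/
theorem bruhatCover_iff {u v : Equiv.Perm (Fin n)} :
    BruhatCover u v ↔ ∃ a b, a < b ∧ u a < u b ∧ (∀ c, a < c → c < b → u a < u c → ¬ u c < u b) ∧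
      v = u * Equiv.swap a b := by
  constructor
  · rintro ⟨hle, hne, hmin⟩
    rcases Relation.ReflTransGen.cases_head hle with h | ⟨x, hux, hxv⟩
    · exact absurd h hne
    · have hx := hmin x (.single hux) hxv
      obtain ⟨a, b, hab, hu, rfl⟩ := bruhatStep_iff.1 hux
      have hsne : u * Equiv.swap a b ≠ u := fun h => by
        have := congrArg permLength h
        exact (permLength_lt_mul_swap hab hu).ne' this
      obtain rfl := hx.resolve_left hsne
      refine ⟨a, b, hab, hu, ?_, rfl⟩
      intro c hac hcb h1 h2
      have s1 : BruhatStep u (u * Equiv.swap a c) := bruhatStep_iff.2 ⟨a, c, hac, h1, rfl⟩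
      have s2 : BruhatStep (u * Equiv.swap a c) (u * Equiv.swap a c * Equiv.swap c b) := by
        refine bruhatStep_iff.2 ⟨c, b, hcb, ?_, rfl⟩
        simpa [Equiv.swap_apply_of_ne_of_ne hab.ne' hcb.ne'] using hu
      have s3 : BruhatStep (u * Equiv.swap a c * Equiv.swap c b) (u * Equiv.swap a b) := by
        refine bruhatStep_iff.2 ⟨a, c, hac, ?_, ?_⟩
        · simpa [Equiv.swap_apply_of_ne_of_ne hab.ne' hcb.ne',
            Equiv.swap_apply_of_ne_of_ne hac.ne hab.ne] using h2
        · ext x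
          simp only [Equiv.Perm.mul_apply, Equiv.swap_apply_def]
          congr 2
          split_ifs <;> grind
      rcases hmin _ (.single s1) (.tail (.single s2) s3) with h | h
      · have := congrArg permLength h
        obtain ⟨_, _, _, _, hl⟩ := s1
        exact hl.ne' this
      · have := congrArg (fun w => w b) h
        simp only [Equiv.Perm.mul_apply, Equiv.swap_apply_right,
          Equiv.swap_apply_of_ne_of_ne hab.ne' hcb.ne'] at this
        exact hab.ne' (u.injective this)
  · rintro ⟨a, b, hab, hu, hempty, rfl⟩
    have hstep : BruhatStep u (u * Equiv.swap a b) := bruhatStep_iff.2 ⟨a, b, hab, hu, rfl⟩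
    refine ⟨.single hstep, ?_, ?_⟩
    · intro h
      have := congrArg permLength h
      exact (permLength_lt_mul_swap hab hu).ne this
    · intro x hux hxv
      rcases Relation.ReflTransGen.cases_head hux with h | ⟨y, huy, hyx⟩
      · exact Or.inl h.symm
      · right
        obtain ⟨c, d, hcd, hu', rfl⟩ := bruhatStep_iff.1 huy
        have hle := fun m j => BruhatLE.permRank_le (hyx.trans hxv : BruhatLE _ _) m j
        simp only [permRank_mul_swap hab hu, permRank_mul_swap hcd hu'] at hle
        -- These are two opposite corners of the rectangle where the swap of `c` and `d` raises the
        -- rank; both must lie in the rectangle of `a` and `b`.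
        have h1 := hle (c + 1) (u c + 1)
        have h2 := hle d (u d)
        have hstep' := hstep
        rw [Fin.lt_def] at hab hu hcd hu'
        rw [if_pos (by omega)] at h1 h2
        have h1' : (a : ℕ) < c + 1 ∧ (c : ℕ) + 1 ≤ b ∧ (u a : ℕ) < u c + 1 ∧ (u c : ℕ) + 1 ≤ u b := by
          by_contra hc
          rw [if_neg hc] at h1
          omega
        have h2' : (a : ℕ) < d ∧ (d : ℕ) ≤ b ∧ (u a : ℕ) < u d ∧ (u d : ℕ) ≤ u b := by
          by_contra hc
          rw [if_neg hc] at h2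
          omega
        have hca : c = a := by
          by_contra hne
          have h3 : (u c : ℕ) ≠ u a := fun h => hne (u.injective (Fin.ext h))
          have h4 : (c : ℕ) ≠ a := fun h => hne (Fin.ext h)
          exact hempty c (Fin.lt_def.2 (by omega)) (Fin.lt_def.2 (by omega))
            (Fin.lt_def.2 (by omega)) (Fin.lt_def.2 (by omega))
        have hdb : d = b := by
          by_contra hne
          have h3 : (u d : ℕ) ≠ u b := fun h => hne (u.injective (Fin.ext h))
          have h4 : (d : ℕ) ≠ b := fun h => hne (Fin.ext h)
          exact hempty d (Fin.lt_def.2 (by omega)) (Fin.lt_def.2 (by omega))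
            (Fin.lt_def.2 (by omega)) (Fin.lt_def.2 (by omega))
        subst hca hdb
        exact (bruhatLE_antisymm hxv hyx)

end Finite

end PositroidPosets

namespace PositroidPosets

/-! ### A criterion for `k`-Bruhat order -/

section KBruhat

variable {n : ℕ}

/-- Two positions lie in the same block of the parabolic subgroup `S_k × S_{n-k}`. -/
def SameBlock (k : ℕ) (a b : Fin n) : Prop := (a : ℕ) < k ↔ (b : ℕ) < k

/-- The criterion of Bergeron and Sottile for `u ≤_k w`. -/
structure KCriterion (k : ℕ) (u w : Equiv.Perm (Fin n)) : Prop where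
  lower : ∀ a : Fin n, (a : ℕ) < k → u a ≤ w a
  upper : ∀ a : Fin n, k ≤ (a : ℕ) → w a ≤ u a
  block : ∀ a b : Fin n, SameBlock k a b → a < b → u a < u b → w a < w b

theorem KCriterion.refl (k : ℕ) (u : Equiv.Perm (Fin n)) : KCriterion k u u :=
  ⟨fun _ _ => le_rfl, fun _ _ => le_rfl, fun _ _ _ _ h => h⟩

theorem KCriterion.trans {k : ℕ} {u v w : Equiv.Perm (Fin n)} (h₁ : KCriterion k u v)
    (h₂ : KCriterion k v w) : KCriterion k u w :=
  ⟨fun a h => (h₁.lower a h).trans (h₂.lower a h), fun a h => (h₂.upper a h).trans (h₁.upper a h),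
    fun a b h h' h'' => h₂.block a b h h' (h₁.block a b h h' h'')⟩

/-- A swap within one block does not change `u([k])`, so a `k`-cover exchanges a position of the
first block with one of the second. -/
theorem kBruhatCover_iff {k : ℕ} {u v : Equiv.Perm (Fin n)} :
    KBruhatCover k u v ↔ ∃ a b : Fin n, (a : ℕ) < k ∧ k ≤ (b : ℕ) ∧ u a < u b ∧
      (∀ c, a < c → c < b → u a < u c → ¬ u c < u b) ∧ v = u * Equiv.swap a b := by
  unfold KBruhatCover
  rw [bruhatCover_iff]
  constructor
  · rintro ⟨⟨a, b, hab, hu, he, rfl⟩, hs⟩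
    by_cases hblock : SameBlock k a b
    · refine absurd ?_ hs
      ext x
      have hk : ∀ c : Fin n, ((Equiv.swap a b c : Fin n) : ℕ) < k ↔ (c : ℕ) < k := by
        intro c
        rw [Equiv.swap_apply_def]
        split_ifs with h1 h2
        · subst h1; exact hblock.symm
        · subst h2; exact hblock
        · rfl
      constructor
      · rintro ⟨c, hc, rfl⟩
        exact ⟨Equiv.swap a b c, (hk c).2 hc, by simp⟩
      · rintro ⟨c, hc, rfl⟩
        exact ⟨Equiv.swap a b c, (hk c).2 hc, by simp⟩
    · unfold SameBlock at hblock
      rw [Fin.lt_def] at hab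
      exact ⟨a, b, by omega, by omega, hu, he, rfl⟩
  · rintro ⟨a, b, ha, hb, hu, he, rfl⟩
    refine ⟨⟨a, b, Fin.lt_def.2 (by omega), hu, he, rfl⟩, fun hs => ?_⟩
    have : u a ∈ sigma k u := ⟨a, ha, rfl⟩
    rw [hs] at this
    obtain ⟨c, hc, hca⟩ := this
    have h2 : Equiv.swap a b c = a := u.injective (by simpa using hca)
    have h3 : c = b := by rw [← Equiv.swap_apply_self a b c, h2, Equiv.swap_apply_left]
    subst h3
    omega

/-- The block clause can fail only for `a` or `b` paired with a position of its own block, and such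
a position would lie in the rectangle assumed empty. -/
theorem kCriterion_mul_swap {k : ℕ} {u : Equiv.Perm (Fin n)} {a b : Fin n} (ha : (a : ℕ) < k)
    (hb : k ≤ (b : ℕ)) (hu : u a < u b) (he : ∀ c, a < c → c < b → u a < u c → ¬ u c < u b) :
    KCriterion k u (u * Equiv.swap a b) := by
  have hinj : ∀ x y : Fin n, x ≠ y → u x ≠ u y := fun x y h h' => h (u.injective h')
  refine ⟨?_, ?_, ?_⟩
  · intro c hc
    rw [Equiv.Perm.mul_apply, Equiv.swap_apply_def]
    split_ifs with h1 h2
    · subst h1; exact hu.le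
    · subst h2; omega
    · exact le_rfl
  · intro c hc
    rw [Equiv.Perm.mul_apply, Equiv.swap_apply_def]
    split_ifs with h1 h2
    · subst h1; omega
    · subst h2; exact hu.le
    · exact le_rfl
  · intro c d hcd hlt h
    unfold SameBlock at hcd
    simp only [Equiv.Perm.mul_apply, Equiv.swap_apply_def]
    have hlt' := Fin.lt_def.1 hlt
    split_ifs with h1 h2 h3 h4 h5 h6
    · exact absurd (h1.trans h2.symm) hlt.ne
    · subst h1 h3; omega
    · subst h1
      by_contra hc
      have := hinj d b h3
      exact he d hlt (Fin.lt_def.2 (by omega)) h (by order)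
    · subst h4 h5; omega
    · subst h4 h6; omega
    · subst h4; order
    · rename_i h7; subst h7; order
    · rename_i h7 h8; subst h8
      by_contra hc
      have := hinj c a h1
      exact he c (Fin.lt_def.2 (by omega)) hlt (by order) h
    · exact h

theorem KBruhatLE.kCriterion {k : ℕ} {u w : Equiv.Perm (Fin n)} (h : KBruhatLE k u w) :
    KCriterion k u w := by
  induction h with
  | refl => exact .refl k u
  | tail _ h ih =>
    obtain ⟨a, b, ha, hb, hu, he, rfl⟩ := kBruhatCover_iff.1 h
    exact ih.trans (kCriterion_mul_swap ha hb hu he)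

theorem KBruhatLE.bruhatLE {k : ℕ} {u w : Equiv.Perm (Fin n)} (h : KBruhatLE k u w) :
    BruhatLE u w := by
  induction h with
  | refl => exact .refl
  | tail _ h ih => exact ih.trans h.1.1

theorem card_perm_le (w : Equiv.Perm (Fin n)) (x : Fin n) :
    (Finset.univ.filter fun c => w c ≤ x).card = (x : ℕ) + 1 := by
  rw [← Fin.card_Iic x, ← Finset.card_map w.toEmbedding]
  congr 1
  ext y
  simp only [Finset.mem_map, Finset.mem_filter, Finset.mem_univ, true_and, Finset.mem_Iic]
  constructor
  · rintro ⟨c, hc, rfl⟩; exact hc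
  · intro hy; exact ⟨w.symm y, by simpa using hy, by simp⟩

/-- As many values cross a level upwards in the first block as downwards in the second. -/
theorem KCriterion.card_crossing {k : ℕ} {u w : Equiv.Perm (Fin n)} (h : KCriterion k u w)
    (x : Fin n) : (Finset.univ.filter fun c : Fin n => (c : ℕ) < k ∧ u c ≤ x ∧ x < w c).card =
      (Finset.univ.filter fun c : Fin n => k ≤ (c : ℕ) ∧ w c ≤ x ∧ x < u c).card := by
  have h1 := card_perm_le u x
  have h2 := card_perm_le w x
  -- Position by position: in the first block a value can only leave the range `≤ x` on passing from
  -- `u` to `w`, in the second it can only enter.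
  have key : (Finset.univ.filter fun c => u c ≤ x).card +
      (Finset.univ.filter fun c : Fin n => k ≤ (c : ℕ) ∧ w c ≤ x ∧ x < u c).card =
      (Finset.univ.filter fun c => w c ≤ x).card +
      (Finset.univ.filter fun c : Fin n => (c : ℕ) < k ∧ u c ≤ x ∧ x < w c).card := by
    simp only [Finset.card_filter, ← Finset.sum_add_distrib]
    apply Finset.sum_congr rfl
    intro c _
    rcases lt_or_ge (c : ℕ) k with hc | hc
    · have := h.lower c hc
      rw [Fin.le_def] at this
      simp only [Fin.le_def, Fin.lt_def]
      split_ifs <;> omega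
    · have := h.upper c hc
      rw [Fin.le_def] at this
      simp only [Fin.le_def, Fin.lt_def]
      split_ifs <;> omega
  omega

/-- The swap is greedy: among positions of the first block that must still rise, `a` has the largest
`u a`; among positions of the second block that must cross level `u a` downwards, `b` has the
smallest `u b`. These extremal choices empty the rectangle and keep the criterion for the new
permutation. -/
theorem KCriterion.exists_cover {k : ℕ} {u w : Equiv.Perm (Fin n)} (h : KCriterion k u w)
    (hne : u ≠ w) : ∃ v, KBruhatCover k u v ∧ KCriterion k v w := by
  have hinj : ∀ x y : Fin n, x ≠ y → u x ≠ u y := fun x y h h' => h (u.injective h')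
  -- If nothing in the first block moves, then `w ≤ u` pointwise; both have the same sum of values,
  -- so they coincide.
  have hex : (Finset.univ.filter fun c : Fin n => (c : ℕ) < k ∧ u c < w c).Nonempty := by
    by_contra hc
    rw [Finset.not_nonempty_iff_eq_empty, Finset.filter_eq_empty_iff] at hc
    have hlow : ∀ c : Fin n, (c : ℕ) < k → u c = w c := fun c hck =>
      le_antisymm (h.lower c hck) (not_lt.1 fun hlt => hc (Finset.mem_univ c) ⟨hck, hlt⟩)
    have hsum : ∑ c, ((u c : ℕ) : ℤ) = ∑ c, ((w c : ℕ) : ℤ) := by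
      rw [Equiv.sum_comp u (fun c => ((c : ℕ) : ℤ)), Equiv.sum_comp w (fun c => ((c : ℕ) : ℤ))]
    have hle : ∀ c ∈ Finset.univ, ((w c : ℕ) : ℤ) ≤ ((u c : ℕ) : ℤ) := by
      intro c _
      rcases lt_or_ge (c : ℕ) k with hck | hck
      · rw [hlow c hck]
      · exact_mod_cast h.upper c hck
    rw [eq_comm, Finset.sum_eq_sum_iff_of_le hle] at hsum
    apply hne
    ext c
    exact_mod_cast (hsum c (Finset.mem_univ c)).symm
  obtain ⟨a, ha, hamax⟩ := Finset.exists_max_image _ (fun c => u c) hex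
  simp only [Finset.mem_filter, Finset.mem_univ, true_and] at ha hamax
  obtain ⟨hak, haw⟩ := ha
  have hexb : (Finset.univ.filter fun c : Fin n => k ≤ (c : ℕ) ∧ w c ≤ u a ∧ u a < u c).Nonempty := by
    rw [← Finset.card_pos, ← h.card_crossing, Finset.card_pos]
    exact ⟨a, by simpa using ⟨hak, haw⟩⟩
  obtain ⟨b, hb, hbmin⟩ := Finset.exists_min_image _ (fun c => u c) hexb
  simp only [Finset.mem_filter, Finset.mem_univ, true_and] at hb hbmin
  obtain ⟨hbk, hwb, hub⟩ := hb
  -- Were `w a < u b`, then from level `u a` to level `w a` the number of crossings would drop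
  -- strictly in the first block, which loses `a`, but not in the second, contradicting
  -- `card_crossing`.
  have hbw : u b ≤ w a := by
    by_contra hc
    rw [not_le] at hc
    have h1 := h.card_crossing (u a)
    have h2 := h.card_crossing (w a)
    have h3 : (Finset.univ.filter fun c : Fin n => (c : ℕ) < k ∧ u c ≤ w a ∧ w a < w c).card <
        (Finset.univ.filter fun c : Fin n => (c : ℕ) < k ∧ u c ≤ u a ∧ u a < w c).card := by
      apply Finset.card_lt_card
      rw [Finset.ssubset_iff_of_subset]
      · exact ⟨a, by simpa using ⟨hak, haw⟩, by simp⟩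
      · intro c hc'
        simp only [Finset.mem_filter, Finset.mem_univ, true_and] at hc' ⊢
        exact ⟨hc'.1, hamax c ⟨hc'.1, hc'.2.1.trans_lt hc'.2.2⟩, haw.trans hc'.2.2⟩
    have h4 : (Finset.univ.filter fun c : Fin n => k ≤ (c : ℕ) ∧ w c ≤ u a ∧ u a < u c).card ≤
        (Finset.univ.filter fun c : Fin n => k ≤ (c : ℕ) ∧ w c ≤ w a ∧ w a < u c).card := by
      apply Finset.card_le_card
      intro c hc'
      simp only [Finset.mem_filter, Finset.mem_univ, true_and] at hc' ⊢
      exact ⟨hc'.1, hc'.2.1.trans haw.le, hc.trans_le (hbmin c hc')⟩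
    omega
  have hfix : ∀ c : Fin n, (c : ℕ) < k → u a < u c → u c = w c := fun c hck hlt =>
    le_antisymm (h.lower c hck) (not_lt.1 fun h' => (hamax c ⟨hck, h'⟩).not_gt hlt)
  refine ⟨u * Equiv.swap a b, kBruhatCover_iff.2 ⟨a, b, hak, hbk, hub, ?_, rfl⟩, ?_, ?_, ?_⟩
  · intro c hac hcb h1 h2
    rcases lt_or_ge (c : ℕ) k with hck | hck
    · have h3 := hfix c hck h1
      have h4 := h.block a c (by unfold SameBlock; omega) hac h1
      order
    · have h3 := h.block c b (by unfold SameBlock; omega) hcb h2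
      have := hbmin c ⟨hck, by order, h1⟩
      order
  · intro c hc
    rw [Equiv.Perm.mul_apply, Equiv.swap_apply_def]
    split_ifs with h1 h2
    · subst h1; exact hbw
    · subst h2; omega
    · exact h.lower c hc
  · intro c hc
    rw [Equiv.Perm.mul_apply, Equiv.swap_apply_def]
    split_ifs with h1 h2
    · subst h1; omega
    · subst h2; exact hwb
    · exact h.upper c hc
  · intro c d hcd hlt
    have hblk := h.block c d hcd hlt
    unfold SameBlock at hcd
    have hlt' := Fin.lt_def.1 hlt
    simp only [Equiv.Perm.mul_apply, Equiv.swap_apply_def]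
    split_ifs with h1 h2 h3 h4 h5 h6 h7 h8
    · intro h'; exact absurd h' (lt_irrefl _)
    · subst h1 h3; omega
    · subst h1; intro h'; exact hblk (by order)
    · subst h4 h5; omega
    · subst h4 h6; omega
    · subst h4; intro h'
      rcases lt_or_ge (u c) (u d) with h8 | h8
      · exact hblk h8
      · by_contra hcc
        have h9 := hinj c d hlt.ne
        have := hbmin d ⟨by omega, by order, h'⟩
        order
    · subst h7; intro h'
      rcases lt_or_ge (u c) (u d) with h8 | h8
      · exact hblk h8
      · have h9 := hinj c d hlt.ne
        have := hfix c (by omega) (by order)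
        order
    · subst h8; intro h'; exact hblk (by order)
    · exact hblk

theorem permLength_le (u : Equiv.Perm (Fin n)) : permLength u ≤ n * n := by
  refine (Finset.card_le_univ _).trans ?_
  simp

theorem KCriterion.kBruhatLE {k : ℕ} {u w : Equiv.Perm (Fin n)} (h : KCriterion k u w) :
    KBruhatLE k u w := by
  induction hm : n * n - permLength u using Nat.strong_induction_on generalizing u with
  | _ m ih =>
    by_cases hne : u = w
    · subst hne; exact .refl
    · obtain ⟨v, hc, hv⟩ := h.exists_cover hne
      have h1 : permLength u < permLength v := by
        obtain ⟨a, b, hab, hu, _, rfl⟩ := bruhatCover_iff.1 hc.1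
        exact permLength_lt_mul_swap hab hu
      have h2 := permLength_le v
      exact .head hc (ih _ (by omega) hv rfl)

end KBruhat

end PositroidPosets

namespace PositroidPosets

/-! ### Affine permutations -/

section Affine

variable {n : ℕ}

theorem affinePerm_translate (f : affinePerm n) (i m : ℤ) : f.1 (i + m * n) = f.1 i + m * n := by
  induction m using Int.induction_on with
  | zero => simp
  | succ m ih =>
    have := f.2 (i + m * n)
    rw [ih] at this
    rw [show i + ((m : ℤ) + 1) * n = i + m * n + n by ring, this]
    ring
  | pred m ih =>
    have := f.2 (i + (-m - 1) * n)
    rw [show i + (-(m : ℤ) - 1) * n + n = i + -m * n by ring, ih] at this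
    linarith

/-- Every integer is a translate of a unique element of `{1, …, n}`. -/
theorem exists_translate (hn : 0 < n) (x : ℤ) : ∃ i q : ℤ, 1 ≤ i ∧ i ≤ n ∧ x = i + q * n := by
  have hn' : (0 : ℤ) < n := by exact_mod_cast hn
  refine ⟨(x - 1) % n + 1, (x - 1) / n, ?_, ?_, ?_⟩
  · have := Int.emod_nonneg (x - 1) hn'.ne'
    omega
  · have := Int.emod_lt_of_pos (x - 1) hn'
    omega
  · have := Int.emod_add_mul_ediv (x - 1) n
    linarith

theorem translate_unique {i j q r : ℤ} (hi : 1 ≤ i) (hi' : i ≤ n) (hj : 1 ≤ j) (hj' : j ≤ n)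
    (h : i + q * n = j + r * n) : i = j ∧ q = r := by
  have hn' : (0 : ℤ) < n := by omega
  have hqr : q = r := by
    rcases lt_trichotomy q r with hlt | heq | hgt
    · have : (q + 1) * n ≤ r * n := mul_le_mul_of_nonneg_right (by omega) hn'.le
      nlinarith
    · exact heq
    · have : (r + 1) * n ≤ q * n := mul_le_mul_of_nonneg_right (by omega) hn'.le
      nlinarith
  subst hqr
  exact ⟨by linarith, rfl⟩

/-- The displacement of an affine permutation is bounded. -/
theorem affinePerm_exists_bound (hn : 0 < n) (f : affinePerm n) :
    ∃ C : ℤ, ∀ l, l - C ≤ f.1 l ∧ f.1 l ≤ l + C := by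
  refine ⟨∑ i ∈ Finset.Icc (1 : ℤ) n, |f.1 i - i|, fun l => ?_⟩
  obtain ⟨i, q, h1, h2, rfl⟩ := exists_translate hn l
  have h3 := Finset.single_le_sum (f := fun i : ℤ => |f.1 i - i|) (fun _ _ => abs_nonneg _)
    (Finset.mem_Icc.2 ⟨h1, h2⟩)
  have h4 := abs_le.1 h3
  rw [affinePerm_translate f]
  constructor <;> linarith [h4.1, h4.2]

/-- The inversions counted by `affineLength`. -/
def normalInversions (f : affinePerm n) : Set (ℤ × ℤ) :=
  {p | 1 ≤ p.1 ∧ p.1 ≤ n ∧ p ∈ inversions f.1}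

theorem affineLength_eq (f : affinePerm n) : affineLength f = (normalInversions f).ncard := rfl

/-- Strict comparison of `ncard` needs finiteness; displacement is bounded by periodicity. -/
theorem normalInversions_finite (hn : 0 < n) (f : affinePerm n) : (normalInversions f).Finite := by
  obtain ⟨C, hC⟩ := affinePerm_exists_bound hn f
  apply Set.Finite.subset ((Set.finite_Icc (1 : ℤ) n).prod (Set.finite_Icc (1 : ℤ) (n + 2 * C)))
  rintro ⟨a, b⟩ ⟨h1, h2, h3, h4⟩
  simp only at h1 h2 h3 h4
  have := (hC a).2
  have := (hC b).1
  simp only [Set.mem_prod, Set.mem_Icc]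
  omega

theorem mem_inversions_translate (f : affinePerm n) (p : ℤ × ℤ) (q : ℤ) :
    (p.1 + q * n, p.2 + q * n) ∈ inversions f.1 ↔ p ∈ inversions f.1 := by
  simp only [inversions, Set.mem_ofPred_eq, affinePerm_translate f]
  constructor <;> rintro ⟨h1, h2⟩ <;> constructor <;> linarith

theorem movePair_translate (t : affinePerm n) (p : ℤ × ℤ) (q : ℤ) :
    movePair t.1 (p.1 + q * n, p.2 + q * n) =
      ((movePair t.1 p).1 + q * n, (movePair t.1 p).2 + q * n) := by
  unfold movePair
  simp only [affinePerm_translate t, add_lt_add_iff_right]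
  split_ifs <;> rfl

/-- `movePair` commutes with translation by multiples of `n`, so it acts injectively on translation
classes of inversions, and the class of `(a, t a)` is missed. -/
theorem affineLength_lt_mul (hn : 0 < n) {f t : affinePerm n} (h : IsRaising f.1 t.1) {a : ℤ}
    (ha : a < t.1 a) : affineLength f < affineLength (f * t) := by
  choose i q hi1 hi2 hiq using fun x => exists_translate hn x
  -- `N` picks the representative of a translation class with first entry in `{1, …, n}`.
  let N : ℤ × ℤ → ℤ × ℤ := fun p => (p.1 + (-q p.1) * n, p.2 + (-q p.1) * n)
  have hN : ∀ p, 1 ≤ (N p).1 ∧ (N p).1 ≤ n := fun p => by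
    have := hiq p.1
    have h1 := hi1 p.1
    have h2 := hi2 p.1
    simp only [N]
    constructor <;> linarith
  have hmap : ∀ p ∈ normalInversions f, N (movePair t.1 p) ∈ normalInversions (f * t) := by
    intro p hp
    refine ⟨(hN _).1, (hN _).2, ?_⟩
    rw [mem_inversions_translate (f * t)]
    exact h.movePair_mem hp.2.2
  have hback : ∀ p r : ℤ × ℤ, N p = N r → ∃ m : ℤ, p = (r.1 + m * n, r.2 + m * n) := by
    intro p r hpr
    simp only [N, Prod.mk.injEq] at hpr
    refine ⟨q p.1 - q r.1, Prod.ext ?_ ?_⟩ <;> simp only <;> linarith [hpr.1, hpr.2]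
  rw [affineLength_eq, affineLength_eq, ← Set.InjOn.ncard_image (f := N ∘ movePair t.1)]
  · apply Set.ncard_lt_ncard _ (normalInversions_finite hn _)
    rw [Set.ssubset_iff_of_subset]
    · refine ⟨N (a, t.1 a), ⟨(hN _).1, (hN _).2, ?_⟩, ?_⟩
      · rw [mem_inversions_translate (f * t)]
        refine ⟨ha, ?_⟩
        change f.1 (t.1 (t.1 a)) < f.1 (t.1 a)
        rw [h.invol]
        exact h.up a ha
      · rintro ⟨p, hp, hpe⟩
        obtain ⟨m, hm⟩ := hback _ _ hpe
        have hm' : movePair t.1 (p.1 + (-m) * n, p.2 + (-m) * n) = (a, t.1 a) := by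
          rw [movePair_translate, hm]
          ext <;> simp
        exact h.movePair_ne ha ((mem_inversions_translate f p (-m)).2 hp.2.2) hm'
    · rintro _ ⟨p, hp, rfl⟩
      exact hmap p hp
  · intro p hp r hr hpr
    obtain ⟨m, hm⟩ := hback _ _ hpr
    rw [← movePair_translate] at hm
    have h1 := h.movePair_inj hp.2.2.1 ((mem_inversions_translate f r m).2 hr.2.2).1 hm
    have h2 : p.1 + 0 * (n : ℤ) = r.1 + m * n := by rw [zero_mul, add_zero, h1]
    obtain ⟨_, h3⟩ := translate_unique hp.1 hp.2.1 hr.1 hr.2.1 h2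
    rw [h1, ← h3]
    simp

/-! ### Affine reflections and Bruhat steps -/

/-- `t` exchanges the translates of `a` with those of `b`, where `a < b`. -/
structure IsReflection (a b : ℤ) (t : affinePerm n) : Prop where
  lt : a < b
  not_modEq : ¬ (n : ℤ) ∣ b - a
  left : ∀ m : ℤ, t.1 (a + m * n) = b + m * n
  right : ∀ m : ℤ, t.1 (b + m * n) = a + m * n
  other : ∀ x, ¬ (n : ℤ) ∣ x - a → ¬ (n : ℤ) ∣ x - b → t.1 x = x

theorem IsReflection.cases {a b : ℤ} {t : affinePerm n} (h : IsReflection a b t) (x : ℤ) :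
    (∃ m : ℤ, x = a + m * n ∧ t.1 x = x + (b - a)) ∨ (∃ m : ℤ, x = b + m * n ∧ t.1 x = x - (b - a))
      ∨ (¬ (n : ℤ) ∣ x - a ∧ ¬ (n : ℤ) ∣ x - b ∧ t.1 x = x) := by
  by_cases h1 : (n : ℤ) ∣ x - a
  · left
    obtain ⟨m, hm⟩ := h1
    have hx : x = a + m * n := by linarith
    refine ⟨m, hx, ?_⟩
    rw [hx, h.left]; ring
  · by_cases h2 : (n : ℤ) ∣ x - b
    · right; left
      obtain ⟨m, hm⟩ := h2
      have hx : x = b + m * n := by linarith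
      refine ⟨m, hx, ?_⟩
      rw [hx, h.right]; ring
    · exact .inr (.inr ⟨h1, h2, h.other x h1 h2⟩)

theorem isAffineReflection_iff {t : affinePerm n} :
    IsAffineReflection t ↔ ∃ a b, IsReflection a b t := by
  constructor
  · rintro ⟨i, j, hij, hm, ho⟩
    have hd : ∀ {x y : ℤ}, ¬ x ≡ y [ZMOD n] ↔ ¬ (n : ℤ) ∣ x - y := by
      intro x y
      rw [Int.modEq_comm, Int.modEq_iff_dvd]
    rcases lt_trichotomy i j with h | h | h
    · exact ⟨i, j, h, by rwa [← hd, Int.modEq_comm], fun m => (hm m).1, fun m => (hm m).2,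
        fun x h1 h2 => ho x (hd.2 h1) (hd.2 h2)⟩
    · exact absurd (h ▸ Int.ModEq.refl _) hij
    · exact ⟨j, i, h, by rwa [← hd], fun m => (hm m).2, fun m => (hm m).1,
        fun x h1 h2 => ho x (hd.2 h2) (hd.2 h1)⟩
  · rintro ⟨a, b, h⟩
    have hd : ∀ {x y : ℤ}, ¬ x ≡ y [ZMOD n] ↔ ¬ (n : ℤ) ∣ x - y := by
      intro x y
      rw [Int.modEq_comm, Int.modEq_iff_dvd]
    exact ⟨a, b, by rw [Int.modEq_comm, hd]; exact h.not_modEq, fun m => ⟨h.left m, h.right m⟩,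
      fun x h1 h2 => h.other x (hd.1 h1) (hd.1 h2)⟩

theorem IsReflection.invol {a b : ℤ} {t : affinePerm n} (h : IsReflection a b t) (x : ℤ) :
    t.1 (t.1 x) = x := by
  rcases h.cases x with ⟨m, hx, ht⟩ | ⟨m, hx, ht⟩ | ⟨_, _, ht⟩
  · rw [hx, h.left, h.right]
  · rw [hx, h.right, h.left]
  · rw [ht, ht]

theorem IsReflection.mul_self {a b : ℤ} {t : affinePerm n} (h : IsReflection a b t) :
    t * t = 1 := Subtype.ext (Equiv.ext fun x => h.invol x)

theorem IsReflection.apply_left {a b : ℤ} {t : affinePerm n} (h : IsReflection a b t) :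
    t.1 a = b := by simpa using h.left 0

theorem IsReflection.apply_right {a b : ℤ} {t : affinePerm n} (h : IsReflection a b t) :
    t.1 b = a := by simpa using h.right 0

theorem IsReflection.isRaising {a b : ℤ} {f t : affinePerm n} (h : IsReflection a b t)
    (hf : f.1 a < f.1 b) : IsRaising f.1 t.1 where
  invol := h.invol
  up x hx := by
    have := h.lt
    rcases h.cases x with ⟨m, hx', ht⟩ | ⟨m, hx', ht⟩ | ⟨_, _, ht⟩
    · rw [hx', h.left, affinePerm_translate f, affinePerm_translate f]; linarith
    · omega
    · omega
  cross x y hxy hlt := by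
    have := h.lt
    rcases h.cases x with ⟨m, _, ht⟩ | ⟨m, _, ht⟩ | ⟨_, _, ht⟩ <;>
    rcases h.cases y with ⟨m', _, ht'⟩ | ⟨m', _, ht'⟩ | ⟨_, _, ht'⟩ <;> omega

theorem affineBruhatStep_iff (hn : 0 < n) {f g : affinePerm n} :
    AffineBruhatStep f g ↔ ∃ a b t, IsReflection a b t ∧ f.1 a < f.1 b ∧ g = f * t := by
  constructor
  · rintro ⟨t, ht, rfl, hl⟩
    obtain ⟨a, b, h⟩ := isAffineReflection_iff.1 ht
    refine ⟨a, b, t, h, ?_, rfl⟩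
    by_contra hc
    have hne : f.1 a ≠ f.1 b := fun he => h.lt.ne (f.1.injective he)
    have hf : (f * t).1 a < (f * t).1 b := by
      change f.1 (t.1 a) < f.1 (t.1 b)
      rw [h.apply_left, h.apply_right]
      omega
    have h1 := affineLength_lt_mul hn (h.isRaising hf) (a := a) (by rw [h.apply_left]; exact h.lt)
    rw [mul_assoc, h.mul_self, mul_one] at h1
    exact hl.not_gt h1
  · rintro ⟨a, b, t, h, hf, rfl⟩
    exact ⟨t, isAffineReflection_iff.2 ⟨a, b, h⟩, rfl,
      affineLength_lt_mul hn (h.isRaising hf) (a := a) (by rw [h.apply_left]; exact h.lt)⟩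

/-! ### Overtaking ranks -/

/-- The positions before `i` with values beyond `j`. -/
def overtaking (f : ℤ → ℤ) (i j : ℤ) : Set ℤ := {l | l < i ∧ j < f l}

/-- The number of positions before `i` with values beyond `j`. -/
noncomputable def overRank (f : ℤ → ℤ) (i j : ℤ) : ℕ := (overtaking f i j).ncard

theorem overtaking_finite_of_le {f : ℤ → ℤ} {C : ℤ} (hC : ∀ l, f l ≤ l + C) (i j : ℤ) :
    (overtaking f i j).Finite := by
  apply Set.Finite.subset (Set.finite_Icc (j - C) i)
  rintro l ⟨h1, h2⟩
  have := hC l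
  simp only [Set.mem_Icc]
  omega

/-- Keep a position if its value under `f ∘ t` is still beyond `j`, otherwise move it by `t`. A
moved position has a partner with smaller `f`-value, so the move goes to the left and stays before
`i`. -/
theorem IsRaising.overRank_le {f t : ℤ → ℤ} (h : IsRaising f t) {C : ℤ}
    (hC : ∀ l, f (t l) ≤ l + C) (i j : ℤ) : overRank f i j ≤ overRank (f ∘ t) i j := by
  classical
  refine Set.ncard_le_ncard_of_injOn (fun l => if j < f (t l) then l else t l) ?_ ?_
    (overtaking_finite_of_le hC i j)
  · rintro l ⟨h1, h2⟩
    split_ifs with h3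
    · exact ⟨h1, h3⟩
    · refine ⟨?_, by simpa [h.invol] using h2⟩
      by_contra hc
      have h4 := h.le_of_le l (by omega)
      omega
  · rintro l ⟨h1, h2⟩ m ⟨h3, h4⟩ he
    simp only at he
    split_ifs at he with h5 h6 h6
    · exact he
    · subst he; simp [h.invol] at h5; omega
    · subst he; simp [h.invol] at h6; omega
    · exact h.injective he

theorem AffineBruhatLE.overRank_le {f g : affinePerm n} (h : AffineBruhatLE f g) (hn : 0 < n)
    (i j : ℤ) : overRank f.1 i j ≤ overRank g.1 i j := by
  induction h with
  | refl => exact le_rfl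
  | @tail g' g _ h ih =>
    obtain ⟨a, b, t, ht, hf, rfl⟩ := (affineBruhatStep_iff hn).1 h
    obtain ⟨C, hC⟩ := affinePerm_exists_bound hn (g' * t)
    exact ih.trans ((ht.isRaising hf).overRank_le (fun l => (hC l).2) i j)

end Affine

end PositroidPosets

namespace PositroidPosets

/-! ### Ranks of bounded affine permutations -/

section Ranks

variable {n : ℕ}

theorem overRank_add_one {f : ℤ → ℤ} {C : ℤ} (hC : ∀ l, f l ≤ l + C) (i j : ℤ) :
    overRank f (i + 1) j = overRank f i j + if j < f i then 1 else 0 := by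
  unfold overRank
  split_ifs with h
  · have : overtaking f (i + 1) j = insert i (overtaking f i j) := by
      ext l
      simp only [overtaking, Set.mem_ofPred_eq, Set.mem_insert_iff]
      constructor
      · rintro ⟨h1, h2⟩
        rcases (Int.lt_add_one_iff.1 h1).eq_or_lt with h3 | h3
        · exact .inl h3
        · exact .inr ⟨h3, h2⟩
      · rintro (rfl | ⟨h1, h2⟩)
        · exact ⟨by omega, h⟩
        · exact ⟨by omega, h2⟩
    rw [this, Set.ncard_insert_of_notMem (fun hm => lt_irrefl _ hm.1)
      (overtaking_finite_of_le hC i j)]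
  · congr 1
    ext l
    simp only [overtaking, Set.mem_ofPred_eq]
    constructor
    · rintro ⟨h1, h2⟩
      rcases (Int.lt_add_one_iff.1 h1).eq_or_lt with h3 | h3
      · exact absurd (h3 ▸ h2) h
      · exact ⟨h3, h2⟩
    · rintro ⟨h1, h2⟩
      exact ⟨by omega, h2⟩

theorem overRank_sub_one {f : Equiv.Perm ℤ} {C : ℤ} (hC : ∀ l, f l ≤ l + C) (i j : ℤ) :
    overRank f i (j - 1) = overRank f i j + if f.symm j < i then 1 else 0 := by
  unfold overRank
  split_ifs with h
  · have : overtaking f i (j - 1) = insert (f.symm j) (overtaking f i j) := by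
      ext l
      simp only [overtaking, Set.mem_ofPred_eq, Set.mem_insert_iff]
      constructor
      · rintro ⟨h1, h2⟩
        rcases (Int.sub_one_lt_iff.1 h2).eq_or_lt with h3 | h3
        · exact .inl (by rw [h3, Equiv.symm_apply_apply])
        · exact .inr ⟨h1, h3⟩
      · rintro (rfl | ⟨h1, h2⟩)
        · exact ⟨h, by rw [Equiv.apply_symm_apply]; omega⟩
        · exact ⟨h1, by omega⟩
    rw [this, Set.ncard_insert_of_notMem (fun hm => ?_) (overtaking_finite_of_le hC i j)]
    have := hm.2
    rw [Equiv.apply_symm_apply] at this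
    exact lt_irrefl _ this
  · congr 1
    ext l
    simp only [overtaking, Set.mem_ofPred_eq]
    constructor
    · rintro ⟨h1, h2⟩
      rcases (Int.sub_one_lt_iff.1 h2).eq_or_lt with h3 | h3
      · rw [h3, Equiv.symm_apply_apply] at h
        exact absurd h1 h
      · exact ⟨h1, h3⟩
    · rintro ⟨h1, h2⟩
      exact ⟨h1, by omega⟩

theorem overRank_translate (f : affinePerm n) (i j m : ℤ) :
    overRank f.1 (i + m * n) (j + m * n) = overRank f.1 i j := by
  unfold overRank
  symm
  refine Set.ncard_congr (fun l _ => l + m * n) ?_ ?_ ?_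
  · rintro l ⟨h1, h2⟩
    exact ⟨by linarith, by rw [affinePerm_translate]; linarith⟩
  · rintro l l' _ _ h
    linarith
  · rintro l ⟨h1, h2⟩
    refine ⟨l + (-m) * n, ⟨by linarith, by rw [affinePerm_translate]; linarith⟩, by ring⟩

/-- Lowering the level from `q` to `p` adds exactly the values in `(p, q]` taken before `i`;
existence arguments below count these values. -/
theorem overRank_split {f : Equiv.Perm ℤ} {C : ℤ} (hC : ∀ l, f l ≤ l + C) (i : ℤ) {p q : ℤ}
    (hpq : p ≤ q) : overRank f i p =
      overRank f i q + ((Finset.Ioc p q).filter fun x => f.symm x < i).card := by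
  induction q, hpq using Int.leInduction with
  | base => simp
  | succ q hq ih =>
    have h1 := overRank_sub_one hC i (q + 1)
    rw [add_sub_cancel_right] at h1
    have h2 : Finset.Ioc p (q + 1) = insert (q + 1) (Finset.Ioc p q) := by
      ext x; simp only [Finset.mem_Ioc, Finset.mem_insert]; omega
    rw [ih, h1, h2, Finset.filter_insert]
    split_ifs
    · rw [Finset.card_insert_of_notMem (by simp)]; ring
    · ring

/-- The bounds `i ≤ f(i) ≤ i + n`. -/
def IsBounded (n : ℕ) (f : ℤ → ℤ) : Prop := ∀ i, i ≤ f i ∧ f i ≤ i + n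

theorem IsBounded.overRank_eq_zero {f : ℤ → ℤ} (h : IsBounded n f) {i j : ℤ}
    (hij : i + n - 1 ≤ j) : overRank f i j = 0 := by
  unfold overRank
  convert Set.ncard_empty ℤ
  rw [Set.eq_empty_iff_forall_notMem]
  rintro l ⟨h1, h2⟩
  have := (h l).2
  omega

theorem sum_shift_of_periodic {h : ℤ → ℤ} (hp : h (1 + n) = h 1) :
    ∑ i ∈ Finset.Icc (1 : ℤ) n, h (i + 1) = ∑ i ∈ Finset.Icc (1 : ℤ) n, h i := by
  have key : ∀ m : ℕ, ∑ i ∈ Finset.Icc (1 : ℤ) m, h (i + 1) - ∑ i ∈ Finset.Icc (1 : ℤ) m, h i =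
      h (1 + m) - h 1 := by
    intro m
    induction m with
    | zero => simp
    | succ m ih =>
      have : Finset.Icc (1 : ℤ) ((m + 1 : ℕ) : ℤ) = insert ((m : ℤ) + 1) (Finset.Icc (1 : ℤ) m) := by
        ext x; simp only [Finset.mem_Icc, Finset.mem_insert]; push_cast; omega
      rw [this, Finset.sum_insert (by simp), Finset.sum_insert (by simp)]
      push_cast
      rw [show (1 : ℤ) + (m + 1) = m + 1 + 1 by ring]
      rw [show (1 : ℤ) + m = m + 1 by ring] at ih
      linarith
  linarith [key n]

theorem sum_ite_lt {d : ℤ} (h0 : 0 ≤ d) (hd : d ≤ n) :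
    ∑ m ∈ Finset.range n, (if (m : ℤ) < d then (1 : ℤ) else 0) = d := by
  lift d to ℕ using h0
  rw [Finset.sum_boole]
  have : (Finset.range n).filter (fun m : ℕ => (m : ℤ) < d) = Finset.range d := by
    ext x; simp only [Finset.mem_filter, Finset.mem_range]; omega
  rw [this, Finset.card_range]

/-- Write `f i - i` as the number of `m` in `[0, n)` with `i + m < f i`, each indicator being a row
difference of ranks. Over one period the sum along a diagonal is shift invariant, so the double sum
telescopes in `m`; boundedness makes the last diagonal vanish. -/
theorem IsBounded.sum_eq {f : affinePerm n} (h : IsBounded n f.1) :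
    ∑ i ∈ Finset.Icc (1 : ℤ) n, (f.1 i - i) =
      ∑ i ∈ Finset.Icc (1 : ℤ) n, (overRank f.1 (i + 1) i : ℤ) := by
  have hC : ∀ l, f.1 l ≤ l + n := fun l => (h l).2
  have h1 : ∀ i, f.1 i - i = ∑ m ∈ Finset.range n,
      ((overRank f.1 (i + 1) (i + m) : ℤ) - overRank f.1 i (i + m)) := by
    intro i
    rw [← sum_ite_lt (n := n) (d := f.1 i - i) (by linarith [(h i).1]) (by linarith [(h i).2])]
    apply Finset.sum_congr rfl
    intro m _
    rw [overRank_add_one hC]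
    split_ifs <;> omega
  let F : ℕ → ℤ := fun m => ∑ i ∈ Finset.Icc (1 : ℤ) n, (overRank f.1 i (i + m - 1) : ℤ)
  have h2 : ∀ m : ℕ, F m = ∑ i ∈ Finset.Icc (1 : ℤ) n, (overRank f.1 (i + 1) (i + m) : ℤ) := by
    intro m
    have := sum_shift_of_periodic (n := n) (h := fun i => (overRank f.1 i (i + m - 1) : ℤ)) (by
      have := overRank_translate f 1 (1 + m - 1) 1
      rw [one_mul] at this
      rw [← this]
      congr 2
      ring)
    simp only [F, ← this]
    apply Finset.sum_congr rfl
    intro i _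
    congr 2
    ring
  have h3 : ∀ m : ℕ, F (m + 1) = ∑ i ∈ Finset.Icc (1 : ℤ) n, (overRank f.1 i (i + m) : ℤ) := by
    intro m
    apply Finset.sum_congr rfl
    intro i _
    congr 2
    push_cast
    ring
  have h4 : F n = 0 := by
    apply Finset.sum_eq_zero
    intro i _
    rw [h.overRank_eq_zero le_rfl]
    rfl
  rw [Finset.sum_congr rfl fun i _ => h1 i, Finset.sum_comm,
    Finset.sum_congr rfl (g := fun m => F m - F (m + 1)) fun m _ => by
      rw [Finset.sum_sub_distrib, h2, h3], Finset.sum_range_sub', h4, sub_zero, h2]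
  simp

/-- Both entries are compared with the one at `(j, j)`: a term is added on one side if `j < f j`, on
the other if `f⁻¹ j < j`. By boundedness both fail exactly when `f` fixes `j`. -/
theorem IsBounded.overRank_diag {f : affinePerm n} (h : IsBounded n f.1) (j : ℤ) :
    overRank f.1 (j + 1) j = overRank f.1 1 0 := by
  have hC : ∀ l, f.1 l ≤ l + n := fun l => (h l).2
  have step : ∀ j, overRank f.1 (j + 1) j = overRank f.1 j (j - 1) := by
    intro j
    rw [overRank_add_one hC, overRank_sub_one hC]
    congr 1
    have h1 := (h j).1
    have h2 := (h (f.1.symm j)).1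
    rw [Equiv.apply_symm_apply] at h2
    rcases h1.eq_or_lt with h3 | h3
    · have h4 : f.1.symm j = j := by rw [Equiv.symm_apply_eq]; exact h3
      rw [if_neg (by omega), if_neg (by omega)]
    · rw [if_pos h3, if_pos]
      refine lt_of_le_of_ne h2 fun h4 => ?_
      rw [Equiv.symm_apply_eq] at h4
      omega
  induction j using Int.induction_on with
  | zero => rfl
  | succ m ih =>
    rw [step, add_sub_cancel_right]; exact ih
  | pred m ih =>
    rw [step] at ih
    rw [← ih, sub_add_cancel]

variable {k : ℕ}

/-- This trades the condition on the average for one on diagonal ranks, which can be squeezed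
between two known ranks. For `n = 0` the sum says nothing, and `k = 0` comes from `k ≤ n`. -/
theorem IsBounded.sum_eq_iff {f : affinePerm n} (h : IsBounded n f.1) (hkn : k ≤ n) :
    ∑ i ∈ Finset.Icc (1 : ℤ) n, (f.1 i - i) = n * k ↔ ∀ j, overRank f.1 (j + 1) j = k := by
  have h1 : ∑ i ∈ Finset.Icc (1 : ℤ) n, (f.1 i - i) = n * overRank f.1 1 0 := by
    rw [h.sum_eq, Finset.sum_congr rfl (g := fun _ => (overRank f.1 1 0 : ℤ))
      fun i _ => by rw [h.overRank_diag]]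
    simp
  rw [h1]
  constructor
  · intro h2 j
    rw [h.overRank_diag]
    rcases Nat.eq_zero_or_pos n with hn | hn
    · subst hn
      rw [h.overRank_eq_zero (by simp)]
      omega
    · exact_mod_cast mul_left_cancel₀ (by exact_mod_cast hn.ne') h2
  · intro h2
    rw [← h2 0]
    norm_num

theorem Bound.isBounded (f : Bound k n) : IsBounded n f := f.2.1

theorem Bound.le_add (f : Bound k n) (l : ℤ) : f l ≤ l + n := (f.2.1 l).2

theorem Bound.overRank_diag (f : Bound k n) (hkn : k ≤ n) (j : ℤ) : overRank f (j + 1) j = k :=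
  (f.isBounded.sum_eq_iff hkn).1 f.2.2 j

/-- Starting on the diagonal, each further position `l > j` is counted, because `f l ≥ l`. -/
theorem Bound.overRank_below (f : Bound k n) (hkn : k ≤ n) {i j : ℤ} (hij : j < i) :
    (overRank f i j : ℤ) = k + (i - 1 - j) := by
  obtain ⟨m, rfl⟩ : ∃ m : ℕ, i = j + 1 + m := ⟨(i - (j + 1)).toNat, by omega⟩
  clear hij
  induction m with
  | zero => simp [f.overRank_diag hkn]
  | succ m ih =>
    have := overRank_add_one f.le_add (j + 1 + m) j
    have h1 := (f.2.1 (j + 1 + m)).1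
    rw [if_pos (by linarith)] at this
    push_cast
    rw [← add_assoc, this]
    push_cast
    linarith

theorem Bound.ext_apply {f g : Bound k n} (h : ∀ i, f i = g i) : f = g :=
  Subtype.ext (Subtype.ext (Equiv.ext h))

theorem Bound.ext_overRank {f g : Bound k n} (h : ∀ i j, overRank f i j = overRank g i j) :
    f = g := by
  apply Bound.ext_apply
  intro i
  have key : ∀ j, j < f i ↔ j < g i := by
    intro j
    have h1 := overRank_add_one f.le_add i j
    have h2 := overRank_add_one g.le_add i j
    rw [h, h, h2] at h1
    split_ifs at h1 <;> omega
  have h1 := key (f i)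
  have h2 := key (g i)
  omega

/-- Finiteness makes the strict order well founded upwards, which drives the induction building
chains of covers. -/
instance (k n : ℕ) : Finite (Bound k n) := by
  let F : Bound k n → (Set.Icc (0 : ℤ) n → Set.Icc (0 : ℤ) (2 * n)) := fun f i =>
    ⟨f i, by
      have := f.2.1 i
      have := i.2.1
      have := i.2.2
      constructor <;> linarith⟩
  apply Finite.of_injective F
  intro f g h
  have h1 : ∀ i : ℤ, 0 ≤ i → i ≤ n → f i = g i := by
    intro i h0 hi
    exact congrArg Subtype.val (congrFun h ⟨i, h0, hi⟩)
  apply Bound.ext_apply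
  intro x
  rcases Nat.eq_zero_or_pos n with hn | hn
  · have h2 := f.2.1 x
    have h3 := g.2.1 x
    subst hn
    simp only [Nat.cast_zero, add_zero] at h2 h3
    omega
  · obtain ⟨i, q, hi, hi', rfl⟩ := exists_translate hn x
    have := h1 i (by omega) hi'
    rw [affinePerm_translate f.1, affinePerm_translate g.1, this]

/-- Every pair of incongruent integers defines a reflection. -/
theorem exists_isReflection {a b : ℤ} (hab : a < b) (hd : ¬ (n : ℤ) ∣ b - a) :
    ∃ t : affinePerm n, IsReflection a b t := by
  let s : ℤ → ℤ := fun x => if (n : ℤ) ∣ x - a then x + (b - a) else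
    if (n : ℤ) ∣ x - b then x - (b - a) else x
  have hs1 : ∀ x, (n : ℤ) ∣ x - a → s x = x + (b - a) := fun x h => if_pos h
  have hs2 : ∀ x, (n : ℤ) ∣ x - b → s x = x - (b - a) := fun x h => by
    have : ¬ (n : ℤ) ∣ x - a := fun h' => hd (by
      have := dvd_sub h' h
      rwa [show x - a - (x - b) = b - a by ring] at this)
    simp only [s, if_neg this, if_pos h]
  have hs3 : ∀ x, ¬ (n : ℤ) ∣ x - a → ¬ (n : ℤ) ∣ x - b → s x = x := fun x h h' => by
    simp only [s, if_neg h, if_neg h']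
  have hinv : ∀ x, s (s x) = x := by
    intro x
    by_cases h1 : (n : ℤ) ∣ x - a
    · rw [hs1 x h1, hs2 _ (by rwa [show x + (b - a) - b = x - a by ring])]
      ring
    · by_cases h2 : (n : ℤ) ∣ x - b
      · rw [hs2 x h2, hs1 _ (by rwa [show x - (b - a) - a = x - b by ring])]
        ring
      · rw [hs3 x h1 h2, hs3 x h1 h2]
  have hper : ∀ x, s (x + n) = s x + n := by
    intro x
    have h1 : ∀ y, (n : ℤ) ∣ x + n - y ↔ (n : ℤ) ∣ x - y := fun y => by
      rw [show x + n - y = x - y + n by ring, dvd_add_self_right]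
    simp only [s, h1]
    split_ifs <;> ring
  refine ⟨⟨⟨s, s, hinv, hinv⟩, hper⟩, hab, hd, ?_, ?_, hs3⟩
  · intro m
    change s _ = _
    rw [hs1 _ (by simp)]
    ring
  · intro m
    change s _ = _
    rw [hs2 _ (by simp)]
    ring

/-! ### Covers of bounded affine permutations and the rank criterion -/

/-- A length-increasing reflection within the bounded affine permutations that skips no value in
between. -/
def BoundCover (f g : Bound k n) : Prop :=
  ∃ a b t, IsReflection a b t ∧ f a < f b ∧
    (∀ c, a < c → c < b → f a < f c → ¬ f c < f b) ∧ g.1 = f.1 * t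

theorem BoundCover.lt (hn : 0 < n) {f g : Bound k n} (h : BoundCover f g) : f < g := by
  obtain ⟨a, b, t, ht, hf, _, hg⟩ := h
  have hstep : AffineBruhatStep f.1 g.1 := (affineBruhatStep_iff hn).2 ⟨a, b, t, ht, hf, hg⟩
  refine lt_of_le_of_ne (Relation.ReflTransGen.single hstep) fun he => ?_
  obtain ⟨_, _, _, hl⟩ := hstep
  rw [he] at hl
  exact lt_irrefl _ hl

/-- At the largest offset `j - i` with unequal ranks, the ranks agree in row `a` at level `j` but
not in row `a + 1`, so `f a ≤ j < g a`. Exchange the value at `a` with the first later value in `(f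
a, g a]`. On the rectangle where the rank of `f` then rises, that of `g` already has room for one
more. -/
theorem exists_boundCover_of_overRank_le (hkn : k ≤ n) (hn : 0 < n) {f g : Bound k n}
    (hle : ∀ i j, overRank f i j ≤ overRank g i j) (hne : f ≠ g) :
    ∃ h : Bound k n, BoundCover f h ∧ ∀ i j, overRank h i j ≤ overRank g i j := by
  -- a point on the highest diagonal where the ranks differ
  obtain ⟨d, ⟨i, hi⟩, hd⟩ : ∃ d : ℤ, (∃ i, overRank f i (i + d) < overRank g i (i + d)) ∧
      ∀ e : ℤ, (∃ i, overRank f i (i + e) < overRank g i (i + e)) → e ≤ d := by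
    apply Int.exists_greatest_of_bdd
    · refine ⟨n, ?_⟩
      rintro e ⟨i, hi⟩
      by_contra hc
      rw [g.isBounded.overRank_eq_zero (by omega)] at hi
      omega
    · by_contra hc
      push Not at hc
      apply hne
      apply Bound.ext_overRank
      intro i j
      have := hc (j - i) i
      rw [add_sub_cancel] at this
      exact le_antisymm (hle i j) this
  have heq : ∀ i j, d < j - i → overRank f i j = overRank g i j := by
    intro i j hij
    refine le_antisymm (hle i j) (not_lt.1 fun h => ?_)
    have := hd (j - i) ⟨i, by rwa [add_sub_cancel]⟩
    omega
  obtain ⟨a, rfl⟩ : ∃ a, i = a + 1 := ⟨i - 1, by ring⟩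
  set j := a + 1 + d with hj
  have hfa : f a ≤ j ∧ j < g a := by
    have h1 := overRank_add_one f.le_add a j
    have h2 := overRank_add_one g.le_add a j
    rw [heq a j (by omega)] at h1
    split_ifs at h1 h2 <;> omega
  obtain ⟨hfa, hga⟩ := hfa
  have heqa : overRank f a (g a) = overRank g a (g a) := heq _ _ (by omega)
  -- If `f` fixed `a`, the common diagonal value `k` would make the rank of `f` at `(a, a)` exceed
  -- that of `g`.
  have hfa' : a < f a := by
    refine lt_of_le_of_ne (f.2.1 a).1 fun he => ?_
    have h1 := overRank_add_one f.le_add a a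
    have h2 := overRank_add_one g.le_add a a
    rw [f.overRank_diag hkn, if_neg (by omega)] at h1
    rw [g.overRank_diag hkn, if_pos (by omega)] at h2
    have := hle a a
    omega
  -- the first later position with a value in the gap
  obtain ⟨b, ⟨hab, hfb, hfb'⟩, hbmin⟩ : ∃ b : ℤ, (a < b ∧ f a < f b ∧ f b ≤ g a) ∧
      ∀ c : ℤ, (a < c ∧ f a < f c ∧ f c ≤ g a) → b ≤ c := by
    apply Int.exists_least_of_bdd
    · exact ⟨a, fun z hz => hz.1.le⟩
    · by_contra hc
      push Not at hc
      -- Without such a `b`, `f` takes every value of `(f a, g a]` before `a`, while `g` takes `g a`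
      -- at `a`. The ranks agree at level `g a`, so that of `f` would be larger at level `f a`.
      have h1 := overRank_split f.le_add a (p := f a) (q := g a) (by omega)
      have h2 := overRank_split g.le_add a (p := f a) (q := g a) (by omega)
      have h3 : (Finset.Ioc (f a) (g a)).filter (fun x => f.1.1.symm x < a) =
          Finset.Ioc (f a) (g a) := by
        apply Finset.filter_true_of_mem
        intro x hx
        rw [Finset.mem_Ioc] at hx
        by_contra hc'
        have h4 : f.1.1.symm x ≠ a := fun h4 => by
          rw [Equiv.symm_apply_eq] at h4
          omega
        have := hc (f.1.1.symm x) (by omega)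
        rw [Equiv.apply_symm_apply] at this
        omega
      have h4 : ((Finset.Ioc (f a) (g a)).filter (fun x => g.1.1.symm x < a)).card <
          (Finset.Ioc (f a) (g a)).card := by
        apply Finset.card_lt_card
        rw [Finset.ssubset_iff_of_subset (Finset.filter_subset _ _)]
        refine ⟨g a, Finset.mem_Ioc.2 ⟨by omega, le_rfl⟩, ?_⟩
        simp
      have := hle a (f a)
      rw [h3] at h1
      omega
  -- A congruent `b` would have `f b ≥ f a + n > a + n ≥ g a`.
  have hdvd : ¬ (n : ℤ) ∣ b - a := by
    rintro ⟨m, hm⟩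
    have hb : b = a + m * n := by linarith
    have h1 := (g.2.1 a).2
    rw [hb, affinePerm_translate f.1] at hfb'
    have h2 : (0 : ℤ) < n := by exact_mod_cast hn
    have h3 : 0 < m := by
      by_contra hc
      have : m * n ≤ 0 := mul_nonpos_of_nonpos_of_nonneg (by omega) h2.le
      omega
    have : 1 * (n : ℤ) ≤ m * n := mul_le_mul_of_nonneg_right (by omega) h2.le
    linarith
  obtain ⟨t, ht⟩ := exists_isReflection (n := n) hab hdvd
  have hempty : ∀ c, a < c → c < b → f a < f c → ¬ f c < f b := fun c h1 h2 h3 h4 =>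
    absurd (hbmin c ⟨h1, h3, by omega⟩) (by omega)
  -- Compare rows `a` and `i` over the values in `(j, g a]`: between these rows `f` gains none, by
  -- minimality of `b`, whereas `g` gains `g a`.
  have hgap : ∀ i j, a < i → i ≤ b → f a ≤ j → j < f b → overRank f i j + 1 ≤ overRank g i j := by
    intro i j h1 h2 h3 h4
    have e1 := overRank_split f.le_add i (p := j) (q := g a) (by omega)
    have e2 := overRank_split g.le_add i (p := j) (q := g a) (by omega)
    have e3 := overRank_split f.le_add a (p := j) (q := g a) (by omega)
    have e4 := overRank_split g.le_add a (p := j) (q := g a) (by omega)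
    have c1 : ((Finset.Ioc j (g a)).filter (fun x => f.1.1.symm x < i)).card ≤
        ((Finset.Ioc j (g a)).filter (fun x => f.1.1.symm x < a)).card := by
      apply Finset.card_le_card
      intro x hx
      simp only [Finset.mem_filter, Finset.mem_Ioc] at hx ⊢
      refine ⟨hx.1, ?_⟩
      by_contra hc
      have h5 : f.1.1.symm x ≠ a := fun h5 => by
        rw [Equiv.symm_apply_eq] at h5
        omega
      have := hbmin (f.1.1.symm x)
      rw [Equiv.apply_symm_apply] at this
      omega
    have c2 : ((Finset.Ioc j (g a)).filter (fun x => g.1.1.symm x < a)).card <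
        ((Finset.Ioc j (g a)).filter (fun x => g.1.1.symm x < i)).card := by
      apply Finset.card_lt_card
      rw [Finset.ssubset_iff_of_subset]
      · exact ⟨g a, by simpa using ⟨by omega, h1⟩, by simp⟩
      · intro x hx
        simp only [Finset.mem_filter, Finset.mem_Ioc] at hx ⊢
        exact ⟨hx.1, by omega⟩
    have := hle a j
    have := hle i (g a)
    omega
  -- Below the diagonal all ranks are forced to agree, which the gap at `(b, f a)` would violate.
  -- This is the bound needed for the new value at `b`.
  have hbfa : b ≤ f a := by
    by_contra hc
    have h1 := hgap b (f a) hab le_rfl le_rfl hfb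
    have h2 := f.overRank_below hkn (i := b) (j := f a) (by omega)
    have h3 := g.overRank_below hkn (i := b) (j := f a) (by omega)
    omega
  have hraise := ht.isRaising hfb
  have hbdd : IsBounded n (f.1 * t).1 := by
    intro x
    change x ≤ f (t.1 x) ∧ f (t.1 x) ≤ x + n
    have h1 := f.2.1 x
    rcases ht.cases x with ⟨m, hx, hx'⟩ | ⟨m, hx, hx'⟩ | ⟨_, _, hx'⟩
    · have h2 := (f.2.1 a).1
      have h3 := (g.2.1 a).2
      rw [hx, ht.left, affinePerm_translate f.1]
      constructor <;> linarith
    · have h3 := (f.2.1 b).2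
      rw [hx, ht.right, affinePerm_translate f.1]
      constructor <;> linarith
    · rwa [hx']
  have hrank : ∀ i j, overRank (f.1 * t).1 i j ≤ overRank g i j := by
    intro i j
    have hfin : (overtaking f i j).Finite := overtaking_finite_of_le f.le_add i j
    have hfin' : (overtaking (f.1 * t).1 i j).Finite :=
      overtaking_finite_of_le (fun l => (hbdd l).2) i j
    -- positions whose value is raised beyond `j` from outside
    let X : Set ℤ := {l | l < i ∧ i ≤ t.1 l ∧ f l ≤ j ∧ j < f (t.1 l)}
    have hX : ∀ l ∈ X, ∃ m : ℤ, l = a + m * n ∧ t.1 l = b + m * n := by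
      rintro l ⟨h1, h2, h3, h4⟩
      rcases ht.cases l with ⟨m, hx, _⟩ | ⟨m, hx, hx'⟩ | ⟨_, _, hx'⟩
      · exact ⟨m, hx, by rw [hx, ht.left]⟩
      · omega
      · omega
    have hXsub : X ⊆ overtaking (f.1 * t).1 i j := fun l hl => ⟨hl.1, hl.2.2.2⟩
    have hdiff : (overtaking (f.1 * t).1 i j \ X).ncard ≤ (overtaking f i j).ncard := by
      classical
      refine Set.ncard_le_ncard_of_injOn (fun l => if j < f l then l else t.1 l) ?_ ?_ hfin
      · rintro l ⟨⟨h1, h2⟩, h3⟩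
        change j < f (t.1 l) at h2
        split_ifs with h4
        · exact ⟨h1, h4⟩
        · refine ⟨?_, h2⟩
          by_contra hc
          exact h3 ⟨h1, by omega, by omega, h2⟩
      · rintro l ⟨⟨h1, h2⟩, h3⟩ l' ⟨⟨h1', h2'⟩, h3'⟩ he
        change j < f (t.1 l) at h2
        change j < f (t.1 l') at h2'
        dsimp only at he
        split_ifs at he with h5 h6 h6
        · exact he
        · rw [he, ht.invol] at h2; exact absurd h2 h6
        · rw [← he, ht.invol] at h2'; exact absurd h2' h5
        · exact t.1.injective he
    rcases X.eq_empty_or_nonempty with hXe | ⟨l, hl⟩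
    · rw [hXe, Set.sdiff_empty] at hdiff
      exact hdiff.trans (hle i j)
    · obtain ⟨m, hm, hm'⟩ := hX l hl
      -- Two translates of `a` in `X` would place a translate of `a` strictly inside the rectangle
      -- of the cover. Hence the rank at `(i, j)` rises by at most one.
      have hX1 : X ⊆ {l} := by
        intro l' hl'
        obtain ⟨m', hm1, hm1'⟩ := hX l' hl'
        have key : ∀ (m m' : ℤ), a + m * n ∈ X → a + m' * n ∈ X → ¬ m < m' := by
          rintro m m' ⟨x1, x2, x3, x4⟩ ⟨y1, y2, y3, y4⟩ hlt
          rw [ht.left] at x2 x4 y2 y4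
          rw [affinePerm_translate f.1] at x3 y3 x4 y4
          have h2 : (0 : ℤ) < n := by exact_mod_cast hn
          have h3 : 0 < (m' - m) * n := mul_pos (by omega) h2
          refine hempty (a + (m' - m) * n) (by linarith) (by linarith) ?_ ?_
          · rw [affinePerm_translate f.1]; linarith
          · rw [affinePerm_translate f.1]; linarith
        have h1 := key m m' (hm ▸ hl) (hm1 ▸ hl')
        have h2 := key m' m (hm1 ▸ hl') (hm ▸ hl)
        have : m = m' := by omega
        rw [Set.mem_singleton_iff, hm1, hm, this]
      have hXeq : X = {l} := Set.Subset.antisymm hX1 (by simpa using hl)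
      have h1 : (overtaking (f.1 * t).1 i j).ncard = (overtaking (f.1 * t).1 i j \ X).ncard + 1 := by
        rw [hXeq, Set.ncard_sdiff_singleton_add_one (hXsub hl) hfin']
      have h2 : overRank f i j + 1 ≤ overRank g i j := by
        obtain ⟨x1, x2, x3, x4⟩ := hl
        rw [hm'] at x2 x4
        rw [hm] at x1 x3
        rw [affinePerm_translate f.1] at x3 x4
        have := hgap (i + (-m) * n) (j + (-m) * n) (by linarith) (by linarith) (by linarith)
          (by linarith)
        rwa [overRank_translate f.1, overRank_translate g.1] at this
      unfold overRank at h2 ⊢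
      omega
  refine ⟨⟨f.1 * t, hbdd, (hbdd.sum_eq_iff hkn).2 fun j => ?_⟩, ⟨a, b, t, ht, hfb, hempty, rfl⟩,
    hrank⟩
  -- The diagonal ranks lie between those of `f` and of `g`, all equal to `k`.
  apply le_antisymm
  · exact (hrank _ _).trans_eq (g.overRank_diag hkn j)
  · exact (f.overRank_diag hkn j).symm.trans_le (hraise.overRank_le (fun l => (hbdd l).2) _ _)

theorem Bound.reflTransGen_boundCover (hkn : k ≤ n) (hn : 0 < n) {f g : Bound k n}
    (hle : ∀ i j, overRank f i j ≤ overRank g i j) : Relation.ReflTransGen BoundCover f g := by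
  induction f using WellFoundedGT.induction with
  | ind f ih =>
    by_cases hne : f = g
    · subst hne; exact .refl
    · obtain ⟨h, hfh, hh⟩ := exists_boundCover_of_overRank_le hkn hn hle hne
      exact .head hfh (ih h (hfh.lt hn) hh)

/-- The converse builds the chain out of bounded elements only, so it also shows that Bruhat
comparisons in `Bound k n` can be realised inside `Bound k n`. -/
theorem Bound.le_iff (hkn : k ≤ n) {f g : Bound k n} :
    f ≤ g ↔ ∀ i j, overRank f i j ≤ overRank g i j := by
  rcases Nat.eq_zero_or_pos n with hn | hn
  · have : f = g := by
      apply Bound.ext_apply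
      intro i
      have h2 := f.2.1 i
      have h3 := g.2.1 i
      subst hn
      simp only [Nat.cast_zero, add_zero] at h2 h3
      omega
    subst this
    simp
  · constructor
    · intro h
      exact AffineBruhatLE.overRank_le h hn
    · intro h
      have := Bound.reflTransGen_boundCover hkn hn h
      induction this with
      | refl => exact le_rfl
      | tail h1 h2 ih =>
        have h3 : ∀ {x y : Bound k n}, Relation.ReflTransGen BoundCover x y → x ≤ y := by
          intro x y hxy
          induction hxy with
          | refl => exact le_rfl
          | tail _ h ih => exact ih.trans (h.lt hn).le
        exact (h3 h1).trans (h2.lt hn).le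

end Ranks

end PositroidPosets

namespace PositroidPosets

/-! ### Cyclic rank matrices -/

section CyclicRank

variable {k n : ℕ}

/-- The cyclic rank matrix of a bounded affine permutation. -/
noncomputable def Bound.rank (f : Bound k n) (i j : ℤ) : ℤ := k - overRank f i j

theorem Bound.rank_sub_row (f : Bound k n) (i j : ℤ) :
    f.rank i j - f.rank (i + 1) j = if j < f i then 1 else 0 := by
  unfold Bound.rank
  rw [overRank_add_one f.le_add]
  push_cast
  ring

theorem Bound.rank_sub_col (f : Bound k n) (i j : ℤ) :
    f.rank i j - f.rank i (j - 1) = if f.1.1.symm j < i then 1 else 0 := by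
  unfold Bound.rank
  rw [overRank_sub_one f.le_add]
  push_cast
  ring

theorem Bound.isCyclicRankMatrix (f : Bound k n) (hkn : k ≤ n) :
    IsCyclicRankMatrix k n f.rank where
  below i j h := by
    unfold Bound.rank
    rw [f.overRank_below hkn h]
    ring
  above i j h := by
    unfold Bound.rank
    rw [f.isBounded.overRank_eq_zero h]
    simp
  row_step i j := by
    rw [f.rank_sub_row]
    split_ifs <;> simp
  col_step i j := by
    rw [f.rank_sub_col]
    split_ifs <;> simp
  corner i j h h' := by
    have h1 := f.rank_sub_col (i + 1) j
    have h2 := f.rank_sub_col i j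
    split_ifs at h1 h2 <;> omega
  periodic i j := by
    unfold Bound.rank
    have := overRank_translate f.1 i j 1
    rw [one_mul] at this
    rw [this]

/-- The row difference at `(i, j)` is the indicator of `j < f i`; the three conditions locate its
drop from 1 to 0. -/
theorem Bound.apply_eq_iff (f : Bound k n) (i j : ℤ) : f i = j ↔
    f.rank i j = f.rank (i + 1) j ∧ f.rank (i + 1) j = f.rank i (j - 1) ∧
      f.rank (i + 1) (j - 1) < f.rank i (j - 1) := by
  have h1 := f.rank_sub_row i j
  have h2 := f.rank_sub_row i (j - 1)
  have h3 := f.rank_sub_col i j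
  constructor
  · rintro rfl
    rw [if_neg (by omega)] at h1
    rw [if_pos (by omega)] at h2
    rw [if_neg (by simp)] at h3
    omega
  · rintro ⟨h4, h5, h6⟩
    split_ifs at h1 h2 <;> omega

/-- Given that all steps are 0 or 1, the corner condition excludes the only way in which a row
difference could rise from 0 to 1 as `j` grows. -/
theorem IsCyclicRankMatrix.second_difference {r : ℤ → ℤ → ℤ} (hr : IsCyclicRankMatrix k n r)
    (i j : ℤ) : r i j + r (i + 1) (j - 1) ≤ r i (j - 1) + r (i + 1) j := by
  have h1 := hr.row_step i j
  have h2 := hr.row_step i (j - 1)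
  have h3 := hr.col_step i j
  have h4 := hr.col_step (i + 1) j
  have h5 := hr.corner i j
  omega

/-- The position of a special entry of a cyclic rank matrix. -/
def IsSpecialEntry (r : ℤ → ℤ → ℤ) (i j : ℤ) : Prop :=
  r i j = r (i + 1) j ∧ r (i + 1) (j - 1) < r i (j - 1)

theorem IsCyclicRankMatrix.antitone_row {r : ℤ → ℤ → ℤ} (hr : IsCyclicRankMatrix k n r)
    (i : ℤ) : Antitone fun j => r i j - r (i + 1) j := by
  apply antitone_int_of_succ_le
  intro j
  have := hr.second_difference i (j + 1)
  rw [add_sub_cancel_right] at this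
  linarith

theorem IsCyclicRankMatrix.monotone_col {r : ℤ → ℤ → ℤ} (hr : IsCyclicRankMatrix k n r)
    (j : ℤ) : Monotone fun i => r i j - r i (j - 1) := by
  apply monotone_int_of_le_succ
  intro i
  have := hr.second_difference i j
  linarith

/-- The same entries are found by scanning columns. This symmetry makes the permutations read off
from rows and from columns mutually inverse. -/
theorem IsCyclicRankMatrix.isSpecialEntry_iff {r : ℤ → ℤ → ℤ} (hr : IsCyclicRankMatrix k n r)
    (i j : ℤ) : IsSpecialEntry r i j ↔ r i j = r i (j - 1) ∧ r (i + 1) (j - 1) < r (i + 1) j := by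
  have h1 := hr.row_step i j
  have h2 := hr.row_step i (j - 1)
  have h3 := hr.col_step i j
  have h4 := hr.col_step (i + 1) j
  have h5 := hr.corner i j
  unfold IsSpecialEntry
  omega

/-- The row difference is 1 far to the left by `below` and 0 far to the right by `above`; its first
zero is the special entry. -/
theorem IsCyclicRankMatrix.exists_row {r : ℤ → ℤ → ℤ} (hr : IsCyclicRankMatrix k n r) (i : ℤ) :
    ∃ j, IsSpecialEntry r i j := by
  obtain ⟨j, h1, h2⟩ := Int.exists_least_of_bdd (P := fun j => r i j = r (i + 1) j)
    ⟨i, fun j hj => by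
      by_contra hc
      rw [hr.below i j (by omega), hr.below (i + 1) j (by omega)] at hj
      omega⟩
    ⟨i + n, by rw [hr.above _ _ (by omega), hr.above _ _ (by omega)]⟩
  refine ⟨j, h1, ?_⟩
  have h3 := h2 (j - 1)
  have h4 := hr.row_step i (j - 1)
  omega

theorem IsCyclicRankMatrix.exists_col {r : ℤ → ℤ → ℤ} (hr : IsCyclicRankMatrix k n r) (j : ℤ) :
    ∃ i, IsSpecialEntry r i j := by
  obtain ⟨i, h1, h2⟩ := Int.exists_greatest_of_bdd (P := fun i => r i j = r i (j - 1))
    ⟨j, fun i hi => by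
      by_contra hc
      rw [hr.below i j (by omega), hr.below i (j - 1) (by omega)] at hi
      omega⟩
    ⟨j - n, by rw [hr.above _ _ (by omega), hr.above _ _ (by omega)]⟩
  refine ⟨i, (hr.isSpecialEntry_iff i j).2 ⟨h1, ?_⟩⟩
  have h3 := h2 (i + 1)
  have h4 := hr.col_step (i + 1) j
  omega

theorem IsCyclicRankMatrix.row_unique {r : ℤ → ℤ → ℤ} (hr : IsCyclicRankMatrix k n r)
    {i j j' : ℤ} (h : IsSpecialEntry r i j) (h' : IsSpecialEntry r i j') : j = j' := by
  have key : ∀ {j j' : ℤ}, IsSpecialEntry r i j → IsSpecialEntry r i j' → ¬ j < j' := by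
    intro j j' h h' hlt
    have := hr.antitone_row i (show j ≤ j' - 1 by omega)
    have h1 := h.1
    have h2 := h'.2
    simp only at this
    omega
  have h1 := key h h'
  have h2 := key h' h
  omega

theorem IsCyclicRankMatrix.col_unique {r : ℤ → ℤ → ℤ} (hr : IsCyclicRankMatrix k n r)
    {i i' j : ℤ} (h : IsSpecialEntry r i j) (h' : IsSpecialEntry r i' j) : i = i' := by
  have key : ∀ {i i' : ℤ}, IsSpecialEntry r i j → IsSpecialEntry r i' j → ¬ i < i' := by
    intro i i' h h' hlt
    have := hr.monotone_col j (show i + 1 ≤ i' by omega)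
    have h1 := ((hr.isSpecialEntry_iff _ _).1 h).2
    have h2 := ((hr.isSpecialEntry_iff _ _).1 h').1
    simp only at this
    omega
  have h1 := key h h'
  have h2 := key h' h
  omega

/-- The special entries form a permutation matrix, whose bounds come from `below` and `above` and
whose periodicity comes from uniqueness in a row. -/
theorem IsCyclicRankMatrix.exists_bound {r : ℤ → ℤ → ℤ} (hr : IsCyclicRankMatrix k n r)
    (hkn : k ≤ n) : ∃ f : Bound k n, f.rank = r := by
  choose f hf using hr.exists_row
  choose g hg using hr.exists_col
  have hfb : IsBounded n f := by
    intro i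
    have h1 := (hf i).1
    have h2 := (hf i).2
    constructor
    · by_contra hc
      rw [hr.below i _ (by omega), hr.below (i + 1) _ (by omega)] at h1
      omega
    · by_contra hc
      rw [hr.above i _ (by omega), hr.above (i + 1) _ (by omega)] at h2
      omega
  let F : Equiv.Perm ℤ := ⟨f, g, fun i => hr.col_unique (hg (f i)) (hf i),
    fun j => hr.row_unique (hf (g j)) (hg j)⟩
  have hper : F ∈ affinePerm n := by
    intro i
    refine hr.row_unique (hf (i + n)) ?_
    have h := hf i
    unfold IsSpecialEntry at h ⊢
    have h1 := hr.periodic i (f i)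
    have h2 := hr.periodic (i + 1) (f i)
    have h3 := hr.periodic (i + 1) (f i - 1)
    have h4 := hr.periodic i (f i - 1)
    rw [show i + 1 + (n : ℤ) = i + n + 1 by ring] at h2 h3
    rw [show f i - 1 + (n : ℤ) = f i + n - 1 by ring] at h3 h4
    change r (i + n) (f i + n) = r (i + n + 1) (f i + n) ∧
      r (i + n + 1) (f i + n - 1) < r (i + n) (f i + n - 1)
    omega
  have hFb : IsBounded n F := hfb
  have hC : ∀ l, F l ≤ l + n := fun l => (hfb l).2
  have hlt : ∀ i j, r i j - r (i + 1) j = if j < f i then 1 else 0 := by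
    intro i j
    have h1 := (hf i).1
    have h2 := (hf i).2
    have h3 := hr.row_step i j
    have h4 := hr.row_step i (f i - 1)
    split_ifs with h
    · have := hr.antitone_row i (show j ≤ f i - 1 by omega)
      simp only at this
      omega
    · have := hr.antitone_row i (show f i ≤ j by omega)
      simp only at this
      omega
  -- Induct on `i`, starting where `i ≤ j + 1 - n` and both sides equal `k`; row differences agree
  -- by `hlt`.
  have hrank : ∀ i j, (k : ℤ) - overRank F i j = r i j := by
    intro i j
    rcases le_or_gt i (j + 1 - n) with h | h
    · rw [hr.above _ _ (by omega), hFb.overRank_eq_zero (by omega)]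
      simp
    · obtain ⟨m, rfl⟩ : ∃ m : ℕ, i = j + 1 - n + m := ⟨(i - (j + 1 - n)).toNat, by omega⟩
      clear h
      induction m with
      | zero =>
        rw [hr.above _ _ (by push_cast; omega), hFb.overRank_eq_zero (by push_cast; omega)]
        simp
      | succ m ih =>
        have h1 := hlt (j + 1 - n + m) j
        push_cast
        rw [← add_assoc, overRank_add_one hC]
        push_cast
        change (k : ℤ) - (_ + if j < f (j + 1 - n + m) then 1 else 0) = _
        linarith
  refine ⟨⟨⟨F, hper⟩, hfb, ?_⟩, ?_⟩
  · refine (IsBounded.sum_eq_iff (f := ⟨F, hper⟩) hfb hkn).2 fun j => ?_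
    have := hrank (j + 1) j
    rw [hr.below _ _ (by omega)] at this
    change overRank F (j + 1) j = k
    omega
  · funext i j
    exact hrank i j

/-- Bounded affine permutations and cyclic rank matrices. -/
noncomputable def rankIso (hkn : k ≤ n) : Bound k n ≃o CyclicRankMatrix k n where
  toEquiv := Equiv.ofBijective (fun f => ⟨f.rank, f.isCyclicRankMatrix hkn⟩) (by
    constructor
    · intro f g h
      have h' : f.rank = g.rank := congrArg Subtype.val h
      apply Bound.ext_overRank
      intro i j
      have := congrFun (congrFun h' i) j
      unfold Bound.rank at this
      omega
    · rintro ⟨r, hr⟩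
      obtain ⟨f, hf⟩ := hr.exists_bound hkn
      exact ⟨f, Subtype.ext hf⟩)
  map_rel_iff' {f g} := by
    rw [Bound.le_iff hkn]
    change (∀ i j, g.rank i j ≤ f.rank i j) ↔ _
    unfold Bound.rank
    constructor
    · intro h i j
      have := h i j
      omega
    · intro h i j
      have := h i j
      omega

end CyclicRank

/-! ### Juggling patterns -/

section Juggling

variable {k n : ℕ}

/-- Componentwise comparison of sorted sets is comparison of tail counts, which are the ranks. -/
theorem kSubset_le_iff {I J : KSubset k n} : I ≤ J ↔
    ∀ m : ℕ, (I.1.filter fun a : Fin n => m ≤ (a : ℕ)).card ≤ (J.1.filter fun a : Fin n => m ≤ (a : ℕ)).card := by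
  have hcard : ∀ (K : KSubset k n) (m : ℕ), (K.1.filter fun a : Fin n => m ≤ (a : ℕ)).card =
      (Finset.univ.filter fun p : Fin k => m ≤ ((K.1.orderEmbOfFin K.2 p : Fin n) : ℕ)).card := by
    intro K m
    rw [← Finset.card_map (K.1.orderEmbOfFin K.2).toEmbedding]
    congr 1
    ext a
    simp only [Finset.mem_filter, Finset.mem_map, Finset.mem_univ, true_and,
      RelEmbedding.coe_toEmbedding]
    constructor
    · rintro ⟨h1, h2⟩
      have : a ∈ Set.range (K.1.orderEmbOfFin K.2) := by
        rw [Finset.range_orderEmbOfFin]; exact h1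
      obtain ⟨p, rfl⟩ := this
      exact ⟨p, h2, rfl⟩
    · rintro ⟨p, h2, rfl⟩
      exact ⟨Finset.orderEmbOfFin_mem _ _ _, h2⟩
  constructor
  · intro h m
    rw [hcard, hcard]
    apply Finset.card_le_card
    intro p
    simp only [Finset.mem_filter, Finset.mem_univ, true_and]
    exact fun h' => h'.trans (h p)
  · intro h p
    by_contra hc
    rw [not_le] at hc
    -- At the level of the `p`-th element of `I`, the tail of `I` is indexed by `Ici p`, that of `J`
    -- by a subset of `Ioi p`.
    have h1 := h (I.1.orderEmbOfFin I.2 p : Fin n)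
    rw [hcard, hcard] at h1
    have h2 : (Finset.univ.filter fun q : Fin k => ((I.1.orderEmbOfFin I.2 p : Fin n) : ℕ) ≤
        ((I.1.orderEmbOfFin I.2 q : Fin n) : ℕ)) = Finset.Ici p := by
      ext q
      simp only [Finset.mem_filter, Finset.mem_univ, true_and, Finset.mem_Ici]
      rw [← Fin.le_def, OrderEmbedding.le_iff_le]
    have h3 : (Finset.univ.filter fun q : Fin k => ((I.1.orderEmbOfFin I.2 p : Fin n) : ℕ) ≤
        ((J.1.orderEmbOfFin J.2 q : Fin n) : ℕ)) ⊆ Finset.Ioi p := by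
      intro q
      simp only [Finset.mem_filter, Finset.mem_univ, true_and, Finset.mem_Ioi]
      intro hq
      rw [← Fin.le_def] at hq
      exact (OrderEmbedding.lt_iff_lt _).1 (hc.trans_le hq)
    have h4 := Finset.card_le_card h3
    rw [h2, Fin.card_Ici] at h1
    rw [Fin.card_Ioi] at h4
    have := p.2
    omega

/-- The members of a set of integers beyond `m`. -/
def beyond (S : Set ℤ) (m : ℤ) : Set ℤ := {x | x ∈ S ∧ m < x}

theorem stateRank_eq (S : Set ℤ) (m : ℤ) : stateRank k S m = k - (beyond S m).ncard := rfl

theorem beyond_finite {S : Set ℤ} (hS : ∀ x ∈ S, x ≤ (n : ℤ)) (m : ℤ) : (beyond S m).Finite := by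
  apply Set.Finite.subset (Set.finite_Icc m n)
  rintro x ⟨h1, h2⟩
  exact ⟨h2.le, hS x h1⟩

theorem ncard_beyond_sub_one {S : Set ℤ} (hS : ∀ x ∈ S, x ≤ (n : ℤ)) (m : ℤ) [Decidable (m ∈ S)] :
    (beyond S (m - 1)).ncard = (beyond S m).ncard + if m ∈ S then 1 else 0 := by
  split_ifs with h
  · rw [← Set.ncard_insert_of_notMem (a := m) (fun h' => lt_irrefl _ h'.2) (beyond_finite hS m)]
    congr 1
    ext x
    simp only [beyond, Set.mem_ofPred_eq, Set.mem_insert_iff]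
    constructor
    · rintro ⟨h1, h2⟩
      rcases (Int.sub_one_lt_iff.1 h2).eq_or_lt with h3 | h3
      · exact .inl h3.symm
      · exact .inr ⟨h1, h3⟩
    · rintro (rfl | ⟨h1, h2⟩)
      · exact ⟨h, by omega⟩
      · exact ⟨h1, by omega⟩
  · rw [add_zero]
    congr 1
    ext x
    simp only [beyond, Set.mem_ofPred_eq]
    constructor
    · rintro ⟨h1, h2⟩
      rcases (Int.sub_one_lt_iff.1 h2).eq_or_lt with h3 | h3
      · exact absurd (h3 ▸ h1) h
      · exact ⟨h1, h3⟩
    · rintro ⟨h1, h2⟩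
      exact ⟨h1, by omega⟩

theorem eq_of_ncard_beyond_eq {S T : Set ℤ} (hS : ∀ x ∈ S, x ≤ (n : ℤ)) (hT : ∀ x ∈ T, x ≤ (n : ℤ))
    (h : ∀ m, (beyond S m).ncard = (beyond T m).ncard) : S = T := by
  classical
  ext m
  have h1 := ncard_beyond_sub_one hS m
  have h2 := ncard_beyond_sub_one hT m
  rw [h, h, h2] at h1
  split_ifs at h1 <;> first | omega | tauto

/-- This becomes the row step of the rank matrix: the shift moves the level by one and the new
element adds at most one. -/
theorem ncard_beyond_follow {S : Set ℤ} (hS : ∀ x ∈ S, x ≤ (n : ℤ)) {t : ℤ}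
    (ht : t ∉ (fun x => x - 1) '' S) (m : ℤ) :
    (beyond (insert t ((fun x => x - 1) '' S)) m).ncard =
      (beyond S (m + 1)).ncard + if m < t then 1 else 0 := by
  have hinj : Function.Injective fun x : ℤ => x - 1 := fun x y h => by simpa using h
  have himg : beyond ((fun x => x - 1) '' S) m = (fun x => x - 1) '' beyond S (m + 1) := by
    ext x
    simp only [beyond, Set.mem_ofPred_eq, Set.mem_image]
    constructor
    · rintro ⟨⟨y, hy, rfl⟩, h⟩
      exact ⟨y, ⟨hy, by omega⟩, rfl⟩
    · rintro ⟨y, ⟨hy, h⟩, rfl⟩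
      exact ⟨⟨y, hy, rfl⟩, by omega⟩
  rw [← Set.ncard_image_of_injective (beyond S (m + 1)) hinj, ← himg]
  split_ifs with h
  · rw [← Set.ncard_insert_of_notMem (a := t) (fun h' => ht h'.1)
      (by rw [himg]; exact (beyond_finite hS _).image _)]
    congr 1
    ext x
    simp only [beyond, Set.mem_ofPred_eq, Set.mem_insert_iff]
    constructor
    · rintro ⟨h1 | h1, h2⟩
      · exact .inl h1
      · exact .inr ⟨h1, h2⟩
    · rintro (rfl | ⟨h1, h2⟩)
      · exact ⟨.inl rfl, h⟩
      · exact ⟨.inr h1, h2⟩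
  · rw [add_zero]
    congr 1
    ext x
    simp only [beyond, Set.mem_ofPred_eq, Set.mem_insert_iff]
    constructor
    · rintro ⟨rfl | h1, h2⟩
      · exact absurd h2 h
      · exact ⟨h1, h2⟩
    · rintro ⟨h1, h2⟩
      exact ⟨.inr h1, h2⟩

theorem toState_le (J : KSubset k n) : ∀ x ∈ toState J, x ≤ (n : ℤ) := by
  rintro x (h | ⟨a, _, rfl⟩)
  · exact (show x ≤ 0 from h).trans (by positivity)
  · have := a.2
    omega

theorem mem_toState (J : KSubset k n) (a : Fin n) : ((a : ℕ) : ℤ) + 1 ∈ toState J ↔ a ∈ J.1 := by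
  constructor
  · rintro (h | ⟨b, hb, h⟩)
    · exact absurd (show ((a : ℕ) : ℤ) + 1 ≤ 0 from h) (by omega)
    · have : a = b := Fin.ext (by omega)
      rwa [this]
  · exact fun h => .inr ⟨a, h, rfl⟩

theorem mem_toState_of_nonpos (J : KSubset k n) {x : ℤ} (hx : x ≤ 0) : x ∈ toState J := .inl hx

/-- Since `a` stands for `a + 1`, the strict `m < a + 1` turns into `m ≤ a`. -/
theorem ncard_beyond_toState (J : KSubset k n) (m : ℕ) :
    (beyond (toState J) m).ncard = (J.1.filter fun a : Fin n => m ≤ (a : ℕ)).card := by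
  have hinj : Function.Injective fun a : Fin n => ((a : ℕ) : ℤ) + 1 := fun a b h => by
    apply Fin.ext; simpa using h
  rw [← Set.ncard_coe_finset, ← Set.ncard_image_of_injective _ hinj]
  congr 1
  ext x
  simp only [beyond, Set.mem_ofPred_eq, Finset.coe_filter, Set.mem_image]
  constructor
  · rintro ⟨h | ⟨a, ha, rfl⟩, h2⟩
    · have : x ≤ 0 := h
      omega
    · exact ⟨a, ⟨ha, by omega⟩, rfl⟩
  · rintro ⟨a, ⟨ha, h⟩, rfl⟩
    exact ⟨(mem_toState J a).2 ha, by omega⟩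

theorem ncard_beyond_toState_of_nonpos (J : KSubset k n) {m : ℤ} (hm : m ≤ 0) :
    ((beyond (toState J) m).ncard : ℤ) = k - m := by
  obtain ⟨d, rfl⟩ : ∃ d : ℕ, m = -d := ⟨m.natAbs, by omega⟩
  clear hm
  classical
  induction d with
  | zero =>
    have := ncard_beyond_toState J 0
    simp only [Nat.zero_le, Finset.filter_true, J.2, Nat.cast_zero] at this
    simp [this]
  | succ d ih =>
    have := ncard_beyond_sub_one (toState_le J) (-(d : ℤ))
    rw [if_pos (mem_toState_of_nonpos J (by omega))] at this
    push_cast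
    rw [show -((d : ℤ) + 1) = -d - 1 by ring, this]
    push_cast
    linarith

/-- The members of `[n]` in a set of integers. -/
noncomputable def windowSet (n : ℕ) (S : Set ℤ) : Finset (Fin n) :=
  open Classical in Finset.univ.filter fun a : Fin n => ((a : ℕ) : ℤ) + 1 ∈ S

theorem mem_windowSet {S : Set ℤ} {a : Fin n} : a ∈ windowSet n S ↔ ((a : ℕ) : ℤ) + 1 ∈ S := by
  simp [windowSet]

theorem card_windowSet {S : Set ℤ} (hS : ∀ x ∈ S, x ≤ (n : ℤ)) :
    (windowSet n S).card = (beyond S 0).ncard := by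
  have hinj : Function.Injective fun a : Fin n => ((a : ℕ) : ℤ) + 1 := fun a b h => by
    apply Fin.ext; simpa using h
  rw [← Set.ncard_coe_finset, ← Set.ncard_image_of_injective _ hinj]
  congr 1
  ext x
  simp only [beyond, Set.mem_ofPred_eq, Set.mem_image, Finset.mem_coe, mem_windowSet]
  constructor
  · rintro ⟨a, ha, rfl⟩
    exact ⟨ha, by omega⟩
  · rintro ⟨h1, h2⟩
    have := hS x h1
    refine ⟨⟨(x - 1).toNat, by omega⟩, ?_, ?_⟩
    · rwa [show (((x - 1).toNat : ℕ) : ℤ) + 1 = x by omega]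
    · simp only
      omega

theorem toState_windowSet {S : Set ℤ} (hS : ∀ x ∈ S, x ≤ (n : ℤ)) (h0 : ∀ x ≤ 0, x ∈ S)
    (hk : (windowSet n S).card = k) : toState (⟨windowSet n S, hk⟩ : KSubset k n) = S := by
  ext x
  constructor
  · rintro (h | ⟨a, ha, rfl⟩)
    · exact h0 x h
    · exact mem_windowSet.1 ha
  · intro hx
    rcases le_or_gt x 0 with h | h
    · exact .inl h
    · have := hS x hx
      refine .inr ⟨⟨(x - 1).toNat, by omega⟩, mem_windowSet.2 ?_, ?_⟩
      · rwa [show (((x - 1).toNat : ℕ) : ℤ) + 1 = x by omega]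
      · simp only
        omega

theorem stateAt_le (f : Bound k n) (t : ℤ) : ∀ x ∈ stateAt f t, x ≤ (n : ℤ) := by
  rintro x ⟨i, hi, rfl⟩
  have := f.le_add i
  linarith

theorem mem_stateAt_of_nonpos (f : Bound k n) (t : ℤ) {x : ℤ} (hx : x ≤ 0) : x ∈ stateAt f t := by
  refine ⟨f.1.1.symm (x + t), ?_, by rw [Equiv.apply_symm_apply]; ring⟩
  have := (f.2.1 (f.1.1.symm (x + t))).1
  rw [Equiv.apply_symm_apply] at this
  linarith

/-- This is the bridge from juggling states to ranks, via the substitution `x = f l - t`. -/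
theorem ncard_beyond_stateAt (f : Bound k n) (t m : ℤ) :
    (beyond (stateAt f t) m).ncard = overRank f (t + 1) (t + m) := by
  have hinj : Function.Injective fun l : ℤ => f l - t := fun a b h => by
    apply f.1.1.injective; simpa using h
  unfold overRank
  rw [← Set.ncard_image_of_injective (overtaking f (t + 1) (t + m)) hinj]
  congr 1
  ext x
  simp only [beyond, stateAt, overtaking, Set.mem_ofPred_eq, Set.mem_image]
  constructor
  · rintro ⟨⟨i, hi, rfl⟩, h⟩
    exact ⟨i, ⟨by omega, by omega⟩, rfl⟩
  · rintro ⟨i, ⟨h1, h2⟩, rfl⟩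
    exact ⟨⟨i, by omega, rfl⟩, by omega⟩

/-- The members of `[n]` in the juggling state at time `t`. -/
noncomputable def Bound.state (hkn : k ≤ n) (f : Bound k n) (t : ℤ) : KSubset k n :=
  ⟨windowSet n (stateAt f t), by
    rw [card_windowSet (stateAt_le f t), ncard_beyond_stateAt, add_zero, f.overRank_diag hkn]⟩

theorem Bound.toState_state (hkn : k ≤ n) (f : Bound k n) (t : ℤ) :
    toState (f.state hkn t) = stateAt f t :=
  toState_windowSet (stateAt_le f t) (fun _ => mem_stateAt_of_nonpos f t) _

theorem stateAt_add_one (f : Bound k n) (t : ℤ) : CanFollow (stateAt f t) (stateAt f (t + 1)) := by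
  refine ⟨f (t + 1) - (t + 1), ?_, ?_⟩
  · rintro ⟨_, ⟨i, hi, rfl⟩, h⟩
    have : i = t + 1 := f.1.1.injective (by simp only at h; linarith)
    omega
  · ext x
    simp only [stateAt, Set.mem_ofPred_eq, Set.mem_insert_iff, Set.mem_image]
    constructor
    · rintro ⟨i, hi, rfl⟩
      rcases hi.eq_or_lt with rfl | h
      · exact .inl rfl
      · exact .inr ⟨f i - t, ⟨i, by omega, rfl⟩, by ring⟩
    · rintro (rfl | ⟨_, ⟨i, hi, rfl⟩, rfl⟩)
      · exact ⟨t + 1, le_rfl, rfl⟩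
      · exact ⟨i, by omega, by ring⟩

theorem stateAt_add_period (f : Bound k n) (t : ℤ) : stateAt f (t + n) = stateAt f t := by
  ext x
  constructor
  · rintro ⟨i, hi, rfl⟩
    refine ⟨i + (-1) * n, by linarith, ?_⟩
    rw [affinePerm_translate f.1]
    ring
  · rintro ⟨i, hi, rfl⟩
    refine ⟨i + 1 * n, by linarith, ?_⟩
    rw [affinePerm_translate f.1]
    ring

theorem val_finRotate (a : Fin n) : ((finRotate n a : Fin n) : ℕ) = (a + 1) % n := by
  obtain _ | n := n
  · exact a.elim0
  · rw [finRotate_apply, Fin.val_add]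
    simp

/-- The juggling pattern of a bounded affine permutation. -/
noncomputable def Bound.jugg (hkn : k ≤ n) (f : Bound k n) : Jugg k n :=
  ⟨fun r => f.state hkn r, fun r => by
    rw [f.toState_state, f.toState_state]
    convert stateAt_add_one f r using 1
    rw [val_finRotate]
    rcases (Nat.succ_le_of_lt r.2).eq_or_lt with h | h
    · rw [← stateAt_add_period]
      have : ((r : ℕ) + 1) % n = 0 := by rw [show (r : ℕ) + 1 = n from h, Nat.mod_self]
      rw [this]
      congr 1
      omega
    · rw [Nat.mod_eq_of_lt h]
      push_cast
      rfl⟩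

theorem Bound.state_le_iff (hkn : k ≤ n) (f g : Bound k n) (t : ℤ) :
    f.state hkn t ≤ g.state hkn t ↔
      ∀ m : ℕ, overRank f (t + 1) (t + m) ≤ overRank g (t + 1) (t + m) := by
  rw [kSubset_le_iff]
  simp only [← ncard_beyond_toState, Bound.toState_state, ncard_beyond_stateAt]

theorem Bound.eq_of_n_eq_zero (hn : n = 0) (f g : Bound k n) : f = g := by
  apply Bound.ext_apply
  intro i
  have h2 := f.2.1 i
  have h3 := g.2.1 i
  subst hn
  simp only [Nat.cast_zero, add_zero] at h2 h3
  omega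

/-- The patterns compare ranks only in rows `1, …, n` and on or above the diagonal; periodicity
supplies the other rows, and the entries below are forced. -/
theorem Bound.jugg_le_iff (hkn : k ≤ n) (f g : Bound k n) :
    f.jugg hkn ≤ g.jugg hkn ↔ f ≤ g := by
  rcases Nat.eq_zero_or_pos n with hn | hn
  · rw [Bound.eq_of_n_eq_zero hn f g]
    simp
  rw [Bound.le_iff hkn]
  constructor
  · intro h i j
    rcases lt_or_ge j (i - 1) with hij | hij
    · have h1 := f.overRank_below hkn (i := i) (j := j) (by omega)
      have h2 := g.overRank_below hkn (i := i) (j := j) (by omega)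
      omega
    · obtain ⟨p, q, h1, h2, rfl⟩ := exists_translate hn i
      have h3 := (Bound.state_le_iff hkn f g _).1 (h ⟨(p - 1).toNat, by omega⟩)
        (j - q * n - (p - 1)).toNat
      have h4 : (((p - 1).toNat : ℕ) : ℤ) = p - 1 := by omega
      have h5 : (((j - q * n - (p - 1)).toNat : ℕ) : ℤ) = j - q * n - (p - 1) := by
        apply Int.toNat_of_nonneg
        linarith
      simp only [h4, h5] at h3
      have h6 := overRank_translate f.1 p (j - q * n) q
      have h7 := overRank_translate g.1 p (j - q * n) q
      rw [sub_add_cancel] at h6 h7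
      rw [h6, h7]
      convert h3 using 2 <;> ring
  · intro h r
    exact (Bound.state_le_iff hkn f g _).2 fun m => h _ _

/-- Extended periodically, the pattern defines a cyclic rank matrix: column steps record membership
in a state, row steps record the added element. The `f` of this matrix has the given states, since a
state is determined by its tail counts. -/
theorem Bound.jugg_surjective (hkn : k ≤ n) (hn : 0 < n) (J : Jugg k n) :
    ∃ f : Bound k n, f.jugg hkn = J := by
  have hn' : (0 : ℤ) < n := by exact_mod_cast hn
  have hnat : ∀ i : ℤ, (i % n).toNat < n := fun i => by
    have := Int.emod_nonneg i hn'.ne'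
    have := Int.emod_lt_of_pos i hn'
    omega
  let S : ℤ → Set ℤ := fun i => toState (J ⟨((i - 1) % n).toNat, hnat _⟩)
  have hSle : ∀ i, ∀ x ∈ S i, x ≤ (n : ℤ) := fun i => toState_le _
  have hfollow : ∀ i, CanFollow (S i) (S (i + 1)) := by
    intro i
    convert J.2 ⟨((i - 1) % n).toNat, hnat _⟩ using 3
    apply Fin.ext
    rw [val_finRotate]
    simp only [add_sub_cancel_right]
    zify
    rw [Int.toNat_of_nonneg (Int.emod_nonneg _ hn'.ne'),
      Int.toNat_of_nonneg (Int.emod_nonneg _ hn'.ne'), Int.emod_add_emod, sub_add_cancel]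
  let r : ℤ → ℤ → ℤ := fun i j => stateRank k (S i) (j - i + 1)
  have hcol : ∀ i j, r i j - r i (j - 1) = open Classical in if j - i + 1 ∈ S i then 1 else 0 := by
    classical
    intro i j
    have := ncard_beyond_sub_one (hSle i) (j - i + 1)
    simp only [r, stateRank_eq]
    rw [show j - 1 - i + 1 = j - i + 1 - 1 by ring, this]
    push_cast
    split_ifs <;> ring
  have hr : IsCyclicRankMatrix k n r := by
    constructor
    · intro i j h
      simp only [r, stateRank_eq, S]
      rw [ncard_beyond_toState_of_nonpos _ (by omega)]
      ring
    · intro i j h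
      simp only [r, stateRank_eq, S]
      convert sub_zero (k : ℤ)
      rw [Nat.cast_eq_zero]
      convert Set.ncard_empty ℤ
      rw [Set.eq_empty_iff_forall_notMem]
      rintro x ⟨h1, h2⟩
      have := toState_le _ x h1
      omega
    · intro i j
      obtain ⟨t, ht, hT⟩ := hfollow i
      have := ncard_beyond_follow (hSle i) ht (j - (i + 1) + 1)
      simp only [r, stateRank_eq, hT, this]
      rw [show j - (i + 1) + 1 + 1 = j - i + 1 by ring]
      split_ifs
      · right; push_cast; ring
      · left; push_cast; ring
    · intro i j
      rw [hcol]
      split_ifs <;> simp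
    · intro i j h1 h2
      have h3 := hcol (i + 1) j
      have h4 := hcol i j
      rw [h1, sub_self] at h3
      -- Elements persist, shifted down by one, into the following state; so an absence there forces
      -- an absence here.
      have h5 : j - i + 1 ∉ S i := by
        intro hm
        obtain ⟨t, ht, hT⟩ := hfollow i
        have : j - (i + 1) + 1 ∈ S (i + 1) := by
          rw [hT]
          exact .inr ⟨j - i + 1, hm, by simp only; ring⟩
        rw [if_pos this] at h3
        omega
      rw [if_neg h5] at h4
      omega
    · intro i j
      simp only [r, S]
      congr 2
      · refine congrArg J.1 (Fin.ext ?_)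
        simp only
        rw [show i + n - 1 = i - 1 + n by ring, Int.add_emod_right]
      · ring
  obtain ⟨f, hf⟩ := hr.exists_bound hkn
  refine ⟨f, Subtype.ext (funext fun a => ?_)⟩
  have hst : stateAt f (a : ℕ) = toState (J a) := by
    apply eq_of_ncard_beyond_eq (stateAt_le f _) (toState_le _)
    intro m
    have h1 := congrFun (congrFun hf ((a : ℕ) + 1)) ((a : ℕ) + m)
    have h2 : S ((a : ℕ) + 1) = toState (J a) := by
      simp only [S]
      congr 2
      refine congrArg J.1 (Fin.ext ?_)
      simp only [add_sub_cancel_right]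
      rw [Int.emod_eq_of_lt (by omega) (by exact_mod_cast a.2)]
      simp
    unfold Bound.rank at h1
    simp only [r, stateRank_eq, h2] at h1
    rw [show ((a : ℕ) : ℤ) + m - ((a : ℕ) + 1) + 1 = m by ring] at h1
    rw [ncard_beyond_stateAt]
    omega
  apply Subtype.ext
  ext b
  rw [← mem_toState, ← mem_toState]
  change _ ∈ toState (f.state hkn (a : ℕ)) ↔ _
  rw [f.toState_state, hst]

theorem Bound.nonempty_of_eq_zero (hkn : k ≤ n) (hn : n = 0) : Nonempty (Bound k n) := by
  subst hn
  obtain rfl : k = 0 := by omega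
  exact ⟨⟨1, fun i => by simp, by simp⟩⟩

/-- Bounded affine permutations and juggling patterns. -/
noncomputable def juggIso (hkn : k ≤ n) : Bound k n ≃o Jugg k n where
  toEquiv := Equiv.ofBijective (fun f => f.jugg hkn) (by
    constructor
    · intro f g h
      exact le_antisymm ((Bound.jugg_le_iff hkn f g).1 h.le) ((Bound.jugg_le_iff hkn g f).1 h.ge)
    · intro J
      rcases Nat.eq_zero_or_pos n with hn | hn
      · obtain ⟨f⟩ := Bound.nonempty_of_eq_zero hkn hn
        subst hn
        exact ⟨f, Subtype.ext (funext fun r => r.elim0)⟩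
      · exact Bound.jugg_surjective hkn hn J)
  map_rel_iff' {f g} := Bound.jugg_le_iff hkn f g

end Juggling

end PositroidPosets

namespace PositroidPosets

/-! ### Positroids -/

section Positroids

variable {k n : ℕ}

/-! ### Counting in cyclic intervals -/

/-- The residue of an integer, as an element of `[n]`. -/
def residue (hn : 0 < n) (x : ℤ) : Fin n :=
  ⟨((x - 1) % n).toNat, by
    have := Int.emod_lt_of_pos (x - 1) (show (0 : ℤ) < n by exact_mod_cast hn)
    omega⟩

theorem val_residue (hn : 0 < n) (x : ℤ) : ((residue hn x : ℕ) : ℤ) = (x - 1) % n :=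
  Int.toNat_of_nonneg (Int.emod_nonneg _ (by exact_mod_cast hn.ne'))

theorem residue_eq_iff (hn : 0 < n) {x y : ℤ} :
    residue hn x = residue hn y ↔ (n : ℤ) ∣ x - y := by
  rw [← Fin.val_inj, ← Int.natCast_inj, val_residue, val_residue,
    Int.emod_eq_emod_iff_emod_sub_eq_zero, ← Int.dvd_iff_emod_eq_zero, sub_sub_sub_cancel_right]

theorem residue_translate (hn : 0 < n) (x q : ℤ) : residue hn (x + q * n) = residue hn x := by
  rw [residue_eq_iff]
  simp

theorem residue_val (hn : 0 < n) (a : Fin n) : residue hn ((a : ℕ) + 1) = a := by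
  apply Fin.ext
  zify
  rw [val_residue, add_sub_cancel_right]
  exact Int.emod_eq_of_lt (by omega) (by exact_mod_cast a.2)

/-- The residues in an interval of at most `n` integers are distinct. -/
theorem residue_injOn (hn : 0 < n) {i x y : ℤ} (hx : i ≤ x) (hx' : x < i + n) (hy : i ≤ y)
    (hy' : y < i + n) (h : residue hn x = residue hn y) : x = y := by
  rw [residue_eq_iff] at h
  have := Int.eq_zero_of_abs_lt_dvd h (by rw [abs_lt]; constructor <;> linarith)
  linarith

theorem exists_residue_eq (hn : 0 < n) (i : ℤ) (a : Fin n) :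
    ∃ x, i ≤ x ∧ x < i + n ∧ residue hn x = a := by
  have hn' : (0 : ℤ) < n := by exact_mod_cast hn
  refine ⟨i + (((a : ℕ) : ℤ) + 1 - i) % n, ?_, ?_, ?_⟩
  · linarith [Int.emod_nonneg (((a : ℕ) : ℤ) + 1 - i) hn'.ne']
  · linarith [Int.emod_lt_of_pos (((a : ℕ) : ℤ) + 1 - i) hn']
  · rw [← residue_val hn a, residue_eq_iff, residue_val]
    have := Int.emod_add_mul_ediv (((a : ℕ) : ℤ) + 1 - i) n
    exact ⟨-((((a : ℕ) : ℤ) + 1 - i) / n), by linarith⟩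

/-- The number of elements of `[i, j]` with residues in `s`. -/
noncomputable def cyclicCount (hn : 0 < n) (s : Finset (Fin n)) (i j : ℤ) : ℕ :=
  ((Finset.Icc i j).filter fun x => residue hn x ∈ s).card

theorem cyclicCount_split (hn : 0 < n) (s : Finset (Fin n)) {i m j : ℤ} (h1 : i ≤ m + 1)
    (h2 : m ≤ j) : cyclicCount hn s i j = cyclicCount hn s i m + cyclicCount hn s (m + 1) j := by
  unfold cyclicCount
  rw [← Finset.card_union_of_disjoint, ← Finset.filter_union]
  · congr 2
    ext x
    simp only [Finset.mem_union, Finset.mem_Icc]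
    omega
  · rw [Finset.disjoint_left]
    intro x hx hx'
    simp only [Finset.mem_filter, Finset.mem_Icc] at hx hx'
    omega

theorem cyclicCount_empty (hn : 0 < n) (s : Finset (Fin n)) {i j : ℤ} (h : j < i) :
    cyclicCount hn s i j = 0 := by
  unfold cyclicCount
  rw [Finset.Icc_eq_empty (by omega)]
  rfl

theorem cyclicCount_self (hn : 0 < n) (s : Finset (Fin n)) (i : ℤ) :
    cyclicCount hn s i i = if residue hn i ∈ s then 1 else 0 := by
  unfold cyclicCount
  rw [Finset.Icc_self, Finset.filter_singleton]
  split_ifs <;> rfl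

theorem cyclicCount_succ (hn : 0 < n) (s : Finset (Fin n)) {i j : ℤ} (h : i ≤ j) :
    cyclicCount hn s i j = cyclicCount hn s i (j - 1) + if residue hn j ∈ s then 1 else 0 := by
  rw [cyclicCount_split hn s (m := j - 1) (by omega) (by omega), sub_add_cancel, cyclicCount_self]

theorem cyclicCount_translate (hn : 0 < n) (s : Finset (Fin n)) (i j q : ℤ) :
    cyclicCount hn s (i + q * n) (j + q * n) = cyclicCount hn s i j := by
  unfold cyclicCount
  symm
  refine Finset.card_bij (fun x _ => x + q * n) ?_ ?_ ?_
  · intro x hx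
    simp only [Finset.mem_filter, Finset.mem_Icc, residue_translate] at hx ⊢
    exact ⟨by omega, hx.2⟩
  · intro x _ y _ h
    linarith
  · intro x hx
    simp only [Finset.mem_filter, Finset.mem_Icc] at hx
    have h : x - q * n + q * n = x := by ring
    refine ⟨x - q * n, ?_, h⟩
    simp only [Finset.mem_filter, Finset.mem_Icc]
    refine ⟨by omega, ?_⟩
    rw [← residue_translate hn _ q, h]
    exact hx.2

theorem cyclicCount_period (hn : 0 < n) (s : Finset (Fin n)) {i j : ℤ} (h : j = i + n - 1) :
    cyclicCount hn s i j = s.card := by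
  subst h
  unfold cyclicCount
  refine Finset.card_bij (fun x _ => residue hn x) ?_ ?_ ?_
  · intro x hx
    exact (Finset.mem_filter.1 hx).2
  · intro x hx y hy h
    simp only [Finset.mem_filter, Finset.mem_Icc] at hx hy
    exact residue_injOn hn hx.1.1 (by omega) hy.1.1 (by omega) h
  · intro a ha
    obtain ⟨x, h1, h2, rfl⟩ := exists_residue_eq hn i a
    exact ⟨x, Finset.mem_filter.2 ⟨Finset.mem_Icc.2 ⟨h1, by omega⟩, ha⟩, rfl⟩

theorem cyclicCount_singleton_le (hn : 0 < n) (a : Fin n) {i j : ℤ} (h : j < i + n) :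
    cyclicCount hn {a} i j ≤ 1 := by
  unfold cyclicCount
  rw [Finset.card_le_one]
  intro x hx y hy
  simp only [Finset.mem_filter, Finset.mem_Icc, Finset.mem_singleton] at hx hy
  exact residue_injOn hn hx.1.1 (by omega) hy.1.1 (by omega) (hx.2.trans hy.2.symm)

theorem cyclicCount_exchange (hn : 0 < n) {s : Finset (Fin n)} {a b : Fin n} (ha : a ∈ s)
    (hb : b ∉ s) (i j : ℤ) : cyclicCount hn (insert b (s.erase a)) i j + cyclicCount hn {a} i j =
      cyclicCount hn s i j + cyclicCount hn {b} i j := by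
  unfold cyclicCount
  simp only [Finset.card_filter, ← Finset.sum_add_distrib]
  apply Finset.sum_congr rfl
  intro x _
  simp only [Finset.mem_insert, Finset.mem_erase, Finset.mem_singleton]
  by_cases h1 : residue hn x = a
  · have h2 : a ≠ b := fun h => hb (h ▸ ha)
    simp [h1, h2, ha]
  · by_cases h2 : residue hn x = b
    · have h3 : b ≠ a := fun h => hb (h ▸ ha)
      simp [h2, h3, hb]
    · simp [h1, h2]

/-- Summing the local inequality over a rectangle gives submodularity for intervals, on which basis
exchange and minimality both rest. -/
theorem IsCyclicRankMatrix.submodular {r : ℤ → ℤ → ℤ} (hr : IsCyclicRankMatrix k n r)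
    {i i' j j' : ℤ} (hi : i ≤ i') (hj : j ≤ j') : r i j' + r i' j ≤ r i j + r i' j' := by
  obtain ⟨d, rfl⟩ : ∃ d : ℕ, i' = i + d := ⟨(i' - i).toNat, by omega⟩
  clear hi
  induction d with
  | zero => simp only [Nat.cast_zero, add_zero]; omega
  | succ d ih =>
    have := hr.antitone_row (i + d) hj
    simp only at this
    push_cast
    rw [← add_assoc]
    linarith

theorem val_finRotate_pow (a : Fin n) (r : ℕ) : (((finRotate n ^ r) a : Fin n) : ℕ) = (a + r) % n := by
  induction r with
  | zero => simp [Nat.mod_eq_of_lt a.2]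
  | succ r ih =>
    rw [pow_succ', Equiv.Perm.mul_apply, val_finRotate, ih, Nat.mod_add_mod, add_assoc]

theorem finRotate_pow_eq_residue (hn : 0 < n) (a : Fin n) (r : ℕ) :
    (finRotate n ^ r) a = residue hn (((a : ℕ) : ℤ) + 1 + r) := by
  apply Fin.ext
  rw [val_finRotate_pow]
  zify
  rw [val_residue]
  congr 1
  ring

theorem mem_rotateBack {I : KSubset k n} {r : ℕ} {a : Fin n} :
    a ∈ (rotateBack r I).1 ↔ (finRotate n ^ r) a ∈ I.1 := by
  change a ∈ I.1.map ((finRotate n ^ r)⁻¹).toEmbedding ↔ _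
  rw [Finset.mem_map_equiv]
  rfl

/-- Rotation by `χ⁻ʳ` turns tails of `[n]` into terminal pieces of the period `[r + 1, r + n]`. -/
theorem card_rotateBack (hn : 0 < n) (I : KSubset k n) (r m : ℕ) :
    ((rotateBack r I).1.filter fun a : Fin n => m ≤ (a : ℕ)).card =
      cyclicCount hn I.1 (r + m + 1) (r + n) := by
  unfold cyclicCount
  refine Finset.card_bij (fun a _ => ((a : ℕ) : ℤ) + 1 + r) ?_ ?_ ?_
  · intro a ha
    simp only [Finset.mem_filter, mem_rotateBack, Finset.mem_Icc, ← finRotate_pow_eq_residue] at ha ⊢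
    exact ⟨by omega, ha.1⟩
  · intro a _ b _ h
    exact Fin.ext (by omega)
  · intro x hx
    simp only [Finset.mem_filter, Finset.mem_Icc] at hx
    refine ⟨⟨(x - 1 - r).toNat, by omega⟩, ?_, by simp only; omega⟩
    simp only [Finset.mem_filter, mem_rotateBack]
    rw [finRotate_pow_eq_residue hn]
    refine ⟨?_, by omega⟩
    convert hx.2
    simp only
    omega

theorem Bound.rank_translate (f : Bound k n) (i j q : ℤ) :
    f.rank (i + q * n) (j + q * n) = f.rank i j := by
  unfold Bound.rank
  rw [overRank_translate f.1]

/-- A lower bound on a terminal piece of a period is an upper bound on the complementary initial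
piece, because the whole period contains `k` elements. As `r` varies, the initial pieces are all the
cyclic intervals. -/
theorem mem_juggBases_iff (hkn : k ≤ n) (hn : 0 < n) (f : Bound k n) (I : KSubset k n) :
    I ∈ juggBases (f.jugg hkn) ↔
      ∀ i j : ℤ, i ≤ j + 1 → j < i + n → (cyclicCount hn I.1 i j : ℤ) ≤ f.rank i j := by
  have key : ∀ (r m : ℕ), m ≤ n → (overRank f (r + 1) (r + m) ≤ cyclicCount hn I.1 (r + m + 1) (r + n) ↔
      (cyclicCount hn I.1 (r + 1) (r + m) : ℤ) ≤ f.rank (r + 1) (r + m)) := by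
    intro r m hm
    have h1 := cyclicCount_split hn I.1 (i := r + 1) (m := r + m) (j := r + n) (by omega) (by omega)
    rw [cyclicCount_period hn _ (by ring), I.2] at h1
    unfold Bound.rank
    omega
  have hiff : I ∈ juggBases (f.jugg hkn) ↔ ∀ (r : Fin n) (m : ℕ), m ≤ n →
      (cyclicCount hn I.1 ((r : ℕ) + 1) ((r : ℕ) + m) : ℤ) ≤
        f.rank ((r : ℕ) + 1) ((r : ℕ) + m) := by
    change (∀ r : Fin n, f.state hkn (r : ℕ) ≤ rotateBack (r : ℕ) I) ↔ _
    apply forall_congr'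
    intro r
    rw [kSubset_le_iff]
    apply forall_congr'
    intro m
    rw [← ncard_beyond_toState, f.toState_state, ncard_beyond_stateAt, card_rotateBack hn]
    rcases le_or_gt m n with hm | hm
    · rw [key r m hm]
      simp [hm]
    · rw [f.isBounded.overRank_eq_zero (by omega)]
      simp [hm]
  rw [hiff]
  constructor
  · intro h i j h1 h2
    obtain ⟨p, q, hp, hp', rfl⟩ := exists_translate hn i
    have h3 := h ⟨(p - 1).toNat, by omega⟩ (j - q * n - (p - 1)).toNat (by omega)
    have h4 : (((p - 1).toNat : ℕ) : ℤ) = p - 1 := by omega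
    have h5 : (((j - q * n - (p - 1)).toNat : ℕ) : ℤ) = j - q * n - (p - 1) :=
      Int.toNat_of_nonneg (by linarith)
    simp only [h4, h5] at h3
    rw [show p - 1 + 1 = p by ring, show p - 1 + (j - q * n - (p - 1)) = j - q * n by ring,
      ← cyclicCount_translate hn _ _ _ q, ← f.rank_translate _ _ q, sub_add_cancel] at h3
    exact h3
  · intro h r m hm
    exact h _ _ (by omega) (by omega)

/-- The exchange property for the sets that satisfy cyclic rank conditions: maximal tight intervals
avoiding a given element are disjoint. -/
theorem cyclicCount_exchangeProperty (hn : 0 < n) {r : ℤ → ℤ → ℤ} (hr : IsCyclicRankMatrix k n r)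
    (hrt : ∀ i j q : ℤ, r (i + q * n) (j + q * n) = r i j) {A B : Finset (Fin n)}
    (hcard : A.card = B.card)
    (hA : ∀ i j : ℤ, i ≤ j + 1 → j < i + n → (cyclicCount hn A i j : ℤ) ≤ r i j)
    (hB : ∀ i j : ℤ, i ≤ j + 1 → j < i + n → (cyclicCount hn B i j : ℤ) ≤ r i j)
    {a : Fin n} (ha : a ∈ A) (haB : a ∉ B) :
    ∃ b ∈ B, b ∉ A ∧ ∀ i j : ℤ, i ≤ j + 1 → j < i + n →
      (cyclicCount hn (insert b (A.erase a)) i j : ℤ) ≤ r i j := by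
  by_contra hc
  push Not at hc
  set o : ℤ := ((a : ℕ) : ℤ) + 1 with ho
  have hoa : residue hn o = a := residue_val hn a
  -- tight intervals avoiding the translates of `o`
  let T : ℤ → ℤ → Prop := fun i j => i ≤ j ∧ o < i ∧ j < o + n ∧ (cyclicCount hn A i j : ℤ) = r i j
  -- A violated interval was already tight for `A`, contains the added element and avoids `a`; it is
  -- translated to surround `x` inside the period after `o`.
  have hcover : ∀ x, o < x → x < o + n → residue hn x ∈ B → residue hn x ∉ A →
      ∃ i j, T i j ∧ i ≤ x ∧ x ≤ j := by
    intro x hx1 hx2 hxB hxA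
    obtain ⟨i, j, hij, hij', hlt⟩ := hc _ hxB hxA
    have h1 := cyclicCount_exchange hn ha hxA i j
    have h2 := cyclicCount_singleton_le hn (residue hn x) hij'
    have h3 := hA i j hij hij'
    have h4 : cyclicCount hn {a} i j = 0 := by omega
    have h5 : 0 < cyclicCount hn {residue hn x} i j := by omega
    have h6 : (cyclicCount hn A i j : ℤ) = r i j := by omega
    obtain ⟨y, hy⟩ := Finset.card_pos.1 h5
    simp only [Finset.mem_filter, Finset.mem_Icc, Finset.mem_singleton] at hy
    obtain ⟨q, hq⟩ := (residue_eq_iff hn).1 hy.2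
    have hno : ∀ z, i ≤ z → z ≤ j → residue hn z ≠ a := by
      intro z hz hz' hza
      rw [cyclicCount, Finset.card_eq_zero, Finset.filter_eq_empty_iff] at h4
      exact h4 (Finset.mem_Icc.2 ⟨hz, hz'⟩) (by simpa using hza)
    have hno' : ∀ z, i - q * n ≤ z → z ≤ j - q * n → residue hn z ≠ a := by
      intro z hz hz'
      rw [← residue_translate hn z q]
      exact hno _ (by linarith) (by linarith)
    have hxi : i - q * n ≤ x := by linarith [hy.1.1]
    have hxj : x ≤ j - q * n := by linarith [hy.1.2]
    refine ⟨i - q * n, j - q * n, ⟨hxi.trans hxj, ?_, ?_, ?_⟩, hxi, hxj⟩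
    · by_contra hcc
      exact hno' o (by linarith) (by linarith) hoa
    · by_contra hcc
      refine hno' (o + n) (by linarith) (by linarith) ?_
      have := residue_translate hn o 1
      rw [one_mul] at this
      rw [this, hoa]
    · rw [← cyclicCount_translate hn _ _ _ q, ← hrt _ _ q, sub_add_cancel, sub_add_cancel, h6]
  -- Counting is modular and `r` is submodular, so the union of two overlapping or adjacent tight
  -- intervals is tight.
  have huncross : ∀ {i j i' j' : ℤ}, T i j → T i' j' → i' < i → i ≤ j' + 1 → j' ≤ j → T i' j := by
    rintro i j i' j' ⟨h1, h2, h3, h4⟩ ⟨h1', h2', h3', h4'⟩ h5 h6 h7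
    refine ⟨by omega, h2', h3, ?_⟩
    have e1 := hr.submodular h5.le h7
    have e2 := hA i' j (by omega) (by omega)
    have e3 := hA i j' (by omega) (by omega)
    have e4 := cyclicCount_split hn A (i := i') (m := i - 1) (j := j) (by omega) (by omega)
    have e5 := cyclicCount_split hn A (i := i') (m := i - 1) (j := j') (by omega) (by omega)
    rw [sub_add_cancel] at e4 e5
    omega
  -- At any `y` that does not cut a tight interval, the initial counts satisfy `B ≤ A`. If a tight
  -- interval ends at `y`, remove the longest one, on which `B ≤ r = A`; otherwise remove `y`, which
  -- is then in `A` whenever it is in `B`.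
  have hmain : ∀ d : ℕ, ∀ y, y = o + d → y < o + n → (∀ i j, T i j → i ≤ y → ¬ y < j) →
      cyclicCount hn B (o + 1) y ≤ cyclicCount hn A (o + 1) y := by
    intro d
    induction d using Nat.strong_induction_on with
    | _ d ih =>
      intro y hy hy' hs
      rcases Nat.eq_zero_or_pos d with hd | hd
      · subst hd
        rw [cyclicCount_empty hn _ (by omega)]
        exact Nat.zero_le _
      by_cases hT : ∃ i, T i y
      · obtain ⟨i, hi, himin⟩ := Int.exists_least_of_bdd (P := fun i => T i y)
          ⟨o, fun z hz => hz.2.1.le⟩ hT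
        have h1 := hi.1
        have h2 := hi.2.1
        have h3 := ih (i - 1 - o).toNat (by omega) (i - 1) (by omega) (by omega) (by
          intro i' j' hT' hle hlt
          have h4 : j' ≤ y := by
            by_contra hcc
            exact hs i' j' hT' (by omega) (by omega)
          have := himin i' (huncross hi hT' (by omega) (by omega) h4)
          omega)
        have h4 := cyclicCount_split hn A (i := o + 1) (m := i - 1) (j := y) (by omega) (by omega)
        have h5 := cyclicCount_split hn B (i := o + 1) (m := i - 1) (j := y) (by omega) (by omega)
        rw [sub_add_cancel] at h4 h5
        have h6 := hB i y (by omega) (by omega)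
        have h7 := hi.2.2.2
        omega
      · have h1 : residue hn y ∈ B → residue hn y ∈ A := by
          intro hyB
          by_contra hyA
          obtain ⟨i, j, hij, h2, h3⟩ := hcover y (by omega) hy' hyB hyA
          rcases h3.eq_or_lt with h4 | h4
          · exact hT ⟨i, h4 ▸ hij⟩
          · exact hs i j hij h2 h4
        have h2 := ih (d - 1) (by omega) (y - 1) (by omega) (by omega) (by
          intro i j hij h3 h4
          rcases (show y ≤ j by omega).eq_or_lt with h5 | h5
          · exact hT ⟨i, h5 ▸ hij⟩
          · exact hs i j hij (by omega) h5)
        rw [cyclicCount_succ hn _ (by omega), cyclicCount_succ hn A (by omega)]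
        split_ifs with h3 h4
        · omega
        · exact absurd (h1 h3) h4
        · omega
        · omega
  -- Over the period with `o + n` removed, `B` keeps all its elements and `A` loses `a`,
  -- contradicting equal cardinalities.
  have h1 := hmain (n - 1) (o + n - 1) (by omega) (by omega) (fun i j hij _ h => by
    have := hij.2.2.1
    omega)
  have h2 : residue hn (o + n) = a := by
    have := residue_translate hn o 1
    rw [one_mul] at this
    rw [this, hoa]
  have h3 := cyclicCount_succ hn A (i := o + 1) (j := o + n) (by omega)
  have h4 := cyclicCount_succ hn B (i := o + 1) (j := o + n) (by omega)
  rw [h2, if_pos ha, cyclicCount_period hn _ (by ring)] at h3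
  rw [h2, if_neg haB, cyclicCount_period hn _ (by ring)] at h4
  omega

/-- Every member of a juggling pattern is a rotated basis. -/
theorem exists_mem_juggBases_rotateBack (hkn : k ≤ n) (f : Bound k n) (t : Fin n) :
    ∃ I ∈ juggBases (f.jugg hkn), rotateBack (t : ℕ) I = f.jugg hkn t := by
  have hn : 0 < n := by have := t.2; omega
  have hr := f.isCyclicRankMatrix hkn
  let I : KSubset k n := ⟨(f.jugg hkn t).1.map (finRotate n ^ (t : ℕ)).toEmbedding, by
    rw [Finset.card_map]; exact (f.jugg hkn t).2⟩
  have hI : rotateBack (t : ℕ) I = f.jugg hkn t := by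
    apply Subtype.ext
    ext a
    rw [mem_rotateBack]
    change (finRotate n ^ (t : ℕ)) a ∈ (f.jugg hkn t).1.map (finRotate n ^ (t : ℕ)).toEmbedding ↔ _
    exact Finset.mem_map' (finRotate n ^ (t : ℕ)).toEmbedding
  refine ⟨I, (mem_juggBases_iff hkn hn f I).2 ?_, hI⟩
  -- The rotated `J t` attains every rank bound on the intervals that begin at `t + 1`; the other
  -- intervals are controlled by splitting and submodularity.
  have hbase : ∀ y : ℤ, (t : ℕ) ≤ y → y ≤ (t : ℕ) + n →
      (cyclicCount hn I.1 ((t : ℕ) + 1) y : ℤ) = f.rank ((t : ℕ) + 1) y := by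
    intro y h1 h2
    obtain ⟨m, rfl⟩ : ∃ m : ℕ, y = (t : ℕ) + m := ⟨(y - (t : ℕ)).toNat, by omega⟩
    have h3 := card_rotateBack hn I t m
    rw [hI, ← ncard_beyond_toState] at h3
    change (beyond (toState (f.state hkn (t : ℕ))) m).ncard = _ at h3
    rw [f.toState_state, ncard_beyond_stateAt] at h3
    have h4 := cyclicCount_split hn I.1 (i := (t : ℕ) + 1) (m := (t : ℕ) + m) (j := (t : ℕ) + n)
      (by omega) (by omega)
    rw [cyclicCount_period hn _ (by ring), I.2] at h4
    unfold Bound.rank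
    omega
  intro i j hij hij'
  obtain ⟨p, q, hp, hp', hpq⟩ := exists_translate hn (i - (t : ℕ))
  obtain ⟨i, rfl⟩ : ∃ i', i = i' + q * n := ⟨i - q * n, by ring⟩
  obtain ⟨j, rfl⟩ : ∃ j', j = j' + q * n := ⟨j - q * n, by ring⟩
  rw [cyclicCount_translate, f.rank_translate]
  have h1 : (t : ℕ) + 1 ≤ i := by linarith
  have h2 : i ≤ (t : ℕ) + n := by linarith
  have h3 : i ≤ j + 1 := by linarith
  have h4 : j < i + n := by linarith
  have e1 := hbase (i - 1) (by omega) (by omega)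
  rcases le_or_gt j ((t : ℕ) + n) with hj | hj
  · have e2 := hbase j (by omega) hj
    have e3 := cyclicCount_split hn I.1 (i := (t : ℕ) + 1) (m := i - 1) (j := j) (by omega) (by omega)
    rw [sub_add_cancel] at e3
    have e4 := hr.submodular h1 (show i - 1 ≤ j by omega)
    rw [hr.below i (i - 1) (by omega)] at e4
    omega
  · have e2 := hbase ((t : ℕ) + n) (by omega) le_rfl
    rw [hr.above _ _ (by omega)] at e2
    have e3 := cyclicCount_split hn I.1 (i := (t : ℕ) + 1) (m := i - 1) (j := (t : ℕ) + n)
      (by omega) (by omega)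
    rw [sub_add_cancel] at e3
    have e4 := cyclicCount_split hn I.1 (i := i) (m := (t : ℕ) + n) (j := j) (by omega) (by omega)
    have e5 := hbase (j - n) (by omega) (by omega)
    have e6 := cyclicCount_translate hn I.1 ((t : ℕ) + 1) (j - n) 1
    have e7 := f.rank_translate ((t : ℕ) + 1) (j - n) 1
    have e8 := f.rank_translate ((t : ℕ) + 1) (i - 1) 1
    rw [one_mul, show ((t : ℕ) : ℤ) + 1 + n = (t : ℕ) + n + 1 by ring, sub_add_cancel] at e6 e7
    rw [one_mul, show ((t : ℕ) : ℤ) + 1 + n = (t : ℕ) + n + 1 by ring] at e8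
    -- For an interval wrapping past `t + n`, the other row is the translate of row `t + 1` and the
    -- other end is `i - 1 + n`, where the rank is already `k`.
    have e9 := hr.submodular (i := i) (i' := (t : ℕ) + n + 1) (j := j) (j' := i - 1 + n)
      (by omega) (by omega)
    rw [hr.above i (i - 1 + n) (by omega)] at e9
    omega

/-- The positroid of a juggling pattern. -/
theorem exists_matroid_hasBases (hkn : k ≤ n) (J : Jugg k n) :
    ∃ M : Matroid (Fin n), M.E = Set.univ ∧ HasBases M (juggBases J) := by
  obtain ⟨f, rfl⟩ : ∃ f : Bound k n, f.jugg hkn = J := (juggIso hkn).surjective J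
  have hne : ∃ S : Set (Fin n), ∃ I ∈ juggBases (f.jugg hkn), (I.1 : Set (Fin n)) = S := by
    rcases Nat.eq_zero_or_pos n with hn | hn
    · subst hn
      obtain rfl : k = 0 := by omega
      exact ⟨_, ⟨∅, rfl⟩, fun r => r.elim0, rfl⟩
    · obtain ⟨I, hI, _⟩ := exists_mem_juggBases_rotateBack hkn f ⟨0, hn⟩
      exact ⟨_, I, hI, rfl⟩
  have hex : Matroid.ExchangeProperty fun S : Set (Fin n) =>
      ∃ I ∈ juggBases (f.jugg hkn), (I.1 : Set (Fin n)) = S := by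
    rintro _ _ ⟨A, hA, rfl⟩ ⟨B, hB, rfl⟩ a ⟨ha, haB⟩
    have hn : 0 < n := by have := a.2; omega
    rw [mem_juggBases_iff hkn hn] at hA hB
    obtain ⟨b, hb, hbA, h⟩ := cyclicCount_exchangeProperty hn (f.isCyclicRankMatrix hkn)
      f.rank_translate (A.2.trans B.2.symm) hA hB (Finset.mem_coe.1 ha)
      (fun h => haB (Finset.mem_coe.2 h))
    refine ⟨b, ⟨hb, hbA⟩, ⟨insert b (A.1.erase a), ?_⟩, ?_, ?_⟩
    · rw [Finset.card_insert_of_notMem (fun h => hbA (Finset.mem_of_mem_erase h)),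
        Finset.card_erase_add_one ha, A.2]
    · exact (mem_juggBases_iff hkn hn f _).2 h
    · simp
  exact ⟨Matroid.ofIsBaseOfFinite Set.finite_univ _ hne hex fun _ _ => Set.subset_univ _, rfl,
    fun _ => Iff.rfl⟩

/-- The positroid of a juggling pattern. -/
noncomputable def Jugg.positroid (hkn : k ≤ n) (J : Jugg k n) : Positroid k n :=
  ⟨(exists_matroid_hasBases hkn J).choose, (exists_matroid_hasBases hkn J).choose_spec.1, J,
    (exists_matroid_hasBases hkn J).choose_spec.2⟩

theorem Jugg.hasBases_positroid (hkn : k ≤ n) (J : Jugg k n) :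
    HasBases (J.positroid hkn).1 (juggBases J) := (exists_matroid_hasBases hkn J).choose_spec.2

theorem Jugg.isBase_positroid (hkn : k ≤ n) (J : Jugg k n) (I : KSubset k n) :
    (J.positroid hkn).1.IsBase (I.1 : Set (Fin n)) ↔ I ∈ juggBases J := by
  rw [J.hasBases_positroid hkn]
  constructor
  · rintro ⟨I', h, he⟩
    have : I' = I := Subtype.ext (Finset.coe_injective he)
    rwa [← this]
  · exact fun h => ⟨I, h, rfl⟩

theorem Jugg.isLeast (hkn : k ≤ n) (J : Jugg k n) (r : Fin n) :
    IsLeast (rotatedBases (J.positroid hkn) (r : ℕ)) (J r) := by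
  obtain ⟨f, rfl⟩ : ∃ f : Bound k n, f.jugg hkn = J := (juggIso hkn).surjective J
  constructor
  · obtain ⟨I, hI, he⟩ := exists_mem_juggBases_rotateBack hkn f r
    exact ⟨I, (Jugg.isBase_positroid hkn _ I).2 hI, he.symm⟩
  · rintro K ⟨I, hI, rfl⟩
    exact (Jugg.isBase_positroid hkn _ I).1 hI r

/-- Each entry of the larger pattern is a rotated basis of its positroid; if that is also a basis of
the other positroid, it lies above the corresponding entry there. -/
theorem Jugg.positroid_le_iff (hkn : k ≤ n) (J J' : Jugg k n) :
    J.positroid hkn ≤ J'.positroid hkn ↔ J ≤ J' := by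
  constructor
  · intro h r
    obtain ⟨⟨I, hI, he⟩, _⟩ := J'.isLeast hkn r
    rw [he]
    exact (J.isBase_positroid hkn I).1 (h _ hI) r
  · intro h S hS
    obtain ⟨I, hI, rfl⟩ := (J'.hasBases_positroid hkn S).1 hS
    exact (J.isBase_positroid hkn I).2 fun r => (h r).trans (hI r)

/-- Juggling patterns and positroids. -/
noncomputable def positroidIso (hkn : k ≤ n) : Jugg k n ≃o Positroid k n where
  toEquiv := Equiv.ofBijective (fun J => J.positroid hkn) (by
    constructor
    · intro J J' h
      exact le_antisymm ((Jugg.positroid_le_iff hkn J J').1 h.le)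
        ((Jugg.positroid_le_iff hkn J' J).1 h.ge)
    · rintro ⟨M, hE, J, hJ⟩
      refine ⟨J, Subtype.ext (Matroid.ext_isBase ?_ fun S _ => ?_)⟩
      · exact (J.positroid hkn).2.1.trans hE.symm
      · rw [J.hasBases_positroid hkn, hJ])
  map_rel_iff' {J J'} := Jugg.positroid_le_iff hkn J J'

theorem positroidIso_apply (hkn : k ≤ n) (J : Jugg k n) :
    positroidIso hkn J = J.positroid hkn := rfl

end Positroids

end PositroidPosets

namespace PositroidPosets

/-! ### Pairs of permutations and bounded affine permutations -/

section Pairs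

variable {k n : ℕ}

/-- `f` is the bounded affine permutation `f_{u,w}`. -/
def IsPairWindow (f : Bound k n) (u w : Equiv.Perm (Fin n)) : Prop :=
  ∀ i : Fin n, f (((i : ℕ) : ℤ) + 1) = pairWindow k u w i

/-- The shift of a position: `n` in the first block and `0` in the second. -/
def blockShift (k : ℕ) (a : Fin n) : ℤ := if (a : ℕ) < k then n else 0

theorem blockShift_of_lt {a : Fin n} (h : (a : ℕ) < k) : blockShift k a = n := if_pos h

theorem blockShift_of_ge {a : Fin n} (h : k ≤ (a : ℕ)) : blockShift k a = 0 :=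
  if_neg (not_lt.2 h)

theorem isPairWindow_iff {f : Bound k n} {u w : Equiv.Perm (Fin n)} :
    IsPairWindow f u w ↔
      ∀ a : Fin n, f (((w a : ℕ) : ℤ) + 1) = ((u a : ℕ) : ℤ) + 1 + blockShift k a := by
  constructor
  · intro h a
    rw [h (w a)]
    simp [pairWindow, blockShift]
  · intro h i
    have := h (w⁻¹ i)
    rw [show w (w⁻¹ i) = i from w.apply_symm_apply i] at this
    exact this

theorem IsPairWindow.apply {f : Bound k n} {u w : Equiv.Perm (Fin n)} (h : IsPairWindow f u w)
    (a : Fin n) (q : ℤ) :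
    f (((w a : ℕ) : ℤ) + 1 + q * n) = ((u a : ℕ) : ℤ) + 1 + blockShift k a + q * n := by
  rw [affinePerm_translate f.1, isPairWindow_iff.1 h]

theorem exists_fin_translate (hn : 0 < n) (x : ℤ) :
    ∃ (i : Fin n) (q : ℤ), x = ((i : ℕ) : ℤ) + 1 + q * n := by
  obtain ⟨p, q, h1, h2, rfl⟩ := exists_translate hn x
  refine ⟨⟨(p - 1).toNat, by omega⟩, q, ?_⟩
  simp only
  rw [Int.toNat_of_nonneg (by omega)]
  ring

theorem IsPairWindow.unique {f g : Bound k n} {u w : Equiv.Perm (Fin n)} (hf : IsPairWindow f u w)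
    (hg : IsPairWindow g u w) : f = g := by
  rcases Nat.eq_zero_or_pos n with hn | hn
  · exact Bound.eq_of_n_eq_zero hn f g
  · apply Bound.ext_apply
    intro x
    obtain ⟨i, q, rfl⟩ := exists_fin_translate hn x
    rw [affinePerm_translate f.1, affinePerm_translate g.1, hf, hg]

/-- Boundedness of `f` is precisely `u ≤ w` on the first block and `w ≤ u` on the second, so only
the block clause needs checking. -/
theorem IsPairWindow.kCriterion {f : Bound k n} {u w : Equiv.Perm (Fin n)}
    (h : IsPairWindow f u w)
    (hb : ∀ a b : Fin n, SameBlock k a b → a < b → u a < u b → w a < w b) :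
    KCriterion k u w := by
  rw [isPairWindow_iff] at h
  refine ⟨fun a ha => ?_, fun a ha => ?_, hb⟩
  · have h1 := h a
    have h2 := f.le_add (((w a : ℕ) : ℤ) + 1)
    rw [blockShift_of_lt ha] at h1
    rw [Fin.le_def]
    omega
  · have h1 := h a
    have h2 := (f.2.1 (((w a : ℕ) : ℤ) + 1)).1
    rw [blockShift_of_ge ha] at h1
    rw [Fin.le_def]
    omega

theorem ediv_translate (hn : 0 < n) (i : Fin n) (q : ℤ) :
    (((i : ℕ) : ℤ) + 1 + q * n - 1) / n = q := by
  have hn' : (n : ℤ) ≠ 0 := by exact_mod_cast hn.ne'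
  rw [show ((i : ℕ) : ℤ) + 1 + q * n - 1 = (i : ℕ) + q * n by ring, Int.add_mul_ediv_right _ _ hn',
    Int.ediv_eq_zero_of_lt (by omega) (by exact_mod_cast i.2), zero_add]

theorem sum_Icc_eq_sum_fin (h : ℤ → ℤ) :
    ∑ i ∈ Finset.Icc (1 : ℤ) n, h i = ∑ i : Fin n, h (((i : ℕ) : ℤ) + 1) := by
  symm
  refine Finset.sum_bij (fun i _ => ((i : ℕ) : ℤ) + 1) ?_ ?_ ?_ ?_
  · intro i _
    rw [Finset.mem_Icc]
    omega
  · intro i _ j _ h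
    exact Fin.ext (by omega)
  · intro x hx
    rw [Finset.mem_Icc] at hx
    exact ⟨⟨(x - 1).toNat, by omega⟩, Finset.mem_univ _, by simp only; omega⟩
  · intro i _
    rfl

theorem sum_ite_val_lt (hkn : k ≤ n) : ∑ a : Fin n, (if (a : ℕ) < k then 1 else 0) = k := by
  rw [Fin.sum_univ_eq_sum_range (fun i => if i < k then 1 else 0) n, ← Finset.card_filter]
  have : (Finset.range n).filter (fun i => i < k) = Finset.range k := by
    ext x; simp only [Finset.mem_filter, Finset.mem_range]; omega
  rw [this, Finset.card_range]

theorem sum_blockShift (hkn : k ≤ n) : ∑ a : Fin n, blockShift k a = n * k := by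
  have h1 := congrArg (Nat.cast : ℕ → ℤ) (sum_ite_val_lt hkn)
  push_cast at h1
  rw [← h1, Finset.mul_sum]
  apply Finset.sum_congr rfl
  intro a _
  unfold blockShift
  split_ifs <;> simp

/-- The values of `u` and of `w` have equal sums, so the total displacement is that of the block
shifts, `n * k`. -/
theorem KCriterion.exists_bound {u w : Equiv.Perm (Fin n)} (h : KCriterion k u w) (hkn : k ≤ n) :
    ∃ f : Bound k n, IsPairWindow f u w := by
  rcases Nat.eq_zero_or_pos n with hn | hn
  · obtain ⟨f⟩ := Bound.nonempty_of_eq_zero hkn hn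
    subst hn
    exact ⟨f, fun i => i.elim0⟩
  let e : Fin n → ℤ := fun a => if (a : ℕ) < k then 1 else 0
  have he : ∀ a, blockShift k a = e a * n := fun a => by
    simp only [e, blockShift]
    split_ifs <;> simp
  let F : ℤ → ℤ := fun x =>
    (u (w.symm (residue hn x)) : ℕ) + 1 + ((x - 1) / n + e (w.symm (residue hn x))) * n
  let G : ℤ → ℤ := fun y =>
    (w (u.symm (residue hn y)) : ℕ) + 1 + ((y - 1) / n - e (u.symm (residue hn y))) * n
  have hF : ∀ (a : Fin n) (q : ℤ), F ((w a : ℕ) + 1 + q * n) = (u a : ℕ) + 1 + (q + e a) * n := by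
    intro a q
    simp only [F]
    rw [residue_translate, residue_val, ediv_translate hn, Equiv.symm_apply_apply]
  have hG : ∀ (a : Fin n) (q : ℤ), G ((u a : ℕ) + 1 + q * n) = (w a : ℕ) + 1 + (q - e a) * n := by
    intro a q
    simp only [G]
    rw [residue_translate, residue_val, ediv_translate hn, Equiv.symm_apply_apply]
  have hdec : ∀ (v : Equiv.Perm (Fin n)) (x : ℤ), ∃ a q, x = (v a : ℕ) + 1 + q * n := by
    intro v x
    obtain ⟨i, q, rfl⟩ := exists_fin_translate hn x
    exact ⟨v.symm i, q, by rw [Equiv.apply_symm_apply]⟩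
  let P : Equiv.Perm ℤ := ⟨F, G, fun x => by
    obtain ⟨a, q, rfl⟩ := hdec w x
    rw [hF, hG, add_sub_cancel_right], fun y => by
    obtain ⟨a, q, rfl⟩ := hdec u y
    rw [hG, hF, sub_add_cancel]⟩
  have hP : P ∈ affinePerm n := by
    intro x
    obtain ⟨a, q, rfl⟩ := hdec w x
    change F _ = F _ + n
    rw [show ((w a : ℕ) : ℤ) + 1 + q * n + n = (w a : ℕ) + 1 + (q + 1) * n by ring, hF, hF]
    ring
  have hwin : ∀ a, F ((w a : ℕ) + 1) = (u a : ℕ) + 1 + blockShift k a := by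
    intro a
    have := hF a 0
    rw [zero_mul, add_zero, zero_add, ← he] at this
    exact this
  refine ⟨⟨⟨P, hP⟩, ?_, ?_⟩, isPairWindow_iff.2 hwin⟩
  · intro x
    obtain ⟨a, q, rfl⟩ := hdec w x
    change _ ≤ F _ ∧ F _ ≤ _
    rw [hF, add_mul, ← he]
    have := (w a).2
    have := (u a).2
    rcases lt_or_ge (a : ℕ) k with ha | ha
    · have := Fin.le_def.1 (h.lower a ha)
      rw [blockShift_of_lt ha]
      constructor <;> linarith
    · have := Fin.le_def.1 (h.upper a ha)
      rw [blockShift_of_ge ha]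
      constructor <;> linarith
  · change ∑ i ∈ Finset.Icc (1 : ℤ) n, (F i - i) = _
    rw [sum_Icc_eq_sum_fin (fun i => F i - i), ← Equiv.sum_comp w]
    have : ∀ a, F ((w a : ℕ) + 1) - ((w a : ℕ) + 1) =
        ((u a : ℕ) : ℤ) - ((w a : ℕ) : ℤ) + blockShift k a := fun a => by rw [hwin]; ring
    rw [Finset.sum_congr rfl fun a _ => this a, Finset.sum_add_distrib, Finset.sum_sub_distrib,
      Equiv.sum_comp u (fun c => ((c : ℕ) : ℤ)), Equiv.sum_comp w (fun c => ((c : ℕ) : ℤ)),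
      sub_self, zero_add, sum_blockShift hkn]

/-! ### Monotonicity in the pair -/

/-- Positions up to `i - n` have values at most `i ≤ j`, so only the period `(i - n, i]` counts; `l
a` is its representative of the class of `w a`. -/
theorem IsPairWindow.overRank_eq {f : Bound k n} {u w : Equiv.Perm (Fin n)}
    (h : IsPairWindow f u w) {i : ℕ} (hi : i ≤ n) {j : ℤ} (hj : (i : ℤ) ≤ j) :
    overRank f (i + 1) j = (Finset.univ.filter fun a : Fin n => j <
      ((u a : ℕ) : ℤ) + 1 + blockShift k a - if (w a : ℕ) < i then 0 else (n : ℤ)).card := by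
  let l : Fin n → ℤ := fun a => ((w a : ℕ) : ℤ) + 1 - if (w a : ℕ) < i then 0 else (n : ℤ)
  have hl : ∀ a, f (l a) =
      ((u a : ℕ) : ℤ) + 1 + blockShift k a - if (w a : ℕ) < i then 0 else (n : ℤ) := by
    intro a
    simp only [l]
    split_ifs
    · have := h.apply a 0
      simpa using this
    · have := h.apply a (-1)
      rw [neg_one_mul] at this
      rw [sub_eq_add_neg, this]
      ring
  have hinj : Function.Injective l := by
    intro a b hab
    have ha := (w a).2
    have hb := (w b).2
    simp only [l] at hab
    apply w.injective
    apply Fin.ext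
    split_ifs at hab <;> omega
  unfold overRank
  rw [← Set.ncard_coe_finset, ← Set.ncard_image_of_injective _ hinj]
  congr 1
  ext x
  simp only [overtaking, Set.mem_ofPred_eq, Finset.coe_filter, Finset.mem_univ, true_and,
    Set.mem_image]
  constructor
  · rintro ⟨h1, h2⟩
    have h3 := f.le_add x
    rcases lt_or_ge 0 x with hx | hx
    · refine ⟨w.symm ⟨(x - 1).toNat, by omega⟩, ?_⟩
      have : l (w.symm ⟨(x - 1).toNat, by omega⟩) = x := by
        simp only [l, Equiv.apply_symm_apply]
        rw [if_pos (by omega)]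
        omega
      rw [← hl, this]
      exact ⟨h2, rfl⟩
    · refine ⟨w.symm ⟨(x + n - 1).toNat, by omega⟩, ?_⟩
      have : l (w.symm ⟨(x + n - 1).toNat, by omega⟩) = x := by
        simp only [l, Equiv.apply_symm_apply]
        rw [if_neg (by omega)]
        omega
      rw [← hl, this]
      exact ⟨h2, rfl⟩
  · rintro ⟨a, h1, rfl⟩
    rw [← hl] at h1
    refine ⟨?_, h1⟩
    have := (w a).2
    simp only [l]
    split_ifs <;> omega

theorem permRank_eq_sum (w : Equiv.Perm (Fin n)) (m j : ℕ) : permRank w m j =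
    ∑ a : Fin n, if (a : ℕ) < m ∧ j ≤ (w a : ℕ) then 1 else 0 := by
  unfold permRank
  rw [Finset.card_filter]

/-- The first position of a block at which `w` is large but `u` is small. -/
theorem exists_first_defect (u w : Equiv.Perm (Fin n)) (i j : ℕ) {lo hi : ℕ} (h : lo ≤ hi)
    (hb : ∀ a b : Fin n, lo ≤ (a : ℕ) → (b : ℕ) < hi → a < b → u a < u b → w a < w b) :
    ∃ m, lo ≤ m ∧ m ≤ hi ∧
      (∀ a : Fin n, lo ≤ (a : ℕ) → (a : ℕ) < m → i ≤ (w a : ℕ) → j ≤ (u a : ℕ)) ∧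
      ∀ a : Fin n, m ≤ (a : ℕ) → (a : ℕ) < hi → (w a : ℕ) < i → (u a : ℕ) < j := by
  classical
  by_cases hex : ∃ m, ∃ hm : m < n, lo ≤ m ∧ m < hi ∧ i ≤ (w ⟨m, hm⟩ : ℕ) ∧ (u ⟨m, hm⟩ : ℕ) < j
  · obtain ⟨hm, h1, h2, h3, h4⟩ := Nat.find_spec hex
    have hmin := fun x hx => Nat.find_min hex (m := x) hx
    generalize Nat.find hex = m at *
    refine ⟨m, h1, h2.le, ?_, ?_⟩
    · intro a ha ha' hw
      by_contra hc
      exact hmin a ha' ⟨a.2, ha, by omega, hw, not_le.1 hc⟩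
    · intro a ha ha' hw
      by_contra hc
      rcases ha.eq_or_lt with he | hlt
      · subst he
        exact absurd h4 hc
      -- A later bad `a` would satisfy `u m < j ≤ u a`, so the block clause would give `i ≤ w m < w
      -- a < i`.
      · have := Fin.lt_def.1 (hb ⟨m, hm⟩ a h1 ha' (Fin.lt_def.2 hlt) (Fin.lt_def.2 (by omega)))
        omega
  · push Not at hex
    refine ⟨hi, h, le_rfl, fun a ha ha' hw => hex a a.2 ha ha' hw, fun a ha ha' => by omega⟩

/-- `f_{u,w}` is increasing in `u` and decreasing in `w`, over all pairs `u ≤_k w`. -/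
theorem IsPairWindow.le_of_bruhatLE (hkn : k ≤ n) {f f' : Bound k n} {u w u' w' : Equiv.Perm (Fin n)}
    (h : IsPairWindow f u w) (h' : IsPairWindow f' u' w') (hk : KCriterion k u w)
    (hk' : KCriterion k u' w') (hu : BruhatLE u u') (hw : BruhatLE w' w) : f ≤ f' := by
  rcases Nat.eq_zero_or_pos n with hn | hn
  · exact (Bound.eq_of_n_eq_zero hn f f').le
  rw [Bound.le_iff hkn]
  have hmain : ∀ (i : ℕ) (j : ℤ), i ≤ n → (i : ℤ) ≤ j →
      overRank f (i + 1) j ≤ overRank f' (i + 1) j := by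
    intro i j hi hj
    rw [h.overRank_eq hi hj, h'.overRank_eq hi hj]
    simp only [Finset.card_filter]
    obtain ⟨j, rfl⟩ : ∃ j' : ℕ, j = j' := ⟨j.toNat, by omega⟩
    -- The cut `m` is the first defect of `(u, w)`, in the second block if `j ≤ n` and in the first
    -- otherwise. There the rank of `f` is at most `k + permRank u m j - permRank w m i`, and that
    -- of `f'` at least the same expression in `(u', w')`. For `j > n`, the level is replaced by its
    -- excess over `n` and the term `k` disappears.
    rcases le_or_gt j n with hjn | hjn
    · obtain ⟨m, hm1, hm2, hm3, hm4⟩ := exists_first_defect u w i j hkn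
        fun a b ha hb hab => hk.block a b (by unfold SameBlock; rw [Fin.lt_def] at hab; omega) hab
      have e1 := hu.permRank_le m j
      have e2 := hw.permRank_le m i
      have e3 : ∑ a : Fin n, (if (j : ℤ) < ((u a : ℕ) : ℤ) + 1 + blockShift k a -
          (if (w a : ℕ) < i then 0 else (n : ℤ)) then 1 else 0) + permRank w m i ≤
          k + permRank u m j := by
        rw [permRank_eq_sum, permRank_eq_sum]
        nth_rewrite 3 [← sum_ite_val_lt hkn]
        rw [← Finset.sum_add_distrib, ← Finset.sum_add_distrib]
        apply Finset.sum_le_sum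
        intro a _
        have := hm3 a
        have := hm4 a
        have := (u a).2
        rcases lt_or_ge (a : ℕ) k with ha | ha
        · rw [blockShift_of_lt ha]
          split_ifs <;> omega
        · rw [blockShift_of_ge ha]
          split_ifs <;> omega
      have e4 : k + permRank u' m j ≤ ∑ a : Fin n, (if (j : ℤ) < ((u' a : ℕ) : ℤ) + 1 +
          blockShift k a - (if (w' a : ℕ) < i then 0 else (n : ℤ)) then 1 else 0) +
          permRank w' m i := by
        rw [permRank_eq_sum, permRank_eq_sum]
        nth_rewrite 1 [← sum_ite_val_lt hkn]
        rw [← Finset.sum_add_distrib, ← Finset.sum_add_distrib]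
        apply Finset.sum_le_sum
        intro a _
        have := (u' a).2
        rcases lt_or_ge (a : ℕ) k with ha | ha
        · have := Fin.le_def.1 (hk'.lower a ha)
          rw [blockShift_of_lt ha]
          split_ifs <;> omega
        · rw [blockShift_of_ge ha]
          split_ifs <;> omega
      omega
    · obtain ⟨j, rfl⟩ := Nat.exists_eq_add_of_le hjn.le
      obtain ⟨m, hm1, hm2, hm3, hm4⟩ := exists_first_defect u w i j (Nat.zero_le k)
        fun a b ha hb hab => hk.block a b (by unfold SameBlock; rw [Fin.lt_def] at hab; omega) hab
      have e1 := hu.permRank_le m j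
      have e2 := hw.permRank_le m i
      have e3 : ∑ a : Fin n, (if ((n + j : ℕ) : ℤ) < ((u a : ℕ) : ℤ) + 1 + blockShift k a -
          (if (w a : ℕ) < i then 0 else (n : ℤ)) then 1 else 0) + permRank w m i ≤
          permRank u m j := by
        rw [permRank_eq_sum, permRank_eq_sum, ← Finset.sum_add_distrib]
        apply Finset.sum_le_sum
        intro a _
        have := hm3 a
        have := hm4 a
        have := (u a).2
        rcases lt_or_ge (a : ℕ) k with ha | ha
        · rw [blockShift_of_lt ha]
          split_ifs <;> omega
        · rw [blockShift_of_ge ha]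
          split_ifs <;> omega
      have e4 : permRank u' m j ≤ ∑ a : Fin n, (if ((n + j : ℕ) : ℤ) < ((u' a : ℕ) : ℤ) + 1 +
          blockShift k a - (if (w' a : ℕ) < i then 0 else (n : ℤ)) then 1 else 0) +
          permRank w' m i := by
        rw [permRank_eq_sum, permRank_eq_sum, ← Finset.sum_add_distrib]
        apply Finset.sum_le_sum
        intro a _
        have := (u' a).2
        rcases lt_or_ge (a : ℕ) k with ha | ha
        · rw [blockShift_of_lt ha]
          split_ifs <;> omega
        · rw [blockShift_of_ge ha]
          split_ifs <;> omega
      omega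
  intro i j
  rcases lt_or_ge j i with hij | hij
  · have h1 := f.overRank_below hkn hij
    have h2 := f'.overRank_below hkn hij
    omega
  · obtain ⟨p, q, rfl⟩ := exists_fin_translate hn i
    obtain ⟨j, rfl⟩ : ∃ j', j = j' + q * n := ⟨j - q * n, by ring⟩
    rw [overRank_translate f.1, overRank_translate f'.1]
    exact hmain p j p.2.le (by linarith)

end Pairs

end PositroidPosets

namespace PositroidPosets

section Classes

variable {k n : ℕ}

/-! ### Canonical representatives -/

/-- The pair `(u, w)` of a bounded affine permutation for which `w` is Grassmannian. -/
theorem Bound.exists_pair (f : Bound k n) (hkn : k ≤ n) : ∃ u w : Equiv.Perm (Fin n),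
    IsPairWindow f u w ∧ KCriterion k u w ∧
      ∀ a b : Fin n, SameBlock k a b → a < b → w a < w b := by
  rcases Nat.eq_zero_or_pos n with hn | hn
  · subst hn
    exact ⟨1, 1, fun i => i.elim0, .refl k 1, fun a => a.elim0⟩
  -- Sorting by this key lists first the positions with value beyond `n`, then the others, each
  -- group in increasing order.
  let key : Fin n → ℤ := fun x => (x : ℕ) + if (n : ℤ) < f (((x : ℕ) : ℤ) + 1) then 0 else (n : ℤ)
  let w : Equiv.Perm (Fin n) := Tuple.sort key
  have hmono : Monotone (key ∘ w) := Tuple.monotone_sort key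
  have hkey : ∀ x, key x < n ↔ (n : ℤ) < f (((x : ℕ) : ℤ) + 1) := by
    intro x
    have := x.2
    simp only [key]
    split_ifs with h <;> simp only [h, iff_true, iff_false] <;> omega
  -- The size of the first group is the diagonal rank at `(n + 1, n)`, namely `k`.
  have hcard : (Finset.univ.filter fun a => (key ∘ w) a < (n : ℤ)).card = k := by
    have h1 := f.overRank_diag hkn n
    rw [← h1, overRank]
    rw [← Set.ncard_coe_finset, ← Set.ncard_image_of_injective (f := fun a : Fin n =>
      ((w a : ℕ) : ℤ) + 1) _ (fun a b hab => w.injective (Fin.ext (by simpa using hab)))]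
    congr 1
    ext l
    simp only [overtaking, Set.mem_ofPred_eq, Finset.coe_filter, Finset.mem_univ, true_and,
      Set.mem_image, Function.comp, hkey]
    constructor
    · rintro ⟨a, ha, rfl⟩
      exact ⟨by omega, ha⟩
    · rintro ⟨h2, h3⟩
      have h4 := f.le_add l
      refine ⟨w.symm ⟨(l - 1).toNat, by omega⟩, ?_, ?_⟩
      · rw [Equiv.apply_symm_apply]
        simp only
        rwa [show (((l - 1).toNat : ℕ) : ℤ) + 1 = l by omega]
      · rw [Equiv.apply_symm_apply]
        simp only
        omega
  have hblock : ∀ a : Fin n, (a : ℕ) < k ↔ (n : ℤ) < f (((w a : ℕ) : ℤ) + 1) := by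
    intro a
    rw [← hkey, ← hcard]
    exact Tuple.lt_card_lt_iff_apply_lt_of_monotone hmono
  have hw : ∀ a b : Fin n, SameBlock k a b → a < b → w a < w b := by
    intro a b hab hlt
    unfold SameBlock at hab
    rw [hblock, hblock] at hab
    have h1 := hmono hlt.le
    simp only [Function.comp, key, hab] at h1
    have h2 : w a ≠ w b := fun h => hlt.ne (w.injective h)
    refine lt_of_le_of_ne ?_ h2
    rw [Fin.le_def]
    omega
  have hu : ∀ a : Fin n, ∃ x : Fin n,
      f (((w a : ℕ) : ℤ) + 1) = ((x : ℕ) : ℤ) + 1 + blockShift k a := by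
    intro a
    have h1 := f.2.1 (((w a : ℕ) : ℤ) + 1)
    have h2 := hblock a
    have h3 := (w a).2
    rcases lt_or_ge (a : ℕ) k with ha | ha
    · rw [blockShift_of_lt ha]
      exact ⟨⟨(f (((w a : ℕ) : ℤ) + 1) - n - 1).toNat, by omega⟩, by simp only; omega⟩
    · rw [blockShift_of_ge ha]
      exact ⟨⟨(f (((w a : ℕ) : ℤ) + 1) - 1).toNat, by omega⟩, by simp only; omega⟩
  choose u hu using hu
  -- Equal `u`-values mean `f`-values differing by a multiple of `n`, hence congruent positions
  -- within one period.
  have hinj : Function.Injective u := by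
    intro a b hab
    have h1 := hu a
    have h2 := hu b
    rw [hab] at h1
    have ha := (w a).2
    have hb := (w b).2
    have key' : ∀ q : ℤ, f (((w a : ℕ) : ℤ) + 1) = f (((w b : ℕ) : ℤ) + 1 + q * n) → q = 0 →
        a = b := by
      rintro q hq rfl
      have := f.1.1.injective hq
      exact w.injective (Fin.ext (by simpa using this))
    have hne : ∀ q : ℤ, f (((w a : ℕ) : ℤ) + 1) = f (((w b : ℕ) : ℤ) + 1 + q * n) → q = 0 := by
      intro q hq
      have h3 := f.1.1.injective hq
      have := translate_unique (n := n) (i := (w a : ℕ) + 1) (j := (w b : ℕ) + 1) (q := 0) (r := q)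
        (by omega) (by omega) (by omega) (by omega) (by rw [zero_mul, add_zero, h3])
      exact this.2.symm
    have hex : ∃ q : ℤ, blockShift k a = blockShift k b + q * n := by
      unfold blockShift
      split_ifs
      · exact ⟨0, by ring⟩
      · exact ⟨1, by ring⟩
      · exact ⟨-1, by ring⟩
      · exact ⟨0, by ring⟩
    obtain ⟨q, hq⟩ := hex
    have h4 : f (((w a : ℕ) : ℤ) + 1) = f (((w b : ℕ) : ℤ) + 1 + q * n) := by
      rw [affinePerm_translate f.1, h1, h2, hq]
      ring
    exact key' q h4 (hne q h4)
  have hwin : IsPairWindow f (Equiv.ofBijective u (Finite.injective_iff_bijective.1 hinj)) w :=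
    isPairWindow_iff.2 hu
  exact ⟨_, w, hwin, hwin.kCriterion fun a b hab hlt _ => hw a b hab hlt, hw⟩

/-- Split the inversions of `x * z` by whether `z` inverts them. By hypothesis every inversion of
`z` occurs; the rest are carried by `z` onto the inversions of `x`. -/
theorem permLength_mul {x z : Equiv.Perm (Fin n)}
    (h : ∀ c d, c < d → z d < z c → x (z d) < x (z c)) :
    permLength (x * z) = permLength x + permLength z := by
  unfold permLength
  rw [← Finset.card_filter_add_card_filter_not (s := Finset.univ.filter fun p : Fin n × Fin n =>
    p.1 < p.2 ∧ (x * z) p.2 < (x * z) p.1) (fun p => z p.2 < z p.1), add_comm,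
    Finset.filter_filter, Finset.filter_filter]
  congr 1
  · refine Finset.card_bij (fun p _ => (z p.1, z p.2)) ?_ ?_ ?_
    · rintro ⟨c, d⟩ hp
      simp only [Finset.mem_filter, Finset.mem_univ, true_and, Equiv.Perm.mul_apply, not_lt] at hp ⊢
      exact ⟨lt_of_le_of_ne hp.2 fun he => hp.1.1.ne (z.injective he), hp.1.2⟩
    · rintro ⟨c, d⟩ _ ⟨c', d'⟩ _ he
      simpa using he
    · rintro ⟨c, d⟩ hp
      simp only [Finset.mem_filter, Finset.mem_univ, true_and] at hp
      refine ⟨(z.symm c, z.symm d), ?_, by simp⟩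
      simp only [Finset.mem_filter, Finset.mem_univ, true_and, Equiv.Perm.mul_apply,
        Equiv.apply_symm_apply, not_lt]
      refine ⟨⟨?_, hp.2⟩, hp.1.le⟩
      by_contra hc
      have hne : z.symm c ≠ z.symm d := fun he => hp.1.ne (z.symm.injective he)
      have := h (z.symm d) (z.symm c) (lt_of_le_of_ne (not_lt.1 hc) hne.symm) (by simpa using hp.1)
      rw [Equiv.apply_symm_apply, Equiv.apply_symm_apply] at this
      exact this.not_gt hp.2
  · refine congrArg Finset.card (Finset.ext fun ⟨c, d⟩ => ?_)
    rw [Finset.mem_filter, Finset.mem_filter]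
    simp only [Finset.mem_univ, true_and, Equiv.Perm.mul_apply]
    exact ⟨fun hp => ⟨hp.1.1, hp.2⟩, fun hp => ⟨⟨hp.1, h c d hp.1 hp.2⟩, hp.2⟩⟩

/-- Every pair is equivalent to the Grassmannian pair with the same bounded affine permutation. -/
theorem IsPairWindow.rel {f : Bound k n} {u w u₀ w₀ : Equiv.Perm (Fin n)}
    (h : IsPairWindow f u w) (h₀ : IsPairWindow f u₀ w₀) (hk : KBruhatLE k u w)
    (hk₀ : KBruhatLE k u₀ w₀) (hw₀ : ∀ a b : Fin n, SameBlock k a b → a < b → w₀ a < w₀ b) :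
    KInterval.Rel (⟨(u₀, w₀), hk₀⟩ : KInterval k n) ⟨(u, w), hk⟩ := by
  rw [isPairWindow_iff] at h h₀
  set z := w₀⁻¹ * w with hz
  have hwz : ∀ a, w a = w₀ (z a) := fun a => by
    rw [hz, Equiv.Perm.mul_apply]
    exact (w₀.apply_symm_apply _).symm
  -- Both windows give the same value of `f`; modulo `n` this identifies the `u`-entries, and the
  -- quotient identifies the blocks.
  have huz : ∀ a, u a = u₀ (z a) ∧ ((a : ℕ) < k ↔ ((z a : Fin n) : ℕ) < k) := by
    intro a
    have h1 := h a
    have h2 := h₀ (z a)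
    rw [← hwz, h1] at h2
    have := (u a).2
    have := (u₀ (z a)).2
    unfold blockShift at h2
    rw [Fin.ext_iff]
    split_ifs at h2 <;> omega
  have hinv : ∀ c d, c < d → z d < z c → SameBlock k c d ∧ SameBlock k (z d) (z c) := by
    intro c d hcd hlt
    have h1 := (huz c).2
    have h2 := (huz d).2
    rw [Fin.lt_def] at hcd hlt
    unfold SameBlock
    omega
  refine ⟨z, fun a => (huz a).2, Equiv.ext fun a => (huz a).1, ?_, Equiv.ext hwz, ?_⟩
  · have hu : u = u₀ * z := Equiv.ext fun a => (huz a).1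
    change permLength u = permLength u₀ + permLength z
    rw [hu]
    apply permLength_mul
    intro c d hcd hlt
    obtain ⟨h1, h2⟩ := hinv c d hcd hlt
    have h3 := hw₀ _ _ h2 hlt
    rw [← (huz c).1, ← (huz d).1]
    by_contra hc
    have hne : u c ≠ u d := fun he => hcd.ne (u.injective he)
    have h4 := hk.kCriterion.block c d h1 hcd (lt_of_le_of_ne (not_lt.1 hc) hne)
    rw [hwz, hwz] at h4
    exact h4.not_gt h3
  · have hw : w = w₀ * z := Equiv.ext hwz
    change permLength w = permLength w₀ + permLength z
    conv_lhs => rw [hw]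
    apply permLength_mul
    intro c d hcd hlt
    exact hw₀ _ _ (hinv c d hcd hlt).2 hlt

theorem IsPairWindow.mk_eq (hkn : k ≤ n) {f : Bound k n} {u w u' w' : Equiv.Perm (Fin n)}
    (h : IsPairWindow f u w) (h' : IsPairWindow f u' w') (hk : KBruhatLE k u w)
    (hk' : KBruhatLE k u' w') : PairClass.mk u w hk = PairClass.mk u' w' hk' := by
  obtain ⟨u₀, w₀, h₀, hk₀, hw₀⟩ := f.exists_pair hkn
  exact (Quot.sound (h.rel h₀ hk hk₀.kBruhatLE hw₀)).symm.trans
    (Quot.sound (h'.rel h₀ hk' hk₀.kBruhatLE hw₀))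

/-- In `u t w⁻¹`, the factor `z` cancels because it preserves the blocks on which the shift is
constant. -/
theorem pairWindow_of_rel {p q : KInterval k n} (h : KInterval.Rel p q) :
    pairWindow k q.1.1 q.1.2 = pairWindow k p.1.1 p.1.2 := by
  obtain ⟨z, hz, hu, _, hw, _⟩ := h
  funext i
  have h1 : q.1.2⁻¹ i = z⁻¹ (p.1.2⁻¹ i) := by rw [hw, mul_inv_rev, Equiv.Perm.mul_apply]
  have h2 : z (z⁻¹ (p.1.2⁻¹ i)) = p.1.2⁻¹ i := z.apply_symm_apply _
  unfold pairWindow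
  have h3 := hz (z⁻¹ (p.1.2⁻¹ i))
  rw [h2] at h3
  rw [h1, hu, Equiv.Perm.mul_apply, h2]
  simp only [h3]

/-! ### Lifting covers to pairs -/

theorem IsReflection.translate {a b : ℤ} {t : affinePerm n} (h : IsReflection a b t) (m : ℤ) :
    IsReflection (a + m * n) (b + m * n) t where
  lt := by have := h.lt; omega
  not_modEq := by
    rw [add_sub_add_right_eq_sub]; exact h.not_modEq
  left q := by
    rw [add_assoc, ← add_mul, h.left, add_mul, add_assoc]
  right q := by
    rw [add_assoc, ← add_mul, h.right, add_mul, add_assoc]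
  other x h1 h2 := by
    apply h.other x
    · intro h3
      apply h1
      rw [← sub_sub]
      exact dvd_sub h3 (dvd_mul_left _ _)
    · intro h3
      apply h2
      rw [← sub_sub]
      exact dvd_sub h3 (dvd_mul_left _ _)

/-- Isolates the only dangerous comparisons after raising `u`: a position left of `a`, or right of
`b`, whose value lies between `u a` and `u b`. -/
theorem block_mul_swap_left {u w : Equiv.Perm (Fin n)} {a b : Fin n}
    (hb : ∀ c d : Fin n, SameBlock k c d → c < d → u c < u d → w c < w d) (hu : u a < u b)
    (hab : SameBlock k a b → a < b)
    (ha : ∀ c, SameBlock k c a → c < a → u a < u c → u c < u b → ¬ w a < w c)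
    (hb' : ∀ d, SameBlock k b d → b < d → u a < u d → u d < u b → ¬ w d < w b) (c d : Fin n)
    (hcd : SameBlock k c d) (hlt : c < d)
    (h : (u * Equiv.swap a b) c < (u * Equiv.swap a b) d) : w c < w d := by
  have aux : ∀ (v : Equiv.Perm (Fin n)) (x y : Fin n), x < y → ¬ v y < v x → v x < v y :=
    fun v x y hxy h => lt_of_le_of_ne (not_lt.1 h) fun he => hxy.ne (v.injective he)
  rw [Equiv.Perm.mul_apply, Equiv.Perm.mul_apply] at h
  by_cases hca : c = a
  · subst hca
    rw [Equiv.swap_apply_left] at h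
    by_cases hdb : d = b
    · subst hdb
      rw [Equiv.swap_apply_right] at h
      exact absurd h hu.asymm
    · rw [Equiv.swap_apply_of_ne_of_ne hlt.ne' hdb] at h
      exact hb c d hcd hlt (hu.trans h)
  by_cases hcb : c = b
  · subst hcb
    rw [Equiv.swap_apply_right] at h
    by_cases hda : d = a
    · subst hda
      exact absurd hlt (hab hcd.symm).asymm
    · rw [Equiv.swap_apply_of_ne_of_ne hda hlt.ne'] at h
      by_cases hdc : u d < u c
      · exact aux w c d hlt (hb' d hcd hlt h hdc)
      · exact hb c d hcd hlt (aux u c d hlt hdc)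
  rw [Equiv.swap_apply_of_ne_of_ne hca hcb] at h
  by_cases hda : d = a
  · subst hda
    rw [Equiv.swap_apply_left] at h
    by_cases hdc : u d < u c
    · exact aux w c d hlt (ha c hcd hlt hdc h)
    · exact hb c d hcd hlt (aux u c d hlt hdc)
  by_cases hdb : d = b
  · subst hdb
    rw [Equiv.swap_apply_right] at h
    exact hb c d hcd hlt (h.trans hu)
  rw [Equiv.swap_apply_of_ne_of_ne hda hdb] at h
  exact hb c d hcd hlt h

/-- The counterpart for lowering `w`: dangerous are positions right of `a`, or left of `b`, in its
own block with `w`-value between `w a` and `w b`. -/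
theorem block_mul_swap_right {u w : Equiv.Perm (Fin n)} {a b : Fin n}
    (hb : ∀ c d : Fin n, SameBlock k c d → c < d → u c < u d → w c < w d) (hw : w a < w b)
    (hab : SameBlock k a b → b < a ∧ u a < u b)
    (ha : ∀ d, SameBlock k a d → a < d → u a < u d → w a < w d → ¬ w d < w b)
    (hb' : ∀ c, SameBlock k c b → c < b → u c < u b → w c < w b → ¬ w a < w c) (c d : Fin n)
    (hcd : SameBlock k c d) (hlt : c < d) (h : u c < u d) :
    (w * Equiv.swap a b) c < (w * Equiv.swap a b) d := by
  have aux : ∀ x y : Fin n, x ≠ y → ¬ w y < w x → w x < w y :=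
    fun x y hxy h => lt_of_le_of_ne (not_lt.1 h) fun he => hxy (w.injective he)
  have h' := hb c d hcd hlt h
  rw [Equiv.Perm.mul_apply, Equiv.Perm.mul_apply]
  by_cases hca : c = a
  · subst hca
    rw [Equiv.swap_apply_left]
    by_cases hdb : d = b
    · subst hdb
      exact absurd hlt (hab hcd).1.asymm
    · rw [Equiv.swap_apply_of_ne_of_ne hlt.ne' hdb]
      exact aux b d (Ne.symm hdb) (ha d hcd hlt h h')
  by_cases hcb : c = b
  · subst hcb
    rw [Equiv.swap_apply_right]
    by_cases hda : d = a
    · subst hda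
      exact absurd h (hab hcd.symm).2.asymm
    · rw [Equiv.swap_apply_of_ne_of_ne hda hlt.ne']
      exact hw.trans h'
  rw [Equiv.swap_apply_of_ne_of_ne hca hcb]
  by_cases hda : d = a
  · subst hda
    rw [Equiv.swap_apply_left]
    exact h'.trans hw
  by_cases hdb : d = b
  · subst hdb
    rw [Equiv.swap_apply_right]
    exact aux c a hca (hb' c hcd hlt h h')
  rwa [Equiv.swap_apply_of_ne_of_ne hda hdb]

/-- Every cover in `Bound(k,n)` lifts to any pair that represents its smaller element. -/
theorem BoundCover.exists_pair (hn : 0 < n) {f g : Bound k n} {u w : Equiv.Perm (Fin n)}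
    (hfg : BoundCover f g) (h : IsPairWindow f u w) (hk : KCriterion k u w) :
    ∃ u' w' : Equiv.Perm (Fin n), BruhatLE u u' ∧ BruhatLE w' w ∧ KCriterion k u' w' ∧
      IsPairWindow g u' w' := by
  obtain ⟨p, q, t, ht, hpq, hem, hg⟩ := hfg
  obtain ⟨i, m, rfl⟩ := exists_fin_translate hn p
  obtain ⟨a, rfl⟩ := w.surjective i
  obtain ⟨j, s, hq⟩ := exists_fin_translate hn (q - m * n)
  obtain ⟨b, rfl⟩ := w.surjective j
  obtain rfl : q = ((w b : ℕ) : ℤ) + 1 + (s + m) * n := by linarith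
  have ht' := ht.translate (-m)
  rw [show ((w a : ℕ) : ℤ) + 1 + m * n + -m * n = (w a : ℕ) + 1 by ring,
    show ((w b : ℕ) : ℤ) + 1 + (s + m) * n + -m * n = (w b : ℕ) + 1 + s * n by ring] at ht'
  rw [h.apply, h.apply] at hpq hem
  have hemp : ∀ (c : Fin n) (r : ℤ), ((w a : ℕ) : ℤ) < (w c : ℕ) + r * n →
      ((w c : ℕ) : ℤ) + r * n < (w b : ℕ) + s * n →
      ((u a : ℕ) : ℤ) + blockShift k a < (u c : ℕ) + blockShift k c + r * n →
      ¬ ((u c : ℕ) : ℤ) + blockShift k c + r * n < (u b : ℕ) + blockShift k b + s * n := by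
    intro c r h1 h2 h3 h4
    refine hem ((w c : ℕ) + 1 + (r + m) * n) (by linarith) (by linarith) ?_ ?_ <;>
    rw [h.apply] <;> linarith
  have hga : g ((w a : ℕ) + 1) = (u b : ℕ) + 1 + blockShift k b + s * n := by
    have : g ((w a : ℕ) + 1) = f (t.1 ((w a : ℕ) + 1)) := by rw [hg]; rfl
    rw [this, ht'.apply_left, h.apply]
  have hgb : g ((w b : ℕ) + 1 + s * n) = (u a : ℕ) + 1 + blockShift k a := by
    have : g ((w b : ℕ) + 1 + s * n) = f (t.1 ((w b : ℕ) + 1 + s * n)) := by rw [hg]; rfl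
    rw [this, ht'.apply_right, isPairWindow_iff.1 h]
  have hgb' : g ((w b : ℕ) + 1) = (u a : ℕ) + 1 + blockShift k a - s * n := by
    rw [← hgb, affinePerm_translate g.1]
    ring
  have hgc : ∀ c, c ≠ a → c ≠ b → g ((w c : ℕ) + 1) = (u c : ℕ) + 1 + blockShift k c := by
    intro c hca hcb
    have hdvd : ∀ (x : Fin n) (r : ℤ), c ≠ x →
        ¬ (n : ℤ) ∣ ((w c : ℕ) : ℤ) + 1 - ((w x : ℕ) + 1 + r * n) := by
      rintro x r hcx ⟨l, hl⟩
      have h1 := translate_unique (n := n) (i := (w c : ℕ) + 1) (j := (w x : ℕ) + 1) (q := 0)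
        (r := r + l) (by omega) (by omega) (by omega) (by omega) (by linarith)
      exact hcx (w.injective (Fin.ext (by omega)))
    have : g ((w c : ℕ) + 1) = f (t.1 ((w c : ℕ) + 1)) := by rw [hg]; rfl
    rw [this, ht'.other _ (by simpa using hdvd a 0 hca) (hdvd b s hcb), isPairWindow_iff.1 h]
  have hlt := ht'.lt
  have hb1 := (g.2.1 (((w b : ℕ) : ℤ) + 1 + s * n)).1
  have hb2 := g.le_add (((w a : ℕ) : ℤ) + 1)
  rw [hga] at hb2
  change _ ≤ g _ at hb1
  rw [hgb] at hb1
  have hwa := (w a).2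
  have hwb := (w b).2
  have hua := (u a).2
  have hub := (u b).2
  -- The cover exchanges the values at `w a + 1` and `w b + 1 + s * n`; the order of these positions
  -- and the bounds on `g` limit `s`.
  have hs : s = 0 ∨ s = 1 := by
    have h1 : blockShift k a ≤ n := by unfold blockShift; split_ifs <;> omega
    have h2 : -1 < s := by
      by_contra hc
      nlinarith
    have h3 : s < 2 := by
      by_contra hc
      nlinarith
    omega
  have hshift : ∀ {x y : Fin n}, SameBlock k x y → blockShift k x = blockShift k y := by
    intro x y hxy
    simp only [blockShift, show ((x : ℕ) < k ↔ (y : ℕ) < k) from hxy]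
  rcases hs with rfl | rfl
  · rw [zero_mul, add_zero] at hlt hb1 hga
    rw [zero_mul, sub_zero] at hgb'
    rw [zero_add] at hpq
    rw [zero_mul, add_zero] at hb2
    have hemp' : ∀ c : Fin n, (w a : ℕ) < w c → (w c : ℕ) < w b →
        ((u a : ℕ) : ℤ) + blockShift k a < (u c : ℕ) + blockShift k c →
        ¬ ((u c : ℕ) : ℤ) + blockShift k c < (u b : ℕ) + blockShift k b := by
      intro c
      have := hemp c 0
      simpa using this
    -- If `a` precedes `b` in the same block, `u` is raised. Otherwise `b < a`, since values in the
    -- first block exceed those in the second, and `w` is lowered.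
    by_cases hblk : SameBlock k a b ∧ a < b
    · obtain ⟨hblk, hab⟩ := hblk
      have hbs := hshift hblk
      have hu : u a < u b := by rw [Fin.lt_def]; omega
      have hwin : IsPairWindow g (u * Equiv.swap a b) w := by
        rw [isPairWindow_iff]
        intro c
        rw [Equiv.Perm.mul_apply, Equiv.swap_apply_def]
        split_ifs with h1 h2
        · rw [h1, hga, hbs]
        · rw [h2, hgb', hbs]
        · exact hgc c h1 h2
      refine ⟨_, w, .single (bruhatStep_iff.2 ⟨a, b, hab, hu, rfl⟩), .refl,
        hwin.kCriterion (block_mul_swap_left hk.block hu (fun _ => hab) ?_ ?_), hwin⟩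
      · intro c hc hca hac hcb hlt'
        have := Fin.lt_def.1 (hk.block c b (hc.trans hblk) (hca.trans hab) hcb)
        have := hemp' c hlt' this
        have := hshift hc
        rw [Fin.lt_def] at hac hcb
        omega
      · intro d hd hbd had hdb hlt'
        have := Fin.lt_def.1 (hk.block a d (hblk.trans hd) (hab.trans hbd) had)
        have := hemp' d this hlt'
        have := hshift hd
        rw [Fin.lt_def] at had hdb
        omega
    · have hne : a ≠ b := by rintro rfl; omega
      have hw : w a < w b := by rw [Fin.lt_def]; omega
      have hab : b < a := by
        by_contra hc
        have hc' : a < b := lt_of_le_of_ne (not_lt.1 hc) hne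
        have hnb : ¬ SameBlock k a b := fun h => hblk ⟨h, hc'⟩
        rw [Fin.lt_def] at hc'
        unfold SameBlock at hnb
        rw [blockShift_of_lt (by omega), blockShift_of_ge (by omega)] at hpq
        omega
      have hwin : IsPairWindow g u (w * Equiv.swap a b) := by
        rw [isPairWindow_iff]
        intro c
        rw [Equiv.Perm.mul_apply, Equiv.swap_apply_def]
        split_ifs with h1 h2
        · rw [h1, hgb']
        · rw [h2, hga]
        · exact hgc c h1 h2
      have hstep : BruhatStep (w * Equiv.swap a b) w := by
        refine bruhatStep_iff.2 ⟨b, a, hab, ?_, ?_⟩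
        · simpa using hw
        · rw [mul_assoc, Equiv.swap_comm b a, Equiv.swap_mul_self, mul_one]
      refine ⟨u, _, .refl, .single hstep, hwin.kCriterion
        (block_mul_swap_right hk.block hw (fun hs => ⟨hab, ?_⟩) ?_ ?_), hwin⟩
      · have := hshift hs
        rw [Fin.lt_def]
        omega
      · intro d hd had hud hwd hlt'
        have h1 := hemp' d hwd hlt'
        have h2 := hshift hd
        rw [Fin.lt_def] at hud
        by_cases hs : SameBlock k a b
        · have h3 := hshift hs
          have hne : u b ≠ u d := fun he => (hab.trans had).ne (u.injective he)
          have h4 := hk.block b d (hs.symm.trans hd) (hab.trans had)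
            (lt_of_le_of_ne (Fin.le_def.2 (by omega)) hne)
          exact h4.not_gt hlt'
        · unfold SameBlock at hd hs
          rw [Fin.lt_def] at hab
          have h3 : k ≤ (d : ℕ) := by omega
          rw [blockShift_of_ge h3, blockShift_of_lt (show (b : ℕ) < k by omega)] at h1
          rw [blockShift_of_ge h3] at h2
          have := (u d).2
          omega
      · intro c hc hcb hcu hwc hlt'
        have h1 := hemp' c hlt' hwc
        have h2 := hshift hc
        rw [Fin.lt_def] at hcu
        by_cases hs : SameBlock k a b
        · have h3 := hshift hs
          have hne : u c ≠ u a := fun he => (hcb.trans hab).ne (u.injective he)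
          have h4 := hk.block c a (hc.trans hs.symm) (hcb.trans hab)
            (lt_of_le_of_ne (Fin.le_def.2 (by omega)) hne)
          exact h4.not_gt hlt'
        · unfold SameBlock at hc hs
          rw [Fin.lt_def] at hab
          have h3 : (c : ℕ) < k := by omega
          rw [blockShift_of_lt h3, blockShift_of_ge (show k ≤ (a : ℕ) by omega)] at h1
          rw [blockShift_of_lt h3] at h2
          omega
  · rw [one_mul] at hlt hb1 hga hgb' hb2
    -- For `s = 1` the bounds on `g` force `a` into the first block and `b` into the second, so
    -- swapping in `u` also accounts for the shift by `n`.
    have hak : (a : ℕ) < k := by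
      by_contra hc
      rw [blockShift_of_ge (not_lt.1 hc)] at hb1
      omega
    have hbk : k ≤ (b : ℕ) := by
      by_contra hc
      rw [blockShift_of_lt (not_le.1 hc)] at hb2
      omega
    have hab : a < b := Fin.lt_def.2 (by omega)
    rw [blockShift_of_lt hak, blockShift_of_ge hbk] at hemp hpq
    rw [blockShift_of_lt hak] at hb1 hgb'
    rw [blockShift_of_ge hbk] at hb2 hga
    have hu : u a < u b := Fin.lt_def.2 (by linarith)
    have hwin : IsPairWindow g (u * Equiv.swap a b) w := by
      rw [isPairWindow_iff]
      intro c
      rw [Equiv.Perm.mul_apply, Equiv.swap_apply_def]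
      split_ifs with h1 h2
      · rw [h1, hga, blockShift_of_lt hak]
        ring
      · rw [h2, hgb', blockShift_of_ge hbk]
        ring
      · exact hgc c h1 h2
    refine ⟨_, w, .single (bruhatStep_iff.2 ⟨a, b, hab, hu, rfl⟩), .refl,
      hwin.kCriterion (block_mul_swap_left hk.block hu (fun _ => hab) ?_ ?_), hwin⟩
    · intro c hc hca hac hcb hlt'
      have h1 := hemp c 0
      have := (w c).2
      have h2 : (c : ℕ) < k := hc.2 hak
      rw [blockShift_of_lt h2] at h1
      rw [Fin.lt_def] at hac hcb hlt'
      omega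
    · intro d hd hbd had hdb hlt'
      have h1 := hemp d 1
      have h2 : k ≤ (d : ℕ) := by rw [Fin.lt_def] at hbd; omega
      rw [blockShift_of_ge h2] at h1
      rw [Fin.lt_def] at had hdb hlt'
      omega

theorem IsPairWindow.exists_of_le (hkn : k ≤ n) {f g : Bound k n} {u w : Equiv.Perm (Fin n)}
    (hfg : f ≤ g) (h : IsPairWindow f u w) (hk : KCriterion k u w) :
    ∃ u' w' : Equiv.Perm (Fin n), BruhatLE u u' ∧ BruhatLE w' w ∧ KCriterion k u' w' ∧
      IsPairWindow g u' w' := by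
  rcases Nat.eq_zero_or_pos n with hn | hn
  · obtain rfl := Bound.eq_of_n_eq_zero hn f g
    exact ⟨u, w, .refl, .refl, hk, h⟩
  · have hchain := Bound.reflTransGen_boundCover hkn hn ((Bound.le_iff hkn).1 hfg)
    clear hfg
    induction hchain with
    | refl => exact ⟨u, w, .refl, .refl, hk, h⟩
    | tail _ hcover ih =>
      obtain ⟨u₁, w₁, h1, h2, h3, h4⟩ := ih
      obtain ⟨u₂, w₂, h5, h6, h7, h8⟩ := hcover.exists_pair hn h4 h3
      exact ⟨u₂, w₂, h1.trans h5, h6.trans h2, h7, h8⟩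

end Classes

end PositroidPosets

namespace PositroidPosets

section PairIso

variable {k n : ℕ}

/-! ### The isomorphism from `Q(k,n)` to `Bound(k,n)` -/

/-- The map `⟨u,w⟩ ↦ f_{u,w}`. -/
noncomputable def PairClass.bound (hkn : k ≤ n) : PairClass k n → Bound k n :=
  Quot.lift (fun p => (p.2.kCriterion.exists_bound hkn).choose) fun p q h => by
    have hp := (p.2.kCriterion.exists_bound hkn).choose_spec
    have hq := (q.2.kCriterion.exists_bound hkn).choose_spec
    exact hp.unique fun i => (hq i).trans (congrFun (pairWindow_of_rel h) i)

theorem PairClass.isPairWindow_bound (hkn : k ≤ n) {u w : Equiv.Perm (Fin n)}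
    (h : KBruhatLE k u w) : IsPairWindow ((PairClass.mk u w h).bound hkn) u w :=
  (h.kCriterion.exists_bound hkn).choose_spec

theorem PairClass.exists_mk (q : PairClass k n) :
    ∃ (u w : Equiv.Perm (Fin n)) (h : KBruhatLE k u w), q = PairClass.mk u w h := by
  obtain ⟨⟨⟨u, w⟩, h⟩, rfl⟩ := Quot.exists_rep q
  exact ⟨u, w, h, rfl⟩

theorem PairClass.bound_injective (hkn : k ≤ n) :
    Function.Injective (PairClass.bound hkn : PairClass k n → Bound k n) := by
  intro p q hpq
  obtain ⟨u, w, h, rfl⟩ := p.exists_mk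
  obtain ⟨u', w', h', rfl⟩ := q.exists_mk
  have h1 := PairClass.isPairWindow_bound hkn h
  rw [hpq] at h1
  exact h1.mk_eq hkn (PairClass.isPairWindow_bound hkn h') h h'

theorem PairClass.bound_surjective (hkn : k ≤ n) :
    Function.Surjective (PairClass.bound hkn : PairClass k n → Bound k n) := by
  intro f
  obtain ⟨u, w, hf, hk, _⟩ := f.exists_pair hkn
  exact ⟨PairClass.mk u w hk.kBruhatLE, (PairClass.isPairWindow_bound hkn _).unique hf⟩

theorem PairClass.bound_le_bound_iff (hkn : k ≤ n) {p q : PairClass k n} :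
    p.bound hkn ≤ q.bound hkn ↔ p ≤ q := by
  constructor
  · intro h
    obtain ⟨u, w, hk, rfl⟩ := p.exists_mk
    obtain ⟨u', w', h1, h2, h3, h4⟩ :=
      (PairClass.isPairWindow_bound hkn hk).exists_of_le hkn h hk.kCriterion
    -- Any representative of the smaller class serves: lifting yields `u ≤ u'` and `w' ≤ w`, hence
    -- nested intervals.
    refine ⟨u, w, u', w', hk, h3.kBruhatLE, rfl, ?_, fun v hv => ⟨h1.trans hv.1, hv.2.trans h2⟩⟩
    exact PairClass.bound_injective hkn
      (h4.unique (PairClass.isPairWindow_bound hkn h3.kBruhatLE))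
  · rintro ⟨u, w, u', w', hk, hk', rfl, rfl, hsub⟩
    have h1 : u' ∈ bruhatInterval u w := hsub ⟨.refl, hk'.bruhatLE⟩
    have h2 : w' ∈ bruhatInterval u w := hsub ⟨hk'.bruhatLE, .refl⟩
    exact IsPairWindow.le_of_bruhatLE hkn (PairClass.isPairWindow_bound hkn hk)
      (PairClass.isPairWindow_bound hkn hk') hk.kCriterion hk'.kCriterion h1.1 h2.2

/-- The isomorphism `⟨u,w⟩ ↦ f_{u,w}`. -/
noncomputable def pairIso (hkn : k ≤ n) : PairClass k n ≃o Bound k n where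
  toEquiv := Equiv.ofBijective (PairClass.bound hkn)
    ⟨PairClass.bound_injective hkn, PairClass.bound_surjective hkn⟩
  map_rel_iff' := PairClass.bound_le_bound_iff hkn

/-- The existential over representatives is not visibly transitive or antisymmetric; both properties
are transported from `Bound k n`. -/
theorem isPartialOrder_pairClass (hkn : k ≤ n) : IsPartialOrder (PairClass k n) (· ≤ ·) where
  refl _ := (pairIso hkn).le_iff_le.1 le_rfl
  trans _ _ _ h h' := (pairIso hkn).le_iff_le.1
    (((pairIso hkn).le_iff_le.2 h).trans ((pairIso hkn).le_iff_le.2 h'))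
  antisymm _ _ h h' := (pairIso hkn).injective
    (le_antisymm ((pairIso hkn).le_iff_le.2 h) ((pairIso hkn).le_iff_le.2 h'))

end PairIso

end PositroidPosets

open PositroidPosets

/-! ### The five isomorphic posets -/

theorem theorem3p1 (k n : ℕ) (hkn : k ≤ n) :
    IsPartialOrder (PairClass k n) (· ≤ ·) ∧
    ∃ (φ : PairClass k n ≃o Bound k n) (ψ : Bound k n ≃o Jugg k n)
      (ρ : Bound k n ≃o CyclicRankMatrix k n) (π : Jugg k n ≃o Positroid k n),
      -- `⟨u,w⟩ ↦ f_{u,w} = u t_{ω_k} w⁻¹`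
      (∀ (u w : Equiv.Perm (Fin n)) (h : KBruhatLE k u w) (i : Fin n),
        φ (PairClass.mk u w h) (((i : ℕ) : ℤ) + 1) = pairWindow k u w i) ∧
      -- `f ↦ (st(f,0) ∩ [n], …, st(f,n-1) ∩ [n])`
      (∀ (f : Bound k n) (r a : Fin n),
        a ∈ (ψ f r).1 ↔ ((a : ℕ) : ℤ) + 1 ∈ stateAt f ((r : ℕ) : ℤ)) ∧
      -- `r_{ij} = R_{j-i+1}(J_i ∪ {x ≤ 0})` where `(J_1, …, J_n)` is the juggling pattern of `f`
      (∀ (f : Bound k n) (i : Fin n) (j : ℤ),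
        ρ f (((i : ℕ) : ℤ) + 1) j = stateRank k (toState (ψ f i)) (j - ((i : ℕ) : ℤ))) ∧
      -- conversely, `f` is recovered from the special entries of `r`
      (∀ (f : Bound k n) (i j : ℤ), f i = j ↔
        ρ f i j = ρ f (i + 1) j ∧ ρ f (i + 1) j = ρ f i (j - 1) ∧
          ρ f (i + 1) (j - 1) < ρ f i (j - 1)) ∧
      -- `J ↦ M_J`
      (∀ J : Jugg k n, HasBases (π J).1 (juggBases J)) ∧
      -- the inverse map sends `M` to its sequence of minimal bases
      (∀ (M : Positroid k n) (r : Fin n), IsLeast (rotatedBases M (r : ℕ)) (π.symm M r)) := by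
  refine ⟨isPartialOrder_pairClass hkn, pairIso hkn, juggIso hkn, rankIso hkn, positroidIso hkn,
    fun u w h => PairClass.isPairWindow_bound hkn h, ?_, ?_, fun f => f.apply_eq_iff,
    fun J => Jugg.hasBases_positroid hkn J, ?_⟩
  · intro f r a
    exact mem_windowSet
  · intro f i j
    change f.rank _ j = stateRank k (toState (f.state hkn ((i : ℕ) : ℤ))) _
    rw [f.toState_state, stateRank_eq, ncard_beyond_stateAt, add_sub_cancel, Bound.rank]
  · intro M r
    have h := Jugg.isLeast hkn ((positroidIso hkn).symm M) r
    rwa [← positroidIso_apply hkn, OrderIso.apply_symm_apply] at h
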